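/- Let $k$ be an algebraically closed field of characteristic $0$, let $X$ be a smooth projective (irreducible) surface over $k$, and let $q\colon T^*_X=\operatorname{Spec}_X\operatorname{Sym}\bigl((\Omega^1_{X/k})^\vee\bigr)\to X$ be the total space of its cotangent bundle. For $m\ge 0$ let $(T^*_X)^m_X$ be the $m$-fold fibre power of $T^*_X$ over $X$, and let $\mathrm{Chow}^m(T^*_X/X)=(T^*_X)^m_X/\mathfrak S_m$ be the relative Chow scheme of zero-cycles of degree $m$ in the fibres of $q$, with quotient morphism $(z_1,\dots,z_m)\mapsto z_1+\dots+z_m$. Let $\mu=(1^{\alpha_1},\dots,s^{\alpha_s})$ be a partition of $n$, i.e. $\alpha_j\ge 0$ and $\sum_j j\,\alpha_j=n$. Let $\mathrm{Chow}^n_\mu(T^*_X/X)\subset \mathrm{Chow}^n(T^*_X/X)$ be the stratum of cycles $\sum_b n_b z_b$ with pairwise distinct points $z_b$ (in one fibre of $q$) whose multiplicities $n_b$ are the parts of $\mu$, and give its closure $\overline{\mathrm{Chow}^n_\mu(T^*_X/X)}$ the structure of a reduced closed subscheme. Then: 1. There is exactly one morphism over $X$ $$\tau_\mu\colon \prod_{j=1,\dots,s;\,X}\mathrm{Chow}^{\alpha_j}(T^*_X/X)\longrightarrow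 \mathrm{Chow}^n(T^*_X/X),\qquad (z_1,\dots,z_s)\longmapsto \sum_{j=1}^s j\,z_j ,$$ where the source is the fibre product over $X$; that is, exactly one morphism over $X$ which, composed with the product of the quotient morphisms from $\prod_{j;X}(T^*_X)^{\alpha_j}_X$, is the morphism $(z_{j,i})\mapsto\sum_{j}\sum_{i=1}^{\alpha_j} j\,z_{j,i}$. 2. The scheme $\overline{\mathrm{Chow}^n_\mu(T^*_X/X)}$ is integral, the morphism $\tau_\mu$ factors through it, and the resulting morphism $$\prod_{j;\,X}\mathrm{Chow}^{\alpha_j}(T^*_X/X)\longrightarrow\overline{\mathrm{Chow}^n_\mu(T^*_X/X)}$$ is the normalization of $\overline{\mathrm{Chow}^n_\mu(T^*_X/X)}$. -/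

import Mathlib

open CategoryTheory Limits AlgebraicGeometry TensorProduct

noncomputable section

universe u

namespace CotangentAlgebra
variable (k A B C : Type u) [CommRing k] [CommRing A] [CommRing B] [CommRing C]
  [Algebra k A] [Algebra k B] [Algebra k C] [Algebra A B] [Algebra B C] [Algebra A C]
  [IsScalarTower k A B] [IsScalarTower k B C] [IsScalarTower k A C] [IsScalarTower A B C]

lemma kaehlerMap_id (x : Ω[A⁄k]) : KaehlerDifferential.map k k A A x = x := by
  have hx : x ∈ Submodule.span A (Set.range (KaehlerDifferential.D k A)) := by
    rw [KaehlerDifferential.span_range_derivation]; trivial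
  induction hx using Submodule.span_induction with
  | mem x h => obtain ⟨a, rfl⟩ := h; simp
  | zero => simp
  | add x y _ _ hx hy => simp [hx, hy]
  | smul a x _ hx => simp [hx]

lemma kaehlerMap_comp (x : Ω[A⁄k]) : KaehlerDifferential.map k k A C x =
    KaehlerDifferential.map k k B C (KaehlerDifferential.map k k A B x) := by
  have hx : x ∈ Submodule.span A (Set.range (KaehlerDifferential.D k A)) := by
    rw [KaehlerDifferential.span_range_derivation]; trivial
  induction hx using Submodule.span_induction with
  | mem x h =>
    obtain ⟨a, rfl⟩ := h
    simp [IsScalarTower.algebraMap_apply A B C]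
  | zero => simp
  | add x y _ _ hx hy => simp [hx, hy]
  | smul a x _ hx =>
    rw [map_smul, map_smul, hx, ← algebraMap_smul B a (KaehlerDifferential.map k k A B x),
      map_smul, algebraMap_smul]

/-- The module of vector fields on `Spec A` relative to `k`: the dual of the Kähler differentials. -/
abbrev Tangent (k A : Type u) [CommRing k] [CommRing A] [Algebra k A] : Type u :=
  Module.Dual A Ω[A⁄k]

/-- The algebra of functions on the total space of the cotangent bundle of `Spec A` over `k`:
the symmetric algebra of the module of vector fields. -/
abbrev Functions (k A : Type u) [CommRing k] [CommRing A] [Algebra k A] : Type u :=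
  SymmetricAlgebra A (Tangent k A)

/-- Restriction of vector fields along an étale morphism. -/
def tangentMap [Algebra.FormallyEtale A B] : Tangent k A →ₗ[A] Tangent k B where
  toFun φ := (Module.Dual.baseChange B φ).comp
      (KaehlerDifferential.tensorKaehlerEquivOfFormallyEtale k A B).symm.toLinearMap
  map_add' φ ψ := by ext x; simp
  map_smul' a φ := by ext x; simp

lemma tangentMap_apply [Algebra.FormallyEtale A B] (φ : Tangent k A) (x : Ω[A⁄k]) :
    tangentMap k A B φ (KaehlerDifferential.map k k A B x) = algebraMap A B (φ x) := by
  have : (KaehlerDifferential.tensorKaehlerEquivOfFormallyEtale k A B).symm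
      (KaehlerDifferential.map k k A B x) = 1 ⊗ₜ x := by
    rw [LinearEquiv.symm_apply_eq]; simp [KaehlerDifferential.tensorKaehlerEquivOfFormallyEtale_apply]
  simp [tangentMap, this, Algebra.algebraMap_eq_smul_one]

variable {k A B} in
lemma tangent_ext [Algebra.FormallyEtale A B] {φ ψ : Tangent k B}
    (h : ∀ x : Ω[A⁄k], φ (KaehlerDifferential.map k k A B x) =
      ψ (KaehlerDifferential.map k k A B x)) : φ = ψ := by
  let e := KaehlerDifferential.tensorKaehlerEquivOfFormallyEtale k A B
  ext y
  obtain ⟨x, hx⟩ := e.surjective (KaehlerDifferential.D k B y)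
  suffices φ (KaehlerDifferential.D k B y) = ψ (KaehlerDifferential.D k B y) by simpa
  rw [← hx]
  clear hx
  induction x with
  | zero => simp
  | add a b ha hb => simp [ha, hb]
  | tmul b x => 
    simp [e, KaehlerDifferential.tensorKaehlerEquivOfFormallyEtale_apply, h]

lemma isLocalizedModule_tangentMap [Algebra.FormallyEtale A B] (S : Submonoid A) [IsLocalization S B]
    [Algebra.Smooth k A] : IsLocalizedModule S (tangentMap k A B) := by
  have h1 : IsLocalizedModule S ((KaehlerDifferential.map k k A B)) :=
    inferInstance
  have : tangentMap k A B = IsLocalizedModule.mapExtendScalars S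
    ((KaehlerDifferential.map k k A B)) (Algebra.linearMap A B) B := by
    ext1 φ
    apply tangent_ext (A := A)
    intro x
    rw [tangentMap_apply]
    simp
  rw [this]
  infer_instance

/-- Restriction of functions on the cotangent bundle along an étale morphism. -/
def functionsMap [Algebra.FormallyEtale A B] : Functions k A →ₐ[A] Functions k B :=
  SymmetricAlgebra.lift (((SymmetricAlgebra.ι B (Tangent k B)).restrictScalars A).comp (tangentMap k A B))

@[simp] lemma functionsMap_ι [Algebra.FormallyEtale A B] (φ : Tangent k A) :
   functionsMap k A B (SymmetricAlgebra.ι A _ φ) = SymmetricAlgebra.ι B _ (tangentMap k A B φ) := by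
  simp [functionsMap]

lemma functionsMap_id : functionsMap k A A = AlgHom.id A _ := by
  ext φ
  have : tangentMap k A A φ = φ := by
    apply tangent_ext (A := A)
    intro x
    rw [tangentMap_apply, kaehlerMap_id]
    rfl
  simp [this]

lemma functionsMap_comp [Algebra.FormallyEtale A B] [Algebra.FormallyEtale B C] [Algebra.FormallyEtale A C] :
    ((functionsMap k B C).restrictScalars A).comp (functionsMap k A B) = functionsMap k A C := by
  ext φ
  have : tangentMap k B C (tangentMap k A B φ) = tangentMap k A C φ := by
    apply tangent_ext (A := A)
    intro x
    have : KaehlerDifferential.map k k A C x = KaehlerDifferential.map k k B C (KaehlerDifferential.map k k A B x) :=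
      kaehlerMap_comp k A B C x
    rw [tangentMap_apply, this, tangentMap_apply, tangentMap_apply]
    exact (IsScalarTower.algebraMap_apply A B C _).symm
  simp [this]


lemma isLocalization_functionsMap [Algebra.FormallyEtale A B] (S : Submonoid A)
    [IsLocalization S B] [Algebra.Smooth k A] :
    let _ := (functionsMap k A B).toRingHom.toAlgebra
    IsLocalization (Algebra.algebraMapSubmonoid (Functions k A) S) (Functions k B) := by
  let _ : Algebra (Functions k A) (Functions k B) := (functionsMap k A B).toRingHom.toAlgebra
  have : IsScalarTower A (Functions k A) (Functions k B) :=
    .of_algebraMap_eq fun a => ((functionsMap k A B).commutes a).symm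
  have h := (isLocalizedModule_iff_isBaseChange S B _).mp (isLocalizedModule_tangentMap k A B S)
  let u : B ⊗[A] Functions k A →ₐ[B] Functions k B :=
    Algebra.TensorProduct.lift (Algebra.ofId B _) (functionsMap k A B) fun _ _ => Commute.all _ _
  let v : Functions k B →ₐ[B] B ⊗[A] Functions k A := SymmetricAlgebra.lift
    (((SymmetricAlgebra.ι A (Tangent k A)).baseChange B).comp h.equiv.symm.toLinearMap)
  have huv : u.comp v = AlgHom.id B _ := by
    apply SymmetricAlgebra.algHom_ext
    ext1 y
    obtain ⟨y, rfl⟩ := h.equiv.surjective y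
    induction y with
    | zero => simp
    | add a b ha hb => simp only [map_add, ha, hb]
    | tmul b φ => simp [u, v, h.equiv_tmul, Algebra.ofId_apply, Algebra.smul_def]
  have hvu : v.comp u = AlgHom.id B _ := by
    apply Algebra.TensorProduct.ext
    · ext
    · apply SymmetricAlgebra.algHom_ext
      ext1 φ
      have : h.equiv.symm (tangentMap k A B φ) = 1 ⊗ₜ φ := by
        rw [LinearEquiv.symm_apply_eq, h.equiv_tmul, one_smul]
      simp [u, v, this]
  rw [Algebra.isLocalization_iff_isPushout S B]
  apply Algebra.IsPushout.symm
  constructor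
  change Function.Bijective _
  have hu : Function.Bijective u :=
    (AlgEquiv.ofAlgHom u v huv hvu).bijective
  convert hu using 1
  funext x
  induction x with
  | zero => simp
  | add a b ha hb => simp only [map_add, ha, hb]
  | tmul b φ => simp [u, Algebra.ofId_apply, Algebra.smul_def]; rfl
end CotangentAlgebra

namespace CotangentAlgebra

/-- The algebra of functions on the cotangent bundle of `Spec A`, for a ring map `φ : k → A`. -/
def functionsObj {k A : Type u} [CommRing k] [CommRing A] (φ : k →+* A) : CommRingCat.{u} :=
  letI := φ.toAlgebra
  .of (Functions k A)

/-- The structure map of the algebra of functions on the cotangent bundle. -/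
def functionsBase {k A : Type u} [CommRing k] [CommRing A] (φ : k →+* A) :
    CommRingCat.of A ⟶ functionsObj φ :=
  letI := φ.toAlgebra
  CommRingCat.ofHom (algebraMap A (Functions k A))

/-- The restriction map for functions on cotangent bundles. -/
def functionsHom {k A B : Type u} [CommRing k] [CommRing A] [CommRing B] (φ : k →+* A)
    (ψ : k →+* B) (g : A →+* B) (h : g.comp φ = ψ) (hg : g.FormallyEtale) :
    functionsObj φ ⟶ functionsObj ψ :=
  letI := φ.toAlgebra
  letI := ψ.toAlgebra
  letI := g.toAlgebra
  haveI : IsScalarTower k A B := .of_algebraMap_eq' h.symm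
  haveI : Algebra.FormallyEtale A B := hg
  CommRingCat.ofHom (functionsMap k A B).toRingHom

lemma functionsBase_functionsHom {k A B : Type u} [CommRing k] [CommRing A] [CommRing B]
    (φ : k →+* A) (ψ : k →+* B) (g : A →+* B) (h : g.comp φ = ψ) (hg : g.FormallyEtale) :
    functionsBase φ ≫ functionsHom φ ψ g h hg = CommRingCat.ofHom g ≫ functionsBase ψ := by
  let _ := φ.toAlgebra
  let _ := ψ.toAlgebra
  let _ := g.toAlgebra
  have : IsScalarTower k A B := .of_algebraMap_eq' h.symm
  have : Algebra.FormallyEtale A B := hg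
  ext a
  exact (functionsMap k A B).commutes a

lemma functionsHom_id {k A : Type u} [CommRing k] [CommRing A] (φ : k →+* A)
    (h : (RingHom.id A).comp φ = φ) (hg : (RingHom.id A).FormallyEtale) :
    functionsHom φ φ (RingHom.id A) h hg = 𝟙 _ := by
  let _ := φ.toAlgebra
  ext x
  exact DFunLike.congr_fun (functionsMap_id k A) x

lemma functionsHom_comp {k A B C : Type u} [CommRing k] [CommRing A] [CommRing B] [CommRing C]
    (φ : k →+* A) (ψ : k →+* B) (χ : k →+* C) (g : A →+* B) (g' : B →+* C) (g'' : A →+* C)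
    (hc : g'.comp g = g'') (h h' h'')
    (hg : g.FormallyEtale) (hg' : g'.FormallyEtale) (hg'' : g''.FormallyEtale) :
    functionsHom φ ψ g h hg ≫ functionsHom ψ χ g' h' hg' = functionsHom φ χ g'' h'' hg'' := by
  let _ := φ.toAlgebra
  let _ := ψ.toAlgebra
  let _ := χ.toAlgebra
  let _ := g.toAlgebra
  let _ := g'.toAlgebra
  let _ := g''.toAlgebra
  have : IsScalarTower k A B := .of_algebraMap_eq' h.symm
  have : IsScalarTower k B C := .of_algebraMap_eq' h'.symm
  have : IsScalarTower k A C := .of_algebraMap_eq' h''.symm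
  have : IsScalarTower A B C := .of_algebraMap_eq' hc.symm
  have : Algebra.FormallyEtale A B := hg
  have : Algebra.FormallyEtale B C := hg'
  have : Algebra.FormallyEtale A C := hg''
  ext x
  exact DFunLike.congr_fun (functionsMap_comp k A B C) x

lemma isLocalization_functionsHom {k A B : Type u} [CommRing k] [CommRing A] [CommRing B]
    (φ : k →+* A) (ψ : k →+* B) (g : A →+* B) (h : g.comp φ = ψ) (hg : g.FormallyEtale)
    (hφ : φ.Smooth) (f : A)
    (hf : let _ := g.toAlgebra; IsLocalization.Away f B) :
    let _ := (functionsHom φ ψ g h hg).hom.toAlgebra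
    IsLocalization.Away ((functionsBase φ).hom f) (functionsObj ψ) := by
  let _ := φ.toAlgebra
  let _ := ψ.toAlgebra
  let _ := g.toAlgebra
  have : IsScalarTower k A B := .of_algebraMap_eq' h.symm
  have : Algebra.FormallyEtale A B := hg
  have : Algebra.Smooth k A := hφ
  have : IsLocalization (.powers f) B := hf
  have := isLocalization_functionsMap k A B (.powers f)
  rw [Algebra.algebraMapSubmonoid_powers] at this
  exact this

end CotangentAlgebra

namespace AlgebraicGeometry.Scheme

open AffineZariskiSite

section RelativeSpec

variable {X : Scheme.{u}} {F : X.AffineZariskiSiteᵒᵖ ⥤ CommRingCat.{u}}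
  {α : (toOpensFunctor X).op ⋙ X.presheaf ⟶ F} (H : α.Coequifibered)

/-- The relative spectrum over `X` of a quasi-coherent algebra, given by its sections `F` on the
affine opens of `X`. -/
def relativeSpec : Scheme.{u} := (relativeGluingData H).glued

/-- The structure morphism of the relative spectrum. -/
def relativeSpecToBase : relativeSpec H ⟶ X := (relativeGluingData H).toBase

/-- The cover of the relative spectrum by the spectra of the algebras `F U`. -/
def relativeSpecCover : (relativeSpec H).OpenCover := (relativeGluingData H).cover

instance : IsAffineHom (relativeSpecToBase H) := by
  apply isAffineHom_of_forall_exists_isAffineOpen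
  intro x
  obtain ⟨_, ⟨U, hU, rfl⟩, hxU, -⟩ :=
    X.isBasis_affineOpens.exists_subset_of_mem_open (Set.mem_univ x) isOpen_univ
  refine ⟨U, hxU, hU, ?_⟩
  have : IsOpenImmersion ((relativeSpecCover H).f ⟨U, hU⟩) := (relativeSpecCover H).map_prop _
  have h2 : relativeSpecToBase H ⁻¹ᵁ U = ((relativeSpecCover H).f ⟨U, hU⟩).opensRange := by
    have := (relativeGluingData H).toBase_preimage_eq_opensRange_ι ⟨U, hU⟩
    rw [Opens.opensRange_ι] at this
    exact this
  have : IsAffine ((relativeSpecCover H).X ⟨U, hU⟩) :=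
    inferInstanceAs (IsAffine (Spec _))
  rw [h2]
  exact isAffineOpen_opensRange _

end RelativeSpec

section Cotangent

variable {k : Type u} [CommRing k] {X : Scheme.{u}} (p : X ⟶ Spec (.of k))

/-- The ring map from `k` to the sections over `U` of a scheme over `k`. -/
def structureHom (U : X.Opens) : k →+* Γ(X, U) :=
  ((ΓSpecIso (.of k)).inv ≫ p.appLE ⊤ U (by simp)).hom

lemma structureHom_comp {U V : X.Opens} (i : U ⟶ V) :
    (X.presheaf.map i.op).hom.comp (structureHom p V) = structureHom p U := by
  exact congr(((ΓSpecIso (.of k)).inv ≫ $(p.appLE_map (U := ⊤) (V := V) (by simp) i.op)).hom)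

lemma smooth_structureHom [Smooth p] {U : X.Opens} (hU : IsAffineOpen U) :
    (structureHom p U).Smooth := by
  have := p.smooth_appLE (isAffineOpen_top _) hU (by simp)
  rw [structureHom, CommRingCat.hom_comp]
  exact .comp (.of_bijective (ConcreteCategory.bijective_of_isIso (ΓSpecIso (.of k)).inv)) this

lemma formallyEtale_map {U V : X.AffineZariskiSite} (i : U ⟶ V) :
    (X.presheaf.map ((toOpensFunctor X).map i).op).hom.FormallyEtale := by
  obtain ⟨f, hf⟩ := i.le
  obtain rfl : V.basicOpen f = U := Subtype.ext hf
  have := V.2.isLocalization_basicOpen f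
  let _ := (X.presheaf.map (homOfLE (X.basicOpen_le f)).op).hom.toAlgebra
  exact Algebra.FormallyEtale.of_isLocalization (Rₘ := Γ(X, X.basicOpen f)) (.powers f)

/-- The presheaf `U ↦ Sym Der(Γ(X, U) / k)` on the affine opens of `X`. -/
def cotangentDiagram : X.AffineZariskiSiteᵒᵖ ⥤ CommRingCat.{u} where
  obj U := CotangentAlgebra.functionsObj (structureHom p U.unop.toOpens)
  map {U V} i := CotangentAlgebra.functionsHom _ _
    (X.presheaf.map ((toOpensFunctor X).map i.unop).op).hom (structureHom_comp p _)
    (formallyEtale_map i.unop)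
  map_id U := by
    have : (X.presheaf.map ((toOpensFunctor X).map (𝟙 U.unop)).op).hom = RingHom.id _ := by
      simp
    simp only [unop_id, this]
    apply CotangentAlgebra.functionsHom_id
  map_comp i j := by
    symm
    apply CotangentAlgebra.functionsHom_comp
    exact congr($(X.presheaf.map_comp ((toOpensFunctor X).map i.unop).op
      ((toOpensFunctor X).map j.unop).op).hom).symm

/-- The structure map of the algebra of functions on the cotangent bundle. -/
def cotangentDiagramMap : (toOpensFunctor X).op ⋙ X.presheaf ⟶ cotangentDiagram p where
  app U := CotangentAlgebra.functionsBase (structureHom p U.unop.toOpens)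
  naturality _ _ i := (CotangentAlgebra.functionsBase_functionsHom _ _
    (X.presheaf.map ((toOpensFunctor X).map i.unop).op).hom (structureHom_comp p _)
    (formallyEtale_map i.unop)).symm

lemma coequifibered_cotangentDiagramMap [Smooth p] : (cotangentDiagramMap p).Coequifibered := by
  refine coequifibered_iff_forall_isLocalizationAway.mpr fun U r ↦ ?_
  exact CotangentAlgebra.isLocalization_functionsHom _ _
    (X.presheaf.map ((toOpensFunctor X).map (homOfLE (U.basicOpen_le r))).op).hom
    (structureHom_comp p _) (formallyEtale_map _)
    (smooth_structureHom p U.2) r (U.2.isLocalization_basicOpen r)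

/-- The total space of the cotangent bundle of a smooth scheme over `k`, i.e. the relative
spectrum of the symmetric algebra of the dual of the sheaf of Kähler differentials. -/
def cotangentBundle [Smooth p] : Scheme.{u} := relativeSpec (coequifibered_cotangentDiagramMap p)

/-- The projection of the cotangent bundle. -/
def cotangentBundleToBase [Smooth p] : cotangentBundle p ⟶ X := relativeSpecToBase _

instance [Smooth p] : IsAffineHom (cotangentBundleToBase p) :=
  inferInstanceAs (IsAffineHom (relativeSpecToBase (coequifibered_cotangentDiagramMap p)))
end Cotangent

end AlgebraicGeometry.Scheme

namespace InvariantSubring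

variable {B B' : Type u} {G : Type} [CommRing B] [CommRing B']

/-- The subring fixed by a family of ring endomorphisms. -/
def fixed (σ : G → (B →+* B)) : Subring B := ⨅ g, RingHom.eqLocus (σ g) (RingHom.id B)

lemma mem_fixed {σ : G → (B →+* B)} {b : B} : b ∈ fixed σ ↔ ∀ g, σ g b = b := by
  simp [fixed, Subring.mem_iInf]

/-- The map induced on fixed subrings by an equivariant map. -/
def fixedMap (σ : G → (B →+* B)) (σ' : G → (B' →+* B')) (φ : B →+* B')
    (h : ∀ g b, φ (σ g b) = σ' g (φ b)) : fixed σ →+* fixed σ' :=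
  φ.restrict _ _ fun b hb => by
    rw [mem_fixed] at hb ⊢
    intro g
    rw [← h, hb]

lemma isLocalization_fixedMap [Finite G] (σ : G → (B →+* B)) (σ' : G → (B' →+* B')) (φ : B →+* B')
    (h : ∀ g b, φ (σ g b) = σ' g (φ b)) (b : fixed σ)
    (hb : let _ := φ.toAlgebra; IsLocalization.Away (b : B) B') :
    let _ := (fixedMap σ σ' φ h).toAlgebra
    IsLocalization.Away b (fixed σ') := by
  let _ := φ.toAlgebra
  let _ := (fixedMap σ σ' φ h).toAlgebra
  have hb : IsLocalization.Away (b : B) B' := hb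
  have hφ : ∀ x, algebraMap B B' x = φ x := fun _ => rfl
  have hm : ∀ x : fixed σ, ((algebraMap (fixed σ) (fixed σ') x : fixed σ') : B') = φ x :=
    fun _ => rfl
  have hbφ : ∀ g, σ' g (φ b) = φ b := fun g => by rw [← h, mem_fixed.mp b.2]
  refine ⟨⟨?_, ?_, ?_⟩⟩
  · rintro ⟨_, n, rfl⟩
    obtain ⟨c, hc⟩ := (IsLocalization.Away.algebraMap_isUnit (S := B') (b : B)).exists_right_inv
    rw [hφ] at hc
    have hcf : c ∈ fixed σ' := by
      rw [mem_fixed]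
      intro g
      have : φ b * σ' g c = 1 := by rw [← hbφ g, ← map_mul, hc, map_one]
      calc σ' g c = (φ b * c) * σ' g c := by rw [hc, one_mul]
        _ = c * (φ b * σ' g c) := by ring
        _ = c := by rw [this, mul_one]
    rw [map_pow]
    refine IsUnit.pow _ (IsUnit.of_mul_eq_one ⟨c, hcf⟩ (Subtype.ext ?_))
    exact hc
  · rintro ⟨z, hz⟩
    rw [mem_fixed] at hz
    obtain ⟨n, x, hx⟩ := IsLocalization.Away.surj (b : B) z
    rw [hφ, hφ] at hx
    have key : ∀ g, ∃ m : ℕ, (b : B) ^ m * σ g x = (b : B) ^ m * x := by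
      intro g
      have : algebraMap B B' (σ g x) = algebraMap B B' x := by
        rw [hφ, hφ, h, ← hx, map_mul, map_pow, hz, hbφ]
      obtain ⟨m, hm⟩ := IsLocalization.Away.exists_of_eq (b : B) this
      exact ⟨m, hm⟩
    choose m hm' using key
    obtain ⟨M, hM⟩ := (Set.finite_range m).bddAbove
    have hfix : (b : B) ^ M * x ∈ fixed σ := by
      rw [mem_fixed]
      intro g
      rw [map_mul, map_pow, mem_fixed.mp b.2]
      obtain ⟨d, hd⟩ := Nat.exists_eq_add_of_le (hM ⟨g, rfl⟩)
      rw [hd, pow_add, mul_right_comm, hm', mul_right_comm]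
    refine ⟨⟨⟨_, hfix⟩, ⟨b ^ (M + n), M + n, rfl⟩⟩, Subtype.ext ?_⟩
    simp only [Subring.coe_mul, hm, Subring.coe_pow, map_pow, map_mul]
    rw [← hx]
    ring
  · rintro ⟨x, hx⟩ ⟨y, hy⟩ hxy
    have : algebraMap B B' x = algebraMap B B' y := congr_arg Subtype.val hxy
    obtain ⟨m, hm⟩ := IsLocalization.Away.exists_of_eq (b : B) this
    exact ⟨⟨b ^ m, m, rfl⟩, Subtype.ext hm⟩

end InvariantSubring

namespace AlgebraicGeometry.Scheme

open AffineZariskiSite InvariantSubring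

lemma gluing_w {S : Scheme.{u}} {𝒰 : S.OpenCover} [Category 𝒰.I₀] [𝒰.LocallyDirected]
    (d : Cover.RelativeGluingData 𝒰) [Small.{u} 𝒰.I₀] [Quiver.IsThin 𝒰.I₀] {i j : 𝒰.I₀}
    (h : i ⟶ j) : d.functor.map h ≫ d.cover.f j = d.cover.f i := colimit.w d.functor h

section RelativeSpec

variable {X : Scheme.{u}} {F : X.AffineZariskiSiteᵒᵖ ⥤ CommRingCat.{u}}
  {α : (toOpensFunctor X).op ⋙ X.presheaf ⟶ F} (H : α.Coequifibered)

/-- The affine pieces of the relative spectrum. -/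
def relativeSpecι (U : X.AffineZariskiSite) : Spec (F.obj (.op U)) ⟶ relativeSpec H :=
  (relativeSpecCover H).f U

lemma relativeSpec_w {U V : X.AffineZariskiSite} (i : U ⟶ V) :
    Spec.map (F.map i.op) ≫ relativeSpecι H V = relativeSpecι H U :=
  gluing_w (relativeGluingData H) i

end RelativeSpec

section Quotient

lemma preimage_le_of_comp {X Y : Scheme.{u}} (f : Y ⟶ X) {G : Type} (a : G → (Y ⟶ Y))
    (ha : ∀ g, a g ≫ f = f) (U : X.Opens) (g : G) : f ⁻¹ᵁ U ≤ a g ⁻¹ᵁ f ⁻¹ᵁ U := by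
  rw [← Hom.comp_preimage, ha]

variable {X Y : Scheme.{u}} (f : Y ⟶ X) {G : Type} (a : G → (Y ⟶ Y)) (ha : ∀ g, a g ≫ f = f)

/-- The pullback of functions along `a g`, for the family `a` of endomorphisms of `Y` over `X`. -/
def actionOnSections (U : X.Opens) (g : G) : Γ(Y, f ⁻¹ᵁ U) →+* Γ(Y, f ⁻¹ᵁ U) :=
  ((a g).appLE _ _ (preimage_le_of_comp f a ha U g)).hom

/-- The direct image of the structure sheaf on affine opens. -/
def pushforwardDiagram : X.AffineZariskiSiteᵒᵖ ⥤ CommRingCat.{u} :=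
  (toOpensFunctor X ⋙ TopologicalSpace.Opens.map f.base).op ⋙ Y.presheaf

lemma map_actionOnSections {U V : X.AffineZariskiSiteᵒᵖ} (i : U ⟶ V) (g : G)
    (s : Γ(Y, f ⁻¹ᵁ U.unop.toOpens)) :
    ((pushforwardDiagram f).map i).hom (actionOnSections f a ha U.unop.toOpens g s) =
      actionOnSections f a ha V.unop.toOpens g (((pushforwardDiagram f).map i).hom s) := by
  have h1 := (a g).appLE_map (preimage_le_of_comp f a ha U.unop.toOpens g)
    ((toOpensFunctor X ⋙ TopologicalSpace.Opens.map f.base).map i.unop).op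
  have h2 := (a g).map_appLE (preimage_le_of_comp f a ha V.unop.toOpens g)
    ((toOpensFunctor X ⋙ TopologicalSpace.Opens.map f.base).map i.unop).op
  exact congr($(h1.trans h2.symm).hom s)

/-- The invariants in the direct image of the structure sheaf. -/
def quotientDiagram : X.AffineZariskiSiteᵒᵖ ⥤ CommRingCat.{u} where
  obj U := .of (fixed (actionOnSections f a ha U.unop.toOpens))
  map {U V} i := CommRingCat.ofHom <|
    fixedMap (actionOnSections f a ha U.unop.toOpens) (actionOnSections f a ha V.unop.toOpens)
      ((pushforwardDiagram f).map i).hom (map_actionOnSections f a ha i)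
  map_id U := by
    ext x
    have h := congr($((pushforwardDiagram f).map_id U).hom x.1)
    exact h
  map_comp i j := by
    ext x
    have h := congr($((pushforwardDiagram f).map_comp i j).hom x.1)
    exact h

lemma app_mem_fixed (U : X.Opens) (s : Γ(X, U)) :
    (f.app U).hom s ∈ fixed (actionOnSections f a ha U) := by
  rw [mem_fixed]
  intro g
  have : f.app U ≫ (a g).appLE _ _ (preimage_le_of_comp f a ha U g) = f.app U := by
    rw [Hom.app_eq_appLE, Hom.appLE_comp_appLE]
    simp only [ha]
  exact congr($(this).hom s)

/-- The structure map of the algebra of invariants. -/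
def quotientDiagramMap : (toOpensFunctor X).op ⋙ X.presheaf ⟶ quotientDiagram f a ha where
  app U := CommRingCat.ofHom <| (f.app U.unop.toOpens).hom.codRestrict _
    (app_mem_fixed f a ha U.unop.toOpens)
  naturality U V i := by
    ext x
    exact Subtype.ext congr($(f.naturality ((toOpensFunctor X).map i.unop).op).hom x)

lemma coequifibered_quotientDiagramMap [Finite G] [IsAffineHom f] :
    (quotientDiagramMap f a ha).Coequifibered := by
  refine coequifibered_iff_forall_isLocalizationAway.mpr fun U r ↦ ?_
  refine isLocalization_fixedMap (actionOnSections f a ha U.toOpens)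
    (actionOnSections f a ha (U.basicOpen r).toOpens)
    ((pushforwardDiagram f).map (homOfLE (U.basicOpen_le r)).op).hom
    (map_actionOnSections f a ha _) ⟨_, app_mem_fixed f a ha U.toOpens r⟩ ?_
  have h1 := (U.2.preimage f).isLocalization_of_eq_basicOpen (f.app _ r)
    (homOfLE (f.preimage_mono (X.basicOpen_le r))) (f.preimage_basicOpen r)
  exact h1

/-- The quotient of a scheme `f : Y ⟶ X` affine over `X` by the finite family `a` of endomorphisms
over `X`: the relative spectrum of the invariants in `f_* O_Y`. -/
def quotient [Finite G] [IsAffineHom f] : Scheme.{u} :=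
  relativeSpec (coequifibered_quotientDiagramMap f a ha)

/-- The structure morphism of the quotient. -/
def quotientToBase [Finite G] [IsAffineHom f] : quotient f a ha ⟶ X :=
  relativeSpecToBase (coequifibered_quotientDiagramMap f a ha)

/-- The quotient morphism over an affine open. -/
def toQuotientLocal [Finite G] [IsAffineHom f] (U : X.AffineZariskiSite) :
    (f ⁻¹ᵁ U.toOpens).toScheme ⟶ quotient f a ha :=
  (f ⁻¹ᵁ U.toOpens).toSpecΓ ≫
    Spec.map (CommRingCat.ofHom (fixed (actionOnSections f a ha U.toOpens)).subtype) ≫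
    relativeSpecι (coequifibered_quotientDiagramMap f a ha) U

lemma homOfLE_toQuotientLocal [Finite G] [IsAffineHom f] {U V : X.AffineZariskiSite} (i : U ⟶ V) :
    Y.homOfLE (f.preimage_mono (toOpens_mono (leOfHom i))) ≫ toQuotientLocal f a ha V =
      toQuotientLocal f a ha U := by
  have h1 : Spec.map ((quotientDiagram f a ha).map i.op) ≫
      relativeSpecι (coequifibered_quotientDiagramMap f a ha) V =
      relativeSpecι (coequifibered_quotientDiagramMap f a ha) U :=
    relativeSpec_w (coequifibered_quotientDiagramMap f a ha) i
  have h2 := Scheme.Opens.toSpecΓ_SpecMap_presheaf_map (X := Y) (f ⁻¹ᵁ U.toOpens) (f ⁻¹ᵁ V.toOpens)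
    (f.preimage_mono (toOpens_mono (leOfHom i)))
  unfold toQuotientLocal
  rw [← h1, ← reassoc_of% h2]
  refine congr((f ⁻¹ᵁ U.toOpens).toSpecΓ ≫ $(?_))
  refine (Spec.map_comp_assoc _ _ _).symm.trans (Eq.trans ?_ (Spec.map_comp_assoc _ _ _))
  rfl

lemma comp_pullbackRestrictIsoRestrict {U V : X.Opens} (h : U ≤ V)
    (t : pullback f U.ι ⟶ pullback f V.ι) (ht : t ≫ pullback.fst f V.ι = pullback.fst f U.ι) :
    t ≫ (pullbackRestrictIsoRestrict f V).hom =
      (pullbackRestrictIsoRestrict f U).hom ≫ Y.homOfLE (f.preimage_mono h) := by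
  rw [← cancel_mono (Scheme.Opens.ι _)]
  rw [Category.assoc, Category.assoc, pullbackRestrictIsoRestrict_hom_ι, homOfLE_ι,
    pullbackRestrictIsoRestrict_hom_ι, ht]

/-- The quotient morphism. -/
def toQuotient [Finite G] [IsAffineHom f] : Y ⟶ quotient f a ha :=
  Scheme.OpenCover.glueMorphismsOfLocallyDirected
    ((directedCover X).pullback₁ f)
    (fun U ↦ (pullbackRestrictIsoRestrict f _).hom ≫ toQuotientLocal f a ha U)
    fun {U V : X.AffineZariskiSite} (i : U ⟶ V) ↦ by
  have h : Cover.trans ((directedCover X).pullback₁ f) i ≫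
      (pullbackRestrictIsoRestrict f V.toOpens).hom =
      (pullbackRestrictIsoRestrict f U.toOpens).hom ≫
        Y.homOfLE (f.preimage_mono (toOpens_mono (leOfHom i))) := by
    exact comp_pullbackRestrictIsoRestrict f (toOpens_mono (leOfHom i)) _
      (Cover.trans_map ((directedCover X).pullback₁ f) i)
  refine (Category.assoc _ _ _).symm.trans ?_
  refine (congr($h ≫ toQuotientLocal f a ha V)).trans ?_
  refine (Category.assoc _ _ _).trans ?_
  exact congr((pullbackRestrictIsoRestrict f U.toOpens).hom ≫ $(homOfLE_toQuotientLocal f a ha i))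

end Quotient
end AlgebraicGeometry.Scheme

namespace AlgebraicGeometry.Scheme

section QuotientBase

open AffineZariskiSite InvariantSubring

variable {X Y : Scheme.{u}} (f : Y ⟶ X) {G : Type} (a : G → (Y ⟶ Y)) (ha : ∀ g, a g ≫ f = f)
  [Finite G] [IsAffineHom f]

lemma gluing_ι_toBase {S : Scheme.{u}} {𝒰 : S.OpenCover} [Category 𝒰.I₀] [𝒰.LocallyDirected]
    (d : Cover.RelativeGluingData 𝒰) [Small.{u} 𝒰.I₀] [Quiver.IsThin 𝒰.I₀] (i : 𝒰.I₀) :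
    d.cover.f i ≫ d.toBase = d.natTrans.app i ≫ 𝒰.f i := d.ι_toBase i

lemma relativeSpecCover_toBase {F : X.AffineZariskiSiteᵒᵖ ⥤ CommRingCat.{u}}
    {α : (toOpensFunctor X).op ⋙ X.presheaf ⟶ F} (H : α.Coequifibered) (U : X.AffineZariskiSite) :
    relativeSpecι H U ≫ relativeSpecToBase H = Spec.map (α.app (.op U)) ≫ U.2.fromSpec := by
  refine (gluing_ι_toBase (relativeGluingData H) U).trans ?_
  exact Category.assoc _ _ _

lemma toQuotientLocal_toBase (U : X.AffineZariskiSite) :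
    toQuotientLocal f a ha U ≫ quotientToBase f a ha = (f ⁻¹ᵁ U.toOpens).ι ≫ f := by
  have h1 := relativeSpecCover_toBase (coequifibered_quotientDiagramMap f a ha) U
  have h2 : (f ⁻¹ᵁ U.toOpens).toSpecΓ ≫ Spec.map (f.app U.toOpens) ≫ IsAffineOpen.fromSpec U.2 =
      (f ⁻¹ᵁ U.toOpens).ι ≫ f := by
    have hU : IsAffineOpen U.toOpens := U.2
    change _ ≫ _ ≫ hU.fromSpec = _
    rw [Opens.toSpecΓ_naturality_assoc, IsAffineOpen.toSpecΓ_fromSpec, morphismRestrict_ι]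
  rw [← h2]
  unfold toQuotientLocal
  rw [Category.assoc]
  refine congr((f ⁻¹ᵁ U.toOpens).toSpecΓ ≫ $(?_))
  refine (Category.assoc _ _ _).trans ?_
  refine (congr(Spec.map (CommRingCat.ofHom
    (fixed (actionOnSections f a ha U.toOpens)).subtype) ≫ $h1)).trans ?_
  refine (Spec.map_comp_assoc _ _ _).symm.trans ?_
  rfl

lemma map_toQuotient (U : X.AffineZariskiSite) :
    ((directedCover X).pullback₁ f).f U ≫ toQuotient f a ha =
      (pullbackRestrictIsoRestrict f U.toOpens).hom ≫ toQuotientLocal f a ha U := by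
  delta toQuotient
  generalize_proofs _ _ _ h
  exact OpenCover.map_glueMorphismsOfLocallyDirected _ _ h U

lemma toQuotient_toBase : toQuotient f a ha ≫ quotientToBase f a ha = f := by
  refine Scheme.Cover.hom_ext ((directedCover X).pullback₁ f) _ _ fun (U : X.AffineZariskiSite) => ?_
  have h1 : ((directedCover X).pullback₁ f).f U ≫ toQuotient f a ha =
      (pullbackRestrictIsoRestrict f _).hom ≫ toQuotientLocal f a ha U :=
    map_toQuotient f a ha U
  have h2 : (pullbackRestrictIsoRestrict f U.toOpens).hom ≫ (f ⁻¹ᵁ U.toOpens).ι =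
    ((directedCover X).pullback₁ f).f U := pullbackRestrictIsoRestrict_hom_ι _ _
  refine (Category.assoc _ _ _).symm.trans ?_
  refine (congr($h1 ≫ quotientToBase f a ha)).trans ?_
  refine (Category.assoc _ _ _).trans ?_
  rw [toQuotientLocal_toBase]
  refine (Category.assoc _ _ _).symm.trans ?_
  exact congr($h2 ≫ f)

end QuotientBase

section FiberPower

variable {X T : Scheme.{u}} (q : T ⟶ X)

/-- The `n`-fold fibre power of `T` over `X`. -/
abbrev fiberPower (n : ℕ) : Scheme.{u} := widePullback X (fun _ : Fin n => T) (fun _ => q)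

/-- The structure morphism of the fibre power. -/
abbrev fiberPowerToBase (n : ℕ) : fiberPower q n ⟶ X := WidePullback.base (fun _ : Fin n => q)

/-- The coordinates of the fibre power. -/
abbrev fiberPowerProj {n : ℕ} (i : Fin n) : fiberPower q n ⟶ T := WidePullback.π (fun _ : Fin n => q) i

lemma isAffineHom_fst_comp {A B S : Scheme.{u}} (g : A ⟶ S) (h : B ⟶ S) [IsAffineHom g]
    (hh : IsAffineHom h) : IsAffineHom (pullback.fst g h ≫ g) := by
  have := isAffineHom_isStableUnderBaseChange.{u}
  have : IsAffineHom (pullback.fst g h) := MorphismProperty.of_isPullback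
    (P := @IsAffineHom.{u}) (IsPullback.of_hasPullback g h).flip hh
  infer_instance

lemma exists_widePullbackCone_isAffineHom [IsAffineHom q] (n : ℕ) :
    ∃ s : WidePullbackCone (fun _ : Fin n => q), Nonempty (IsLimit s) ∧ IsAffineHom s.base := by
  induction n with
  | zero =>
    refine ⟨.mk (𝟙 X) (fun i => i.elim0) (fun i => i.elim0),
      ⟨WidePullbackCone.IsLimit.mk _ (fun t => t.base) ?_ ?_ ?_⟩, ?_⟩
    · intro t; exact Category.comp_id _
    · intro t i; exact i.elim0
    · intro t m h _; exact (Category.comp_id m).symm.trans h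
    · exact inferInstanceAs (IsAffineHom (𝟙 X))
  | succ n ih =>
    obtain ⟨s, ⟨hs⟩, haff⟩ := ih
    refine ⟨.mk (pullback.fst q s.base ≫ q)
      (Fin.cons (pullback.fst q s.base) fun i => pullback.snd q s.base ≫ s.π i) ?_, ⟨?_⟩, ?_⟩
    · intro i
      cases i using Fin.cases with
      | zero => rfl
      | succ i =>
        simp only [Fin.cons_succ, Category.assoc]
        rw [s.condition, pullback.condition]
    · refine WidePullbackCone.IsLimit.mk _
        (fun t => pullback.lift (t.π 0) (hs.lift (WidePullbackCone.mk t.base (fun i => t.π i.succ)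
          fun i => t.condition _)) ?_) ?_ ?_ ?_
      · exact (t.condition 0).trans (WidePullbackCone.IsLimit.lift_base hs _ _ _).symm
      · intro t
        exact (pullback.lift_fst_assoc _ _ _ _).trans (t.condition 0)
      · intro t i
        cases i using Fin.cases with
        | zero => exact pullback.lift_fst _ _ _
        | succ i =>
          refine (pullback.lift_snd_assoc _ _ _ _).trans ?_
          exact WidePullbackCone.IsLimit.lift_π hs _ _ _ i
      · intro t m h1 h2
        apply pullback.hom_ext
        · exact (h2 0).trans (pullback.lift_fst _ _ _).symm
        · refine Eq.trans ?_ (pullback.lift_snd _ _ _).symm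
          apply WidePullbackCone.IsLimit.hom_ext hs
          · refine Eq.trans ?_ (WidePullbackCone.IsLimit.lift_base hs _ _ _).symm
            refine Eq.trans ?_ h1
            refine (Category.assoc _ _ _).trans ?_
            exact congr(m ≫ $(pullback.condition.symm))
          · intro i
            refine Eq.trans ?_ (WidePullbackCone.IsLimit.lift_π hs _ _ _ i).symm
            exact (Category.assoc _ _ _).trans (h2 i.succ)
    · exact isAffineHom_fst_comp q s.base haff

instance [IsAffineHom q] (n : ℕ) : IsAffineHom (fiberPowerToBase q n) := by
  obtain ⟨s, ⟨hs⟩, h⟩ := exists_widePullbackCone_isAffineHom q n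
  let e := (limit.isLimit (WidePullbackShape.wideCospan X (fun _ : Fin n => T)
    (fun _ => q))).conePointUniqueUpToIso hs
  have he : e.hom ≫ s.base = fiberPowerToBase q n :=
    (limit.isLimit _).conePointUniqueUpToIso_hom_comp hs none
  rw [← he]
  infer_instance

end FiberPower
end AlgebraicGeometry.Scheme

namespace AlgebraicGeometry.Scheme

section RelativeChow

variable {X T : Scheme.{u}} (q : T ⟶ X)

/-- The automorphism of the fibre power permuting the factors. -/
def fiberPowerPerm (n : ℕ) (σ : Equiv.Perm (Fin n)) : fiberPower q n ⟶ fiberPower q n :=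
  WidePullback.lift (fiberPowerToBase q n) (fun i => fiberPowerProj q (σ i))
    fun i => WidePullback.π_arrow _ (σ i)

lemma fiberPowerPerm_toBase (n : ℕ) (σ : Equiv.Perm (Fin n)) :
    fiberPowerPerm q n σ ≫ fiberPowerToBase q n = fiberPowerToBase q n :=
  WidePullback.lift_base _ _ _ _

variable [IsAffineHom q]

/-- The relative Chow scheme of zero cycles of degree `n` in the fibres of an affine morphism
`q : T ⟶ X`: the quotient of the `n`-fold fibre power of `T` over `X` by the symmetric group. -/
def Chow (n : ℕ) : Scheme.{u} :=
  quotient (fiberPowerToBase q n) (fiberPowerPerm q n) (fiberPowerPerm_toBase q n)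

/-- The structure morphism of the relative Chow scheme. -/
def chowToBase (n : ℕ) : Chow q n ⟶ X :=
  quotientToBase (fiberPowerToBase q n) (fiberPowerPerm q n) (fiberPowerPerm_toBase q n)

/-- The quotient morphism `(z_1, …, z_n) ↦ z_1 + ⋯ + z_n`. -/
def chowMap (n : ℕ) : fiberPower q n ⟶ Chow q n :=
  toQuotient (fiberPowerToBase q n) (fiberPowerPerm q n) (fiberPowerPerm_toBase q n)

lemma chowMap_toBase (n : ℕ) : chowMap q n ≫ chowToBase q n = fiberPowerToBase q n :=
  toQuotient_toBase _ _ _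

variable {s : ℕ} (α : Fin s → ℕ)

/-- The product over `X` of the relative Chow schemes of degrees `α 0, …, α (s - 1)`. -/
def chowProd : Scheme.{u} := widePullback X (fun j => Chow q (α j)) (fun j => chowToBase q (α j))

/-- The structure morphism of the product of relative Chow schemes. -/
def chowProdToBase : chowProd q α ⟶ X := WidePullback.base (fun j => chowToBase q (α j))

/-- The product over `X` of the fibre powers of exponents `α 0, …, α (s - 1)`. -/
abbrev fiberPowerProd : Scheme.{u} :=
  widePullback X (fun j => fiberPower q (α j)) (fun j => fiberPowerToBase q (α j))

/-- The product of the quotient morphisms. -/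
def chowProdMap : fiberPowerProd q α ⟶ chowProd q α :=
  WidePullback.lift (WidePullback.base (fun j => fiberPowerToBase q (α j)))
    (fun j => WidePullback.π (fun j => fiberPowerToBase q (α j)) j ≫ chowMap q (α j))
    fun j => by
      refine (Category.assoc _ _ _).trans ?_
      refine (congr(WidePullback.π (fun j => fiberPowerToBase q (α j)) j ≫
        $(chowMap_toBase q (α j)))).trans ?_
      exact WidePullback.π_arrow _ j

end RelativeChow

section Addition

variable {X T : Scheme.{u}} (q : T ⟶ X) {s : ℕ} (α : Fin s → ℕ)

/-- The parts of the partition `(1 ^ α 0, …, s ^ α (s - 1))`: the part with index `⟨j, i⟩` has size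
`j + 1`. -/
abbrev Part : Type := Σ j : Fin s, Fin (α j)

variable {α} in
/-- A decomposition of `{0, …, n - 1}` into blocks indexed by the parts of
`(1 ^ α 0, …, s ^ α (s - 1))`, the size of each block being the size of the part. -/
def IsBlockDecomposition {n : ℕ} (c : Fin n → Part α) : Prop :=
  ∀ b : Part α, Nat.card {i // c i = b} = (b.1 : ℕ) + 1

variable {α} in
/-- The morphism of fibre powers repeating the coordinate with index `b` in all the places of the
block of `b`. -/
def repeatMap {n : ℕ} (c : Fin n → Part α) : fiberPowerProd q α ⟶ fiberPower q n :=
  WidePullback.lift (WidePullback.base (fun j => fiberPowerToBase q (α j)))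
    (fun i => WidePullback.π (fun j => fiberPowerToBase q (α j)) (c i).1 ≫
      fiberPowerProj q (c i).2)
    fun i => by
      refine (Category.assoc _ _ _).trans ?_
      refine (congr(WidePullback.π (fun j => fiberPowerToBase q (α j)) (c i).1 ≫
        $(WidePullback.π_arrow (fun _ : Fin (α (c i).1) => q) (c i).2))).trans ?_
      exact WidePullback.π_arrow _ (c i).1

/-- `τ` is the morphism over `X` given by
`(z_1, …, z_s) ↦ 1 z_1 + 2 z_2 + ⋯ + s z_s`: on tuples of points
`z_j = z_{j, 1} + ⋯ + z_{j, α_j}` it sums each `z_{j, i}` with multiplicity `j`. -/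
structure IsAdditionMorphism [IsAffineHom q] {n : ℕ} (τ : chowProd q α ⟶ Chow q n) : Prop where
  toBase : τ ≫ chowToBase q n = chowProdToBase q α
  comp_eq : ∀ c : Fin n → Part α, IsBlockDecomposition c →
    chowProdMap q α ≫ τ = repeatMap q c ≫ chowMap q n

/-- The coordinates `i` and `i'` of the point `y` of the fibre power coincide, i.e. `y` lies in
the partial diagonal where the two coordinates agree. -/
def SameCoordinate {n : ℕ} (y : fiberPower q n) (i i' : Fin n) : Prop :=
  (fiberPower q n).fromSpecResidueField y ≫ fiberPowerProj q i =
    (fiberPower q n).fromSpecResidueField y ≫ fiberPowerProj q i'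

/-- The stratum of cycles of the form `∑ n_b z_b` with pairwise distinct points `z_b`, where the
`n_b` are the parts of the partition `(1 ^ α 0, …, s ^ α (s - 1))`. -/
def chowStratum [IsAffineHom q] (n : ℕ) : Set (Chow q n) :=
  chowMap q n '' {y | ∃ c : Fin n → Part α, IsBlockDecomposition c ∧
    ∀ i i', SameCoordinate q y i i' ↔ c i = c i'}

end Addition

/-- The closure of a set of points, with its reduced closed subscheme structure. -/
def reducedClosure (Z : Scheme.{u}) (S : Set Z) : Scheme.{u} :=
  (IdealSheafData.vanishingIdeal ⟨closure S, isClosed_closure⟩).subscheme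

/-- The inclusion of the closure. -/
def reducedClosureι (Z : Scheme.{u}) (S : Set Z) : reducedClosure Z S ⟶ Z :=
  (IdealSheafData.vanishingIdeal ⟨closure S, isClosed_closure⟩).subschemeι

section Normalization

variable (Z : Scheme.{u})

/-- The morphism from the spectrum of the function field. -/
def fromGenericPoint [IsIntegral Z] : Spec Z.functionField ⟶ Z :=
  Z.fromSpecStalk (genericPoint Z)

instance [IsIntegral Z] : IsPreimmersion Z.fromGenericPoint :=
  inferInstanceAs (IsPreimmersion (Z.fromSpecStalk (genericPoint Z)))

instance [IsIntegral Z] : QuasiCompact Z.fromGenericPoint where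
  isCompact_preimage U _ _ := by
    have : Subsingleton (Spec Z.functionField) :=
      inferInstanceAs (Subsingleton (PrimeSpectrum Z.functionField))
    exact Set.subsingleton_of_subsingleton.isCompact

variable {Z}

/-- `ν` is the normalization of the integral scheme `Z`: up to isomorphism it is the
relative spectrum of the integral closure of `𝒪_Z` in the function field of `Z`. -/
def IsNormalization {Y : Scheme.{u}} (ν : Y ⟶ Z) : Prop :=
  ∃ (_ : IsIntegral Z) (e : Y ≅ Z.fromGenericPoint.normalization),
    e.hom ≫ Z.fromGenericPoint.fromNormalization = ν

end Normalization

section Projective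

attribute [local instance] MvPolynomial.gradedAlgebra

/-- The projective space of dimension `m` over a field. -/
def projectiveSpace (k : Type u) [Field k] (m : ℕ) : Scheme.{u} :=
  Proj (MvPolynomial.homogeneousSubmodule (Fin (m + 1)) k)

/-- The structure morphism of projective space. -/
def projectiveSpaceToSpec (k : Type u) [Field k] (m : ℕ) :
    projectiveSpace k m ⟶ Spec (.of k) :=
  Proj.toSpecZero (MvPolynomial.homogeneousSubmodule (Fin (m + 1)) k) ≫
    Spec.map (CommRingCat.ofHom
      (algebraMap k (MvPolynomial.homogeneousSubmodule (Fin (m + 1)) k 0)))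

/-- A scheme over a field is projective if it is a closed subscheme of a projective space. -/
def IsProjective {k : Type u} [Field k] {X : Scheme.{u}} (p : X ⟶ Spec (.of k)) : Prop :=
  ∃ (m : ℕ) (i : X ⟶ projectiveSpace k m), IsClosedImmersion i ∧
    i ≫ projectiveSpaceToSpec k m = p

end Projective

end AlgebraicGeometry.Scheme

open AlgebraicGeometry.Scheme

/-! ### Integrally closed domains: étale extensions and invariants -/

section IntegrallyClosed

/-! All schemes involved are affine over `X`, so everything is checked on rings of sections over
small affine opens. Let `A` be the ring of an open on which `X` is standard smooth, and let `d` be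
the fibre dimension, here `2`. The vector fields are free of rank `d`, so the cotangent bundle has
functions `A[x_1, …, x_d]`, and the product of the fibre powers has functions `B = A[x_{b,a}]`, one
block of `d` variables for each part `b` of the partition. In characteristic zero the Reynolds
operators identify the tensor product of the rings of symmetric invariants with the ring `B^G`,
where `G` is the product of the symmetric groups permuting parts of equal size; these are the
sections of the product of Chow schemes (`overApp_chowProdMap_injective_and_range`).

Existence and uniqueness of `τ` are a descent argument. Repeating each point according to its
multiplicity is compatible with `G` up to a permutation of the `n` places, so the composite with the
quotient morphism pulls functions back into `B^G`. Uniqueness holds because `B^G → B` is injective.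

For the normalization, `A` is étale over a polynomial ring, hence integrally closed, and so are `B`
and `B^G`. Let `E ⊆ B` be the image of the sections of the Chow scheme of degree `n`. The
coefficients of `∏ i, (t - f (c i))` lie in `E` for each fibre function `f`, where `c` assigns to
each place its part. For `f` a coordinate this makes `B` integral over `E`. For birationality, `Frac
B` is a splitting field over `Frac E`, hence Galois in characteristic zero. A Galois automorphism
permutes the variables `x_{·,a}` preserving multiplicities, and applying it to the sums `x_{b,a} +
x_{b,a'}` shows that the permutation is the same for all `a`. Preserving multiplicities means lying
in `G`, so `B^G ⊆ Frac E` (`exists_mul_eq_of_coeffsMem`). Integrality, birationality and integral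
closedness characterise the normalization of the scheme-theoretic image of `τ`
(`IsNormalization.of_over`).

Finally this image is the reduced closure of the stratum (`closure_chowStratum`,
`vanishingIdeal_closure_range`): the stratum lies in the range of `τ`, the generic point of the
product of fibre powers has pairwise distinct coordinates and so maps into the stratum, and the
source of `τ` is reduced. -/

/-- An integral domain that is étale over an integrally closed domain is integrally closed. -/
lemma isIntegrallyClosed_of_etale (P A : Type u) [CommRing P] [CommRing A] [IsDomain P]
    [IsDomain A] [IsIntegrallyClosed P] [Algebra P A] [Algebra.Etale P A] :
    IsIntegrallyClosed A := by
  let K := FractionRing P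
  have hflat : Module.Flat P A := inferInstance
  have hinj : Function.Injective (algebraMap P A) := by
    exact FaithfulSMul.algebraMap_injective P A
  have : IsLocalization (Algebra.algebraMapSubmonoid A (nonZeroDivisors P)) (A ⊗[P] K) :=
    inferInstance
  have hle : Algebra.algebraMapSubmonoid A (nonZeroDivisors P) ≤ nonZeroDivisors A := by
    rintro _ ⟨x, hx, rfl⟩
    exact map_mem_nonZeroDivisors _ hinj hx
  have hdom : IsDomain (A ⊗[P] K) := IsLocalization.isDomain_of_le_nonZeroDivisors (R := A) _ hle
  let _ : Algebra K (A ⊗[P] K) := Algebra.TensorProduct.rightAlgebra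
  have : Algebra.Etale K (A ⊗[P] K) :=
    .of_equiv (A := K ⊗[P] A) (AlgEquiv.ofRingEquiv
      (f := (Algebra.TensorProduct.comm P K A).toRingEquiv) fun r => by
        simp [Algebra.TensorProduct.right_algebraMap_apply])
  -- Étale over a field implies finite, and a domain integral over a field is a field. As a
  -- localization of `A`, it is then the fraction field of `A`.
  have : Module.Finite K (A ⊗[P] K) := Algebra.FormallyUnramified.finite_of_free K _
  have hint : Algebra.IsIntegral K (A ⊗[P] K) := inferInstance
  have hfield : IsField (A ⊗[P] K) := isField_of_isIntegral_of_isField' (Field.toIsField K)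
  let _ : Field (A ⊗[P] K) := hfield.toField
  have hfrac : IsFractionRing A (A ⊗[P] K) := by
    have : FaithfulSMul A (A ⊗[P] K) := (faithfulSMul_iff_algebraMap_injective _ _).mpr
      (IsLocalization.injective _ hle)
    refine IsFractionRing.of_field A _ fun z => ?_
    obtain ⟨x, s, hz⟩ := IsLocalization.exists_mk'_eq (Algebra.algebraMapSubmonoid A (nonZeroDivisors P)) z
    have hs : algebraMap A (A ⊗[P] K) s ≠ 0 := by
      rw [map_ne_zero_iff _ (IsLocalization.injective _ hle)]
      exact nonZeroDivisors.ne_zero (hle s.2)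
    refine ⟨x, s, ?_⟩
    rw [← hz, eq_div_iff hs, IsLocalization.mk'_spec]
  refine (isIntegrallyClosed_iff (A ⊗[P] K)).mpr fun {x} hx => ?_
  -- Integral closure commutes with smooth base change: what is integral over `A` comes from `A ⊗`
  -- (integral closure of `P` in `K`), and that closure is `P`.
  obtain ⟨y, hy⟩ := (TensorProduct.toIntegralClosure_bijective_of_smooth (R := P) (S := A)
    (B := K)).surjective ⟨x, hx⟩
  have hy' : (TensorProduct.toIntegralClosure P A K y : A ⊗[P] K) = x := congr_arg Subtype.val hy
  rw [← hy']
  clear hy hy'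
  induction y with
  | zero => exact ⟨0, by simp⟩
  | add a b ha hb =>
    obtain ⟨c, hc⟩ := ha
    obtain ⟨d, hd⟩ := hb
    exact ⟨c + d, by simp [hc, hd]⟩
  | tmul a b =>
    obtain ⟨b, hb⟩ := b
    obtain ⟨p, rfl⟩ := IsIntegrallyClosed.algebraMap_eq_of_integral hb
    refine ⟨p • a, ?_⟩
    change (p • a) ⊗ₜ (1 : K) = a ⊗ₜ algebraMap P K p
    rw [TensorProduct.smul_tmul, Algebra.algebraMap_eq_smul_one]

/-- An integral domain that is standard smooth over a field is integrally closed. -/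
lemma RingHom.IsStandardSmooth.isIntegrallyClosed {k A : Type u} [Field k] [CommRing A]
    [IsDomain A] {φ : k →+* A} (h : φ.IsStandardSmooth) : IsIntegrallyClosed A := by
  obtain ⟨n, g, -, hg⟩ := h.exists_etale_mvPolynomial
  algebraize [g]
  exact isIntegrallyClosed_of_etale (MvPolynomial (Fin n) k) A

instance MvPolynomial.isIntegrallyClosed_fin {A : Type u} [CommRing A] [IsDomain A]
    [IsIntegrallyClosed A] (n : ℕ) : IsIntegrallyClosed (MvPolynomial (Fin n) A) := by
  induction n with
  | zero => exact .of_equiv (MvPolynomial.isEmptyRingEquiv A (Fin 0)).symm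
  | succ n ih => exact .of_equiv (MvPolynomial.finSuccEquiv A n).toRingEquiv.symm

lemma MvPolynomial.isIntegrallyClosed_of_finite {A : Type u} [CommRing A] [IsDomain A]
    [IsIntegrallyClosed A] (σ : Type) [Finite σ] : IsIntegrallyClosed (MvPolynomial σ A) := by
  obtain ⟨n, ⟨e⟩⟩ := Finite.exists_equiv_fin σ
  exact .of_equiv (MvPolynomial.renameEquiv A e).toRingEquiv.symm

/-- The elements of an integrally closed domain fixed by a set of endomorphisms form an
integrally closed domain. -/
lemma isIntegrallyClosed_of_range_eq_fixed {B C : Type u} [CommRing B] [CommRing C] [IsDomain B]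
    [IsDomain C] [IsIntegrallyClosed B] (φ : C →+* B) (hφ : Function.Injective φ)
    (S : Set (B →+* B)) (hS : ∀ b, b ∈ Set.range φ ↔ ∀ s ∈ S, s b = b) : IsIntegrallyClosed C := by
  algebraize [φ]
  have : FaithfulSMul C B := (faithfulSMul_iff_algebraMap_injective C B).mpr hφ
  refine (isIntegrallyClosed_iff (FractionRing C)).mpr fun {x} hx => ?_
  let j : FractionRing C →+* FractionRing B := IsFractionRing.map hφ
  have hj : ∀ c : C, j (algebraMap C _ c) = algebraMap B _ (φ c) := fun c => IsLocalization.map_eq _ _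
  obtain ⟨p, q, hq, rfl⟩ := IsFractionRing.div_surjective (A := C) x
  have hq0 : φ q ≠ 0 := by
    simpa using hφ.ne (nonZeroDivisors.ne_zero hq)
  have h1 : IsIntegral B (j (algebraMap C _ p / algebraMap C _ q)) := by
    obtain ⟨f, hf, hf'⟩ := hx
    refine ⟨f.map φ, hf.map φ, ?_⟩
    rw [Polynomial.eval₂_map]
    have : (algebraMap B (FractionRing B)).comp φ = j.comp (algebraMap C _) := by
      ext c; exact (hj c).symm
    rw [this, ← Polynomial.hom_eval₂, hf', map_zero]
  obtain ⟨b, hb⟩ := IsIntegrallyClosed.algebraMap_eq_of_integral h1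
  have hbq : b * φ q = φ p := by
    apply IsFractionRing.injective B (FractionRing B)
    have : algebraMap B (FractionRing B) (φ q) ≠ 0 := by
      simpa using hq0
    rw [map_mul, hb, map_div₀, hj, hj, div_mul_cancel₀ _ this]
  have hfix : ∀ c : C, ∀ s ∈ S, s (φ c) = φ c := fun c => (hS _).mp ⟨c, rfl⟩
  -- Applying `s` to `b * q = p`, where `p` and `q` are fixed, gives `s b * q = b * q`, so `b` is
  -- fixed and comes from `C`.
  obtain ⟨c, rfl⟩ := (hS b).mpr fun s hs => by
    apply mul_right_cancel₀ hq0
    rw [hbq, ← hfix q s hs, ← map_mul, hbq, hfix p s hs]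
  refine ⟨c, ?_⟩
  have hcq : c * q = p := hφ (by rw [map_mul, hbq])
  have : algebraMap C (FractionRing C) q ≠ 0 := by
    simpa using nonZeroDivisors.ne_zero hq
  rw [eq_div_iff this, ← map_mul, hcq]

end IntegrallyClosed

/-! ### Coproducts of commutative algebras -/

/-- `D` is the coproduct of the `A`-algebras `R j`, where the algebra structures are given by the
ring maps `a j` and `d`. -/
structure IsRingCoproduct {J : Type} {A D : Type u} {R : J → Type u} [CommRing A] [CommRing D]
    [∀ j, CommRing (R j)] (a : ∀ j, A →+* R j) (d : A →+* D) (i : ∀ j, R j →+* D) : Prop where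
  comp : ∀ j, (i j).comp (a j) = d
  existsUnique : ∀ {E : Type u} [CommRing E] (e : A →+* E) (g : ∀ j, R j →+* E),
    (∀ j, (g j).comp (a j) = e) → ∃! h : D →+* E, h.comp d = e ∧ ∀ j, h.comp (i j) = g j

namespace IsRingCoproduct

variable {J : Type} {A D D' : Type u} {R : J → Type u} [CommRing A] [CommRing D] [CommRing D']
    [∀ j, CommRing (R j)] {a : ∀ j, A →+* R j} {d : A →+* D} {i : ∀ j, R j →+* D}
    {d' : A →+* D'} {i' : ∀ j, R j →+* D'}

lemma hom_ext (H : IsRingCoproduct a d i) {E : Type u} [CommRing E] {h h' : D →+* E}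
    (hd : h.comp d = h'.comp d) (hi : ∀ j, h.comp (i j) = h'.comp (i j)) : h = h' :=
  (H.existsUnique (h'.comp d) (fun j => h'.comp (i j)) fun j => by
    rw [RingHom.comp_assoc, H.comp]).unique ⟨hd, hi⟩ ⟨rfl, fun _ => rfl⟩

lemma exists_ringEquiv (H : IsRingCoproduct a d i) (H' : IsRingCoproduct a d' i') :
    ∃ e : D ≃+* D', e.toRingHom.comp d = d' ∧ ∀ j, e.toRingHom.comp (i j) = i' j := by
  obtain ⟨f, ⟨hf1, hf2⟩, -⟩ := H.existsUnique d' i' H'.comp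
  obtain ⟨g, ⟨hg1, hg2⟩, -⟩ := H'.existsUnique d i H.comp
  refine ⟨RingEquiv.ofRingHom f g ?_ ?_, hf1, hf2⟩
  · apply H'.hom_ext
    · rw [RingHom.comp_assoc, hg1, hf1, RingHom.id_comp]
    · intro j; rw [RingHom.comp_assoc, hg2, hf2, RingHom.id_comp]
  · apply H.hom_ext
    · rw [RingHom.comp_assoc, hf1, hg1, RingHom.id_comp]
    · intro j; rw [RingHom.comp_assoc, hf2, hg2, RingHom.id_comp]

/-- The universal property is enough for ring maps, but Reynolds operators are only linear; to apply
them in all factors at once the coproduct has to be seen as a tensor product. -/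
lemma exists_piTensorProduct_equiv [Fintype J] [∀ j, Algebra A (R j)] [Algebra A D]
    (H : IsRingCoproduct (fun j => algebraMap A (R j)) (algebraMap A D) i) :
    ∃ e : (⨂[A] j, R j) ≃ₐ[A] D, ∀ x : ∀ j, R j, e (PiTensorProduct.tprod A x) = ∏ j, i j (x j) := by
  classical
  let ia (j : J) : R j →ₐ[A] D := { i j with commutes' := fun r => congr($(H.comp j) r) }
  let f : (⨂[A] j, R j) →ₐ[A] D := PiTensorProduct.liftAlgHom
    ((MultilinearMap.mkPiAlgebra A J D).compLinearMap fun j => (ia j).toLinearMap)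
    (by simp) (by intro x y; simp [Finset.prod_mul_distrib])
  have hf : ∀ x : ∀ j, R j, f (PiTensorProduct.tprod A x) = ∏ j, i j (x j) := by
    intro x
    simp [f, PiTensorProduct.liftAlgHom]
    rfl
  obtain ⟨h, ⟨h1, h2⟩, -⟩ := H.existsUnique (algebraMap A (⨂[A] j, R j))
    (fun j => (PiTensorProduct.singleAlgHom (R := A) (A := R) j).toRingHom) (fun j => by ext; simp)
  let ha : D →ₐ[A] (⨂[A] j, R j) := { h with commutes' := fun r => congr($h1 r) }
  have hfs : ∀ j x, f (PiTensorProduct.singleAlgHom (R := A) (A := R) j x) = i j x := by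
    intro j x
    change f (PiTensorProduct.tprod A (MonoidHom.mulSingle R j x)) = _
    rw [hf, Finset.prod_eq_single j]
    · simp
    · intro b _ hb; simp [Pi.mulSingle_eq_of_ne hb]
    · simp
  refine ⟨AlgEquiv.ofAlgHom f ha ?_ ?_, hf⟩
  · have : f.toRingHom.comp h = RingHom.id D := by
      apply H.hom_ext
      · rw [RingHom.comp_assoc, h1]; ext; simp
      · intro j
        rw [RingHom.comp_assoc, h2]
        ext x
        exact hfs j x
    ext x
    exact congr($this x)
  · apply PiTensorProduct.algHom_ext
    intro j
    ext x
    change h (f (PiTensorProduct.singleAlgHom (R := A) (A := R) j x)) = _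
    rw [hfs]
    exact congr($(h2 j) x)

end IsRingCoproduct

/-! ### Invariants of a product of finite groups -/

section Reynolds

/-- The Reynolds operator: the average over a finite group is a linear projection onto the
invariants. -/
lemma exists_reynolds {A R C G : Type*} [CommRing A] [CommRing R] [CommRing C] [Algebra A R]
    [Algebra A C] [Group G] [Fintype G] (σ : G → R →ₐ[A] R) (hσ : ∀ g h, σ (g * h) = (σ g).comp (σ h))
    (c : C →ₐ[A] R) (hc : Function.Injective c) (hr : ∀ x, x ∈ Set.range c ↔ ∀ g, σ g x = x)
    (v : A) (hv : v * Fintype.card G = 1) :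
    ∃ ρ : R →ₗ[A] C, ρ ∘ₗ c.toLinearMap = LinearMap.id ∧
      c.toLinearMap ∘ₗ ρ = v • ∑ g, (σ g).toLinearMap := by
  let e := LinearEquiv.ofInjective c.toLinearMap hc
  let π : R →ₗ[A] R := v • ∑ g, (σ g).toLinearMap
  have hπ : ∀ x, π x ∈ LinearMap.range c.toLinearMap := by
    intro x
    refine (hr _).mpr fun g => ?_
    simp only [π, LinearMap.smul_apply, LinearMap.sum_apply, map_smul, map_sum,
      AlgHom.toLinearMap_apply]
    congr 1
    refine Fintype.sum_equiv (Equiv.mulLeft g) _ _ fun h => ?_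
    simp [hσ]
  refine ⟨e.symm.toLinearMap ∘ₗ π.codRestrict _ hπ, ?_, ?_⟩
  · ext x
    apply hc
    have : π (c x) = c x := by
      have hx : ∀ g, σ g (c x) = c x := (hr _).mp ⟨x, rfl⟩
      simp only [π, LinearMap.smul_apply, LinearMap.sum_apply, AlgHom.toLinearMap_apply, hx,
        Finset.sum_const, Finset.card_univ]
      rw [← Nat.cast_smul_eq_nsmul A, smul_smul, hv, one_smul]
    have h2 : (e (e.symm (π.codRestrict _ hπ (c x))) : R) = π (c x) := by simp
    exact h2.trans this
  · ext x
    have h2 : (e (e.symm (π.codRestrict _ hπ x)) : R) = π x := by simp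
    exact h2

variable {J : Type} [Fintype J] {A D C : Type u} {R S : J → Type u} [CommRing A] [CommRing D]
    [CommRing C] [∀ j, CommRing (R j)] [∀ j, CommRing (S j)]
    {a : ∀ j, A →+* R j} {d : A →+* D} {i : ∀ j, R j →+* D}
    {b : ∀ j, A →+* S j} {d' : A →+* C} {i' : ∀ j, S j →+* C}

/-- The coproduct of the rings of invariants of finite groups is the ring of invariants of the
product of the groups. -/
theorem IsRingCoproduct.injective_and_range_eq_fixed
    (HD : IsRingCoproduct a d i) (HC : IsRingCoproduct b d' i')
    {G : J → Type} [∀ j, Group (G j)] [∀ j, Fintype (G j)] (σ : ∀ j, G j → R j →+* R j)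
    (hσa : ∀ j g, (σ j g).comp (a j) = a j) (hσ : ∀ j g h, σ j (g * h) = (σ j g).comp (σ j h))
    (c : ∀ j, S j →+* R j) (hca : ∀ j, (c j).comp (b j) = a j)
    (hc : ∀ j, Function.Injective (c j)) (hr : ∀ j x, x ∈ Set.range (c j) ↔ ∀ g, σ j g x = x)
    (hA : ∀ j, IsUnit (Fintype.card (G j) : A)) (φ : C →+* D) (hφ : φ.comp d' = d)
    (hφi : ∀ j, φ.comp (i' j) = (i j).comp (c j))
    (sg : (∀ j, G j) → D →+* D) (hsg : ∀ g, (sg g).comp d = d)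
    (hsgi : ∀ g j, (sg g).comp (i j) = (i j).comp (σ j (g j))) :
    Function.Injective φ ∧ ∀ x, x ∈ Set.range φ ↔ ∀ g, sg g x = x := by
  classical
  let _ (j) : Algebra A (R j) := (a j).toAlgebra
  let _ (j) : Algebra A (S j) := (b j).toAlgebra
  let _ : Algebra A D := d.toAlgebra
  let _ : Algebra A C := d'.toAlgebra
  obtain ⟨eD, heD⟩ := HD.exists_piTensorProduct_equiv
  obtain ⟨eC, heC⟩ := HC.exists_piTensorProduct_equiv
  let ca (j) : S j →ₐ[A] R j := { c j with commutes' := fun r => congr($(hca j) r) }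
  let σa (j) (g : G j) : R j →ₐ[A] R j := { σ j g with commutes' := fun r => congr($(hσa j g) r) }
  let φa : C →ₐ[A] D := { φ with commutes' := fun r => congr($hφ r) }
  let sga (g) : D →ₐ[A] D := { sg g with commutes' := fun r => congr($(hsg g) r) }
  choose v hv using fun j => (hA j).exists_left_inv
  choose ρ hρ1 hρ2 using fun j => exists_reynolds (σa j)
    (fun g h => AlgHom.ext fun x => congr($(hσ j g h) x)) (ca j) (hc j) (hr j) (v j) (hv j)
  have h1 : φa.toLinearMap ∘ₗ eC.toLinearMap =
      eD.toLinearMap ∘ₗ PiTensorProduct.map (fun j => (ca j).toLinearMap) := by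
    ext x
    have : ∀ j y, φ (i' j y) = i j (c j y) := fun j y => congr($(hφi j) y)
    change φ (eC (PiTensorProduct.tprod A x)) =
      eD (PiTensorProduct.map (fun j => (ca j).toLinearMap) (PiTensorProduct.tprod A x))
    rw [heC, PiTensorProduct.map_tprod, heD, map_prod]
    exact Finset.prod_congr rfl fun j _ => this j _
  have h2 : ∀ g, (sga g).toLinearMap ∘ₗ eD.toLinearMap =
      eD.toLinearMap ∘ₗ PiTensorProduct.map (fun j => (σa j (g j)).toLinearMap) := by
    intro g
    ext x
    have : ∀ j y, sg g (i j y) = i j (σ j (g j) y) := fun j y => congr($(hsgi g j) y)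
    change sg g (eD (PiTensorProduct.tprod A x)) =
      eD (PiTensorProduct.map (fun j => (σa j (g j)).toLinearMap) (PiTensorProduct.tprod A x))
    rw [PiTensorProduct.map_tprod, heD, heD, map_prod]
    exact Finset.prod_congr rfl fun j _ => this j _
  -- The tensor product of the projections `ρ j` retracts the tensor product of the inclusions `c
  -- j`; this gives injectivity without flatness.
  have h3 : PiTensorProduct.map ρ ∘ₗ PiTensorProduct.map (fun j => (ca j).toLinearMap) =
      LinearMap.id := by
    rw [← PiTensorProduct.map_comp]
    simp only [hρ1]
    exact PiTensorProduct.map_id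
  -- By multilinearity the tensor product of the averages over the groups `G j` is the average over
  -- their product.
  have h4 : PiTensorProduct.map (fun j => (ca j).toLinearMap) ∘ₗ PiTensorProduct.map ρ =
      (∏ j, v j) • ∑ g : ∀ j, G j, PiTensorProduct.map (fun j => (σa j (g j)).toLinearMap) := by
    rw [← PiTensorProduct.map_comp]
    simp only [hρ2]
    change PiTensorProduct.mapMultilinear A R R (fun j => v j • ∑ g, (σa j g).toLinearMap) = _
    rw [MultilinearMap.map_smul_univ, MultilinearMap.map_sum]
    rfl
  constructor
  · intro x y hxy
    obtain ⟨x, rfl⟩ := eC.surjective x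
    obtain ⟨y, rfl⟩ := eC.surjective y
    have hx := congr($h1 x)
    have hy := congr($h1 y)
    have : eD (PiTensorProduct.map (fun j => (ca j).toLinearMap) x) =
      eD (PiTensorProduct.map (fun j => (ca j).toLinearMap) y) := hx.symm.trans (hxy.trans hy)
    have := eD.injective this
    have h5 : x = y := (congr($h3 x)).symm.trans ((congr_arg (PiTensorProduct.map ρ) this).trans
      congr($h3 y))
    rw [h5]
  · intro x
    constructor
    · rintro ⟨y, rfl⟩ g
      have : (sg g).comp φ = φ := by
        apply HC.hom_ext
        · rw [RingHom.comp_assoc, hφ, hsg]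
        · intro j
          rw [RingHom.comp_assoc, hφi, ← RingHom.comp_assoc, hsgi, RingHom.comp_assoc]
          congr 1
          ext z
          exact (hr j _).mp ⟨z, rfl⟩ _
      exact congr($this y)
    · intro hx
      obtain ⟨y, rfl⟩ := eD.surjective x
      -- An invariant element equals its own average, which by `h4` lies in the image.
      refine ⟨eC (PiTensorProduct.map ρ y), ?_⟩
      refine (congr($h1 (PiTensorProduct.map ρ y))).trans ?_
      refine (congr_arg eD (congr($h4 y))).trans ?_
      have h6 : ∀ g : ∀ j, G j, eD (PiTensorProduct.map (fun j => (σa j (g j)).toLinearMap) y) = eD y :=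
        fun g => (congr($(h2 g) y)).symm.trans (hx g)
      simp only [LinearMap.smul_apply, LinearMap.sum_apply, map_smul, map_sum, h6]
      rw [Finset.sum_const, Finset.card_univ, ← Nat.cast_smul_eq_nsmul A, smul_smul,
        Fintype.card_pi, Nat.cast_prod, ← Finset.prod_mul_distrib]
      simp only [hv, Finset.prod_const_one, one_smul]

end Reynolds

/-! ### Symmetric polynomials with repeated variables -/

section WeightedSymmetric

open Polynomial in
/-- If `σ` permutes, with multiplicities, the roots of `∏ i, (t - f (c i))`, then it permutes the
values of `f`, preserving the multiplicities. -/
lemma exists_eq_of_map_prod_eq {β L : Type*} [Field L] {n : ℕ} (c : Fin n → β)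
    (hc : Function.Surjective c) (σ : L →+* L) (f : β → L) (hf : Function.Injective f)
    (h : (∏ i, (X - C (f (c i)))).map σ = ∏ i, (X - C (f (c i)))) (b : β) :
    ∃ b', σ (f b) = f b' ∧ Nat.card {i // c i = b'} = Nat.card {i // c i = b} := by
  classical
  have hr : ∀ g : Fin n → L, (∏ i, (X - C (g i))).roots = Finset.univ.val.map g := fun g => by
    rw [Polynomial.roots_prod _ _ (Finset.prod_ne_zero_iff.mpr fun i _ => X_sub_C_ne_zero _)]
    simp
  have h1 : Finset.univ.val.map (fun i => σ (f (c i))) = Finset.univ.val.map (fun i => f (c i)) := by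
    rw [← hr, ← hr, ← h]
    simp [Polynomial.map_prod]
  obtain ⟨i, rfl⟩ := hc b
  have h2 : σ (f (c i)) ∈ Finset.univ.val.map (fun i => f (c i)) := by
    rw [← h1]
    exact Multiset.mem_map_of_mem _ (Finset.mem_univ i)
  obtain ⟨i', -, hi'⟩ := Multiset.mem_map.mp h2
  refine ⟨c i', hi'.symm, ?_⟩
  -- As `σ` and `f` are injective, the count is the size of the fibre of `c` over `c i` on the left,
  -- and over `c i'` on the right.
  have h3 := congr_arg (Multiset.count (σ (f (c i)))) h1
  rw [Multiset.count_map, Multiset.count_map] at h3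
  simp only [σ.injective.eq_iff, hf.eq_iff] at h3
  rw [← hi'] at h3
  simp only [hf.eq_iff] at h3
  simp only [Nat.card_eq_fintype_card, Fintype.card_subtype]
  simp only [Finset.card_def, Finset.filter_val]
  simpa only [eq_comm] using h3.symm

variable {A : Type u} [CommRing A] {β ι : Type} {n : ℕ} (c : Fin n → β)
  (E : Subring (MvPolynomial (β × ι) A))

open Polynomial in
/-- The coefficients of the polynomial with roots `f (c i)` lie in the subring `E`. -/
def CoeffsMem (f : β → MvPolynomial (β × ι) A) : Prop :=
  ∀ m, (∏ i, (X - C (f (c i)))).coeff m ∈ E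

variable {c E}

open Polynomial in
lemma CoeffsMem.exists_poly {f : β → MvPolynomial (β × ι) A} (h : CoeffsMem c E f) :
    ∃ q : E[X], q.Monic ∧ q.map E.subtype = ∏ i, (X - C (f (c i))) := by
  have hm : (∏ i, (X - C (f (c i)))).Monic := monic_prod_of_monic _ _ fun i _ => monic_X_sub_C _
  have h1 : (∏ i, (X - C (f (c i)))) ∈ Polynomial.lifts E.subtype := by
    rw [Polynomial.lifts_iff_coeff_lifts]
    intro m
    exact ⟨⟨_, h m⟩, rfl⟩
  obtain ⟨q, hq, -, hq'⟩ := Polynomial.lifts_and_natDegree_eq_and_monic h1 hm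
  exact ⟨q, hq', hq⟩

/-- By surjectivity of `c`, every `f b` is a root of the monic polynomial `∏ i, (t - f (c i))`. -/
lemma CoeffsMem.isIntegral {f : β → MvPolynomial (β × ι) A} (h : CoeffsMem c E f)
    (hc : Function.Surjective c) (b : β) : IsIntegral E (f b) := by
  obtain ⟨q, hq, hq'⟩ := h.exists_poly
  obtain ⟨i, rfl⟩ := hc b
  refine ⟨q, hq, ?_⟩
  rw [← Polynomial.eval_map]
  change (q.map E.subtype).eval _ = 0
  rw [hq', Polynomial.eval_prod]
  exact Finset.prod_eq_zero (Finset.mem_univ i) (by simp)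

lemma isIntegral_of_coeffsMem (hc : Function.Surjective c)
    (hA : ∀ a, MvPolynomial.C a ∈ E)
    (hE : ∀ a : ι, CoeffsMem c E fun b => MvPolynomial.X (b, a)) (x : MvPolynomial (β × ι) A) :
    IsIntegral E x := by
  induction x using MvPolynomial.induction_on with
  | C a => exact isIntegral_algebraMap (R := E) (x := ⟨_, hA a⟩)
  | add p q hp hq => exact hp.add hq
  | mul_X p i hp => exact hp.mul ((hE i.2).isIntegral hc i.1)

variable [Finite β] [Finite ι]

omit [Finite β] [Finite ι] in
-- Coefficient comparison: a sum of variables from different coordinates remembers both indices. It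
-- is used to compare the permutations that a Galois automorphism induces on two coordinates.
lemma eq_of_X_add_X_eq [Nontrivial A] {a a' : ι} (ha : a ≠ a') {b₁ b₂ b₃ b₄ : β}
    (h : (MvPolynomial.X (b₁, a) + MvPolynomial.X (b₂, a') : MvPolynomial (β × ι) A) =
      MvPolynomial.X (b₃, a) + MvPolynomial.X (b₄, a')) : b₁ = b₃ ∧ b₂ = b₄ := by
  classical
  have h1 := congr_arg (MvPolynomial.coeff (Finsupp.single (b₃, a) 1)) h
  have h2 := congr_arg (MvPolynomial.coeff (Finsupp.single (b₄, a') 1)) h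
  rw [MvPolynomial.coeff_add, MvPolynomial.coeff_add] at h1 h2
  simpa [MvPolynomial.coeff_X, Finsupp.single_left_inj, ha, ha.symm] using And.intro h1 h2

open Polynomial in
-- Galois theory for `L / K`: every automorphism acts on the variables through one
-- multiplicity-preserving permutation of `β`, so `x` is fixed by the Galois group and lies in `K =
-- Frac E`. The hypothesis `hE` yields a permutation for each coordinate, `hE'` that these agree.
-- The fields are kept abstract so that their algebra structures can be supplied together.
lemma exists_mul_eq_of_coeffsMem_of_isFractionRing (K L : Type*) [Field K] [Field L]
    [Algebra E K] [IsFractionRing E K] [Algebra (MvPolynomial (β × ι) A) L]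
    [IsFractionRing (MvPolynomial (β × ι) A) L] [Algebra K L] [Algebra E L] [IsScalarTower E K L]
    [IsScalarTower E (MvPolynomial (β × ι) A) L] [Nonempty ι] [CharZero A] (hc : Function.Surjective c)
    (hA : ∀ a, MvPolynomial.C a ∈ E)
    (hE : ∀ a : ι, CoeffsMem c E fun b => MvPolynomial.X (b, a))
    (hE' : ∀ a a' : ι, CoeffsMem c E fun b => MvPolynomial.X (b, a) + MvPolynomial.X (b, a'))
    (x : MvPolynomial (β × ι) A)
    (hx : ∀ π : Equiv.Perm β, (∀ b, Nat.card {i // c i = π b} = Nat.card {i // c i = b}) →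
      MvPolynomial.rename (Prod.map π id) x = x) :
    ∃ d ∈ E, ∃ e ∈ E, d ≠ 0 ∧ d * x = e := by
  classical
  have := Fintype.ofFinite ι
  let B := MvPolynomial (β × ι) A
  let j : B →+* L := algebraMap B L
  have hj : Function.Injective j := IsFractionRing.injective B L
  have hjE : ∀ e : E, algebraMap K L (algebraMap E K e) = j e := fun e => by
    rw [← IsScalarTower.algebraMap_apply, IsScalarTower.algebraMap_apply E B L]; rfl
  have hpoly : ∀ f : β → B, CoeffsMem c E f → ∃ q : K[X],
      q ≠ 0 ∧ q.map (algebraMap K L) = ∏ i, (X - C (j (f (c i)))) := by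
    intro f hf
    obtain ⟨q, hq, hq'⟩ := hf.exists_poly
    refine ⟨q.map (algebraMap E K), (hq.map _).ne_zero, ?_⟩
    have h1 : (algebraMap K L).comp (algebraMap E K) = j.comp E.subtype := RingHom.ext hjE
    rw [Polynomial.map_map, h1, ← Polynomial.map_map, hq', Polynomial.map_prod]
    simp
  choose q hq0 hq using fun a => hpoly _ (hE a)
  have hint : ∀ b : B, IsIntegral K (j b) := fun b => by
    have h1 : IsIntegral E (j b) := (isIntegral_of_coeffsMem hc hA hE b).map
      (IsScalarTower.toAlgHom E B L)
    exact h1.tower_top (A := K)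
  have halg : Algebra.IsAlgebraic K L := ⟨fun y => by
    obtain ⟨p, r, -, rfl⟩ := IsFractionRing.div_surjective (A := B) y
    rw [div_eq_mul_inv]
    exact (hint p).isAlgebraic.mul (hint r).isAlgebraic.inv⟩
  -- The roots of `Q` in `L` are exactly the variables, so `L` will be its splitting field.
  let Q : K[X] := ∏ a, q a
  have hQ0 : Q ≠ 0 := Finset.prod_ne_zero_iff.mpr fun a _ => hq0 a
  have hQ : Q.map (algebraMap K L) = ∏ a, ∏ i, (X - C (j (MvPolynomial.X (c i, a)))) := by
    simp only [Q, Polynomial.map_prod, hq]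
  have hXmem : ∀ b, j (MvPolynomial.X b) ∈ Q.rootSet L := by
    rintro ⟨b, a⟩
    obtain ⟨i, rfl⟩ := hc b
    rw [Polynomial.mem_rootSet_of_ne hQ0, ← Polynomial.eval_map_algebraMap, hQ, Polynomial.eval_prod]
    refine Finset.prod_eq_zero (Finset.mem_univ a) ?_
    rw [Polynomial.eval_prod]
    exact Finset.prod_eq_zero (Finset.mem_univ i) (by simp)
  have hadj : Algebra.adjoin K (Q.rootSet L) = ⊤ := by
    rw [eq_top_iff]
    have h1 : ∀ b : B, j b ∈ Algebra.adjoin K (Q.rootSet L) := by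
      intro b
      induction b using MvPolynomial.induction_on with
      | C a =>
        rw [← hjE ⟨_, hA a⟩]
        exact Subalgebra.algebraMap_mem _ _
      | add p q hp hq => rw [map_add]; exact add_mem hp hq
      | mul_X p i hp => rw [map_mul]; exact mul_mem hp (Algebra.subset_adjoin (hXmem i))
    intro y _
    obtain ⟨p, r, -, rfl⟩ := IsFractionRing.div_surjective (A := B) y
    rw [div_eq_mul_inv]
    -- The adjoined algebra contains the inverses of its algebraic elements, so it contains all
    -- fractions.
    refine mul_mem (h1 p) (Subalgebra.inv_mem_of_algebraic _ (x := ⟨_, h1 r⟩) ?_)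
    exact (hint r).isAlgebraic
  have hsplit : Q.IsSplittingField K L := ⟨by
    rw [hQ]
    exact Polynomial.Splits.prod fun a _ => Polynomial.Splits.prod fun i _ =>
      Polynomial.Splits.X_sub_C _, hadj⟩
  have : FiniteDimensional K L := IsSplittingField.finiteDimensional L Q
  have : Normal K L := Normal.of_isSplittingField Q
  have : CharZero K := by
    have : CharZero E := ⟨fun m n hmn => by
      have := congr_arg Subtype.val hmn
      simpa using this⟩
    exact charZero_of_injective_algebraMap (IsFractionRing.injective E K)
  have : IsGalois K L := {}
  have hperm : ∀ s : L ≃ₐ[K] L, ∀ f : β → B, CoeffsMem c E f → Function.Injective f → ∀ b,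
      ∃ b', s (j (f b)) = j (f b') ∧ Nat.card {i // c i = b'} = Nat.card {i // c i = b} := by
    intro s f hf hfi b
    obtain ⟨r, -, hr⟩ := hpoly f hf
    refine exists_eq_of_map_prod_eq c hc s.toRingEquiv.toRingHom (fun b => j (f b)) (hj.comp hfi) ?_ b
    rw [← hr, Polynomial.map_map]
    congr 1
    ext y
    exact s.commutes y
  have hfix : ∀ s : L ≃ₐ[K] L, s (j x) = j x := by
    intro s
    choose π hπ hπn using fun a => hperm s _ (hE a) (fun b b' h => by
      simpa using MvPolynomial.X_injective h)
    have hinj2 : ∀ a a' : ι, a ≠ a' → ∀ b₁ b₂ b₃ b₄ : β,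
        (MvPolynomial.X (b₁, a) + MvPolynomial.X (b₂, a') : B) =
          MvPolynomial.X (b₃, a) + MvPolynomial.X (b₄, a') → b₁ = b₃ ∧ b₂ = b₄ :=
      fun a a' ha b₁ b₂ b₃ b₄ h => eq_of_X_add_X_eq ha h
    -- The image under `s` of `x_{b,a} + x_{b,a'}` is again such a sum with a common index `b'`;
    -- uniqueness of the indices gives `π a b = b' = π a' b`.
    have hπeq : ∀ a a', π a = π a' := by
      intro a a'
      by_cases ha : a = a'
      · rw [ha]
      funext b
      obtain ⟨b', hb', -⟩ := hperm s _ (hE' a a') (fun b b' h => (hinj2 a a' ha _ _ _ _ h).1) b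
      rw [map_add, map_add, hπ, hπ, ← map_add] at hb'
      obtain ⟨h1, h2⟩ := hinj2 a a' ha _ _ _ _ (hj hb')
      rw [h1, h2]
    obtain ⟨a₀⟩ := ‹Nonempty ι›
    have hπi : Function.Injective (π a₀) := by
      intro b b' h
      have h1 : s (j (MvPolynomial.X (b, a₀))) = s (j (MvPolynomial.X (b', a₀))) := by
        rw [hπ, hπ, h]
      simpa using MvPolynomial.X_injective (hj (s.injective h1))
    let p : Equiv.Perm β := Equiv.ofBijective (π a₀) (Finite.injective_iff_bijective.mp hπi)
    have h1 : ∀ y : B, s (j y) = j (MvPolynomial.rename (Prod.map p id) y) := by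
      intro y
      induction y using MvPolynomial.induction_on with
      | C a =>
        rw [MvPolynomial.rename_C, ← hjE ⟨_, hA a⟩]
        exact s.commutes _
      | add p q hp hq => simp only [map_add, hp, hq]
      | mul_X q i hp =>
        rw [map_mul, map_mul, hp, map_mul, map_mul, MvPolynomial.rename_X, hπ, hπeq i.2 a₀]
        rfl
    rw [h1, hx p (hπn a₀)]
  obtain ⟨y, hy⟩ := (IsGalois.mem_bot_iff_fixed (F := K) (E := L) (j x)).mpr hfix
  obtain ⟨e, d, hd, rfl⟩ := IsFractionRing.div_surjective (A := E) y
  have hd0 : (d : B) ≠ 0 := by simpa using nonZeroDivisors.ne_zero hd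
  refine ⟨d, d.2, e, e.2, hd0, hj ?_⟩
  have hy' : algebraMap K L (algebraMap E K e / algebraMap E K d) = j x := hy
  rw [map_mul, ← hy', map_div₀, hjE, hjE, mul_div_cancel₀]
  simpa using hj.ne hd0

/-- A polynomial invariant under the permutations of the index set preserving the multiplicities
is a quotient of two elements of the subring `E`. -/
theorem exists_mul_eq_of_coeffsMem [IsDomain A] [Nonempty ι] [CharZero A] (hc : Function.Surjective c)
    (hA : ∀ a, MvPolynomial.C a ∈ E)
    (hE : ∀ a : ι, CoeffsMem c E fun b => MvPolynomial.X (b, a))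
    (hE' : ∀ a a' : ι, CoeffsMem c E fun b => MvPolynomial.X (b, a) + MvPolynomial.X (b, a'))
    (x : MvPolynomial (β × ι) A)
    (hx : ∀ π : Equiv.Perm β, (∀ b, Nat.card {i // c i = π b} = Nat.card {i // c i = b}) →
      MvPolynomial.rename (Prod.map π id) x = x) :
    ∃ d ∈ E, ∃ e ∈ E, d ≠ 0 ∧ d * x = e := by
  let B := MvPolynomial (β × ι) A
  let L := FractionRing B
  have : FaithfulSMul E L := by
    rw [faithfulSMul_iff_algebraMap_injective, IsScalarTower.algebraMap_eq E B L]
    exact (IsFractionRing.injective B L).comp Subtype.val_injective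
  let K := FractionRing E
  let _ : Algebra K L := FractionRing.liftAlgebra E L
  have : IsScalarTower E K L := FractionRing.isScalarTower_liftAlgebra E L
  exact exists_mul_eq_of_coeffsMem_of_isFractionRing K L hc hA hE hE' x hx

end WeightedSymmetric

/-! ### Sections of relative spectra, quotients and fibre products over affine opens -/

namespace AlgebraicGeometry.Scheme
open AffineZariskiSite InvariantSubring

lemma isIso_appLE_opensRange {Y Z : Scheme.{u}} (f : Y ⟶ Z) [IsOpenImmersion f] (W : Z.Opens)
    (hW : W = f.opensRange) (h : ⊤ ≤ f ⁻¹ᵁ W) : IsIso (f.appLE W ⊤ h) := by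
  subst hW
  have : IsIso (f.app f.opensRange) := f.isIso_app _ le_rfl
  have h2 : f ⁻¹ᵁ f.opensRange = ⊤ := top_le_iff.mp h
  rw [Hom.appLE]
  have : IsIso (homOfLE h) := ⟨homOfLE h2.le, Subsingleton.elim _ _, Subsingleton.elim _ _⟩
  infer_instance

lemma top_le_preimage_SpecMap_fromSpec {X : Scheme.{u}} {U : X.Opens} (hU : IsAffineOpen U)
    {R : CommRingCat.{u}} (φ : Γ(X, U) ⟶ R) : ⊤ ≤ (Spec.map φ ≫ hU.fromSpec) ⁻¹ᵁ U := by
  rw [Hom.comp_preimage, hU.fromSpec_preimage_self]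
  exact le_rfl

lemma SpecMap_fromSpec_appLE {X : Scheme.{u}} {U : X.Opens} (hU : IsAffineOpen U)
    {R : CommRingCat.{u}} (φ : Γ(X, U) ⟶ R) :
    (Spec.map φ ≫ hU.fromSpec).appLE U ⊤ (top_le_preimage_SpecMap_fromSpec hU φ) ≫
      (ΓSpecIso R).hom = φ := by
  have h3 : hU.fromSpec.appLE U ⊤ (by rw [hU.fromSpec_preimage_self]) = (ΓSpecIso _).inv := by
    have := hU.fromSpec_app_self
    rw [Hom.appLE, this]
    simp only [Category.assoc, ← Functor.map_comp]
    simp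
  rw [← Hom.appLE_comp_appLE _ _ U ⊤ ⊤ (by rw [hU.fromSpec_preimage_self]) le_top, h3]
  have h4 : (Spec.map φ).appLE ⊤ ⊤ le_top = (Spec.map φ).appTop := by
    rw [Hom.appTop, Hom.app_eq_appLE]; rfl
  rw [h4, Category.assoc, ← ΓSpecIso_inv_naturality_assoc]
  simp

section RelativeSpec

variable {X : Scheme.{u}} {F : X.AffineZariskiSiteᵒᵖ ⥤ CommRingCat.{u}}
  {α : (toOpensFunctor X).op ⋙ X.presheaf ⟶ F} (H : α.Coequifibered)

instance (U : X.AffineZariskiSite) : IsOpenImmersion (relativeSpecι H U) :=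
  (relativeSpecCover H).map_prop _

lemma relativeSpecToBase_preimage (U : X.AffineZariskiSite) :
    relativeSpecToBase H ⁻¹ᵁ U.toOpens = (relativeSpecι H U).opensRange := by
  have := (relativeGluingData H).toBase_preimage_eq_opensRange_ι U
  rw [Opens.opensRange_ι] at this
  exact this

lemma top_le_relativeSpecι_preimage (U : X.AffineZariskiSite) :
    ⊤ ≤ relativeSpecι H U ⁻¹ᵁ relativeSpecToBase H ⁻¹ᵁ U.toOpens := by
  rw [relativeSpecToBase_preimage, Hom.preimage_opensRange]

/-- The restriction of sections of the relative spectrum to an affine piece. -/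
def relativeSpecSections (U : X.AffineZariskiSite) :
    Γ(relativeSpec H, relativeSpecToBase H ⁻¹ᵁ U.toOpens) ⟶ F.obj (.op U) :=
  (relativeSpecι H U).appLE _ ⊤ (top_le_relativeSpecι_preimage H U) ≫ (ΓSpecIso _).hom

instance (U : X.AffineZariskiSite) : IsIso (relativeSpecSections H U) := by
  have := isIso_appLE_opensRange (relativeSpecι H U) _ (relativeSpecToBase_preimage H U)
    (top_le_relativeSpecι_preimage H U)
  exact IsIso.comp_isIso

lemma app_relativeSpecSections (U : X.AffineZariskiSite) :
    (relativeSpecToBase H).app U.toOpens ≫ relativeSpecSections H U = α.app (.op U) := by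
  have hU : IsAffineOpen U.toOpens := U.2
  have h1 : relativeSpecι H U ≫ relativeSpecToBase H = Spec.map (α.app (.op U)) ≫ hU.fromSpec :=
    relativeSpecCover_toBase H U
  refine Eq.trans ?_ (SpecMap_fromSpec_appLE hU (α.app (.op U)))
  rw [relativeSpecSections, Hom.app_eq_appLE, Hom.appLE_comp_appLE_assoc]
  simp only [h1]
  rfl

end RelativeSpec

section Quotient

variable {X Y : Scheme.{u}} (f : Y ⟶ X) {G : Type} (a : G → (Y ⟶ Y)) (ha : ∀ g, a g ≫ f = f)
  [Finite G] [IsAffineHom f]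

instance : IsAffineHom (quotientToBase f a ha) :=
  inferInstanceAs (IsAffineHom (relativeSpecToBase _))

lemma ι_toQuotient (U : X.AffineZariskiSite) :
    (f ⁻¹ᵁ U.toOpens).ι ≫ toQuotient f a ha = toQuotientLocal f a ha U := by
  rw [← cancel_epi (pullbackRestrictIsoRestrict f U.toOpens).hom, ← map_toQuotient,
    pullbackRestrictIsoRestrict_hom_ι_assoc]
  rfl

lemma preimage_le_toQuotient_preimage (U : X.Opens) :
    f ⁻¹ᵁ U ≤ toQuotient f a ha ⁻¹ᵁ quotientToBase f a ha ⁻¹ᵁ U := by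
  rw [← Hom.comp_preimage, toQuotient_toBase]

/-- The inclusion of the invariants. -/
def fixedInclusion (U : X.AffineZariskiSite) :
    (quotientDiagram f a ha).obj (.op U) ⟶ Γ(Y, f ⁻¹ᵁ U.toOpens) :=
  CommRingCat.ofHom (fixed (actionOnSections f a ha U.toOpens)).subtype

/-- The affine pieces of the quotient. -/
def quotientι (U : X.AffineZariskiSite) :
    Spec ((quotientDiagram f a ha).obj (.op U)) ⟶ quotient f a ha :=
  relativeSpecι (coequifibered_quotientDiagramMap f a ha) U

lemma top_le_quotientι_preimage (U : X.AffineZariskiSite) :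
    ⊤ ≤ quotientι f a ha U ⁻¹ᵁ quotientToBase f a ha ⁻¹ᵁ U.toOpens :=
  top_le_relativeSpecι_preimage (coequifibered_quotientDiagramMap f a ha) U

/-- The sections of the quotient over an affine open are the invariant sections. -/
def quotientSections (U : X.AffineZariskiSite) :
    Γ(quotient f a ha, quotientToBase f a ha ⁻¹ᵁ U.toOpens) ⟶
      (quotientDiagram f a ha).obj (.op U) :=
  (quotientι f a ha U).appLE _ ⊤ (top_le_quotientι_preimage f a ha U) ≫ (ΓSpecIso _).hom

instance (U : X.AffineZariskiSite) : IsIso (quotientSections f a ha U) :=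
  inferInstanceAs (IsIso (relativeSpecSections (coequifibered_quotientDiagramMap f a ha) U))

omit [Finite G] [IsAffineHom f] in
lemma topIso_inv_eq_appLE (V : Y.Opens) : V.topIso.inv = V.ι.appLE V ⊤ (by simp) := by
  rw [Hom.appLE, Opens.ι_app, Opens.topIso_inv, Opens.toScheme_presheaf_map]
  exact Y.presheaf.map_comp (homOfLE _).op (homOfLE _).op

/-- On an affine piece the quotient morphism is built from the inclusion of the invariants, so its
effect on sections can be read off. The injectivity and range statements deduced from this are the
description of quotients by sections used later. -/
lemma toQuotient_appLE (U : X.AffineZariskiSite) :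
    (toQuotient f a ha).appLE (quotientToBase f a ha ⁻¹ᵁ U.toOpens) (f ⁻¹ᵁ U.toOpens)
      (preimage_le_toQuotient_preimage f a ha U.toOpens) =
    quotientSections f a ha U ≫ fixedInclusion f a ha U := by
  have h2 : (f ⁻¹ᵁ U.toOpens).ι ≫ toQuotient f a ha = (f ⁻¹ᵁ U.toOpens).toSpecΓ ≫
      Spec.map (fixedInclusion f a ha U) ≫ quotientι f a ha U := ι_toQuotient f a ha U
  have h3 := (Hom.appLE_comp_appLE (f ⁻¹ᵁ U.toOpens).ι (toQuotient f a ha) _ _ ⊤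
    (preimage_le_toQuotient_preimage f a ha U.toOpens) (by simp))
  simp only [h2] at h3
  rw [← cancel_mono (f ⁻¹ᵁ U.toOpens).topIso.inv, topIso_inv_eq_appLE]
  refine h3.trans ?_
  have h6 := Hom.appLE_comp_appLE (Spec.map (fixedInclusion f a ha U)) (quotientι f a ha U)
    _ ⊤ ⊤ (top_le_quotientι_preimage f a ha U) le_top
  have h7 : ⊤ ≤ (Spec.map (fixedInclusion f a ha U) ≫ quotientι f a ha U) ⁻¹ᵁ
      quotientToBase f a ha ⁻¹ᵁ U.toOpens := fun _ _ => top_le_quotientι_preimage f a ha U trivial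
  refine (Hom.appLE_comp_appLE (f ⁻¹ᵁ U.toOpens).toSpecΓ
    (Spec.map (fixedInclusion f a ha U) ≫ quotientι f a ha U) _ ⊤ ⊤
    h7 le_top).symm.trans ?_
  rw [← h6]
  have h4 : (Spec.map (fixedInclusion f a ha U)).appLE ⊤ ⊤ le_top =
    (Spec.map (fixedInclusion f a ha U)).appTop := by
    rw [Hom.appTop, Hom.app_eq_appLE]; rfl
  have h5 : (f ⁻¹ᵁ U.toOpens).toSpecΓ.appLE ⊤ ⊤ le_top = (f ⁻¹ᵁ U.toOpens).toSpecΓ.appTop := by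
    rw [Hom.appTop, Hom.app_eq_appLE]; rfl
  rw [h4, h5, Opens.toSpecΓ_appTop, ← topIso_inv_eq_appLE, quotientSections]
  simp only [Category.assoc]
  rw [ΓSpecIso_naturality_assoc]

lemma toQuotient_appLE_injective (U : X.AffineZariskiSite) :
    Function.Injective ((toQuotient f a ha).appLE (quotientToBase f a ha ⁻¹ᵁ U.toOpens)
      (f ⁻¹ᵁ U.toOpens) (preimage_le_toQuotient_preimage f a ha U.toOpens)).hom := by
  rw [toQuotient_appLE f a ha U]
  exact Subtype.val_injective.comp (ConcreteCategory.bijective_of_isIso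
    (quotientSections f a ha U)).1

lemma mem_range_toQuotient_appLE (U : X.AffineZariskiSite) (x : Γ(Y, f ⁻¹ᵁ U.toOpens)) :
    x ∈ Set.range ((toQuotient f a ha).appLE (quotientToBase f a ha ⁻¹ᵁ U.toOpens)
      (f ⁻¹ᵁ U.toOpens) (preimage_le_toQuotient_preimage f a ha U.toOpens)).hom ↔
      ∀ g, actionOnSections f a ha U.toOpens g x = x := by
  rw [toQuotient_appLE f a ha U, ← mem_fixed]
  constructor
  · rintro ⟨y, rfl⟩
    exact ((quotientSections f a ha U).hom y).2
  · intro hx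
    obtain ⟨y, hy⟩ := (ConcreteCategory.bijective_of_isIso
      (quotientSections f a ha U)).2 ⟨x, hx⟩
    exact ⟨y, congr_arg Subtype.val hy⟩

end Quotient

section WidePullback

/-- Adding one factor at a time, by base change and composition of affine morphisms. Any limit cone
will do, since it is isomorphic to the chosen one over `X`. -/
lemma exists_widePullbackCone_isAffineHom' {X : Scheme.{u}} (n : ℕ) (Y : Fin n → Scheme.{u})
    (f : ∀ j, Y j ⟶ X) [∀ j, IsAffineHom (f j)] :
    ∃ s : WidePullbackCone f, Nonempty (IsLimit s) ∧ IsAffineHom s.base := by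
  induction n with
  | zero =>
    refine ⟨.mk (𝟙 X) (fun i => i.elim0) (fun i => i.elim0),
      ⟨WidePullbackCone.IsLimit.mk _ (fun t => t.base) ?_ ?_ ?_⟩, ?_⟩
    · intro t; exact Category.comp_id _
    · intro t i; exact i.elim0
    · intro t m h _; exact (Category.comp_id m).symm.trans h
    · exact inferInstanceAs (IsAffineHom (𝟙 X))
  | succ n ih =>
    obtain ⟨s, ⟨hs⟩, haff⟩ := ih (fun j => Y j.succ) (fun j => f j.succ)
    refine ⟨.mk (pullback.fst (f 0) s.base ≫ f 0)
      (Fin.cons (pullback.fst (f 0) s.base) fun i => pullback.snd (f 0) s.base ≫ s.π i) ?_,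
      ⟨?_⟩, ?_⟩
    · intro i
      cases i using Fin.cases with
      | zero => rfl
      | succ i =>
        simp only [Fin.cons_succ, Category.assoc]
        rw [s.condition, pullback.condition]
    · refine WidePullbackCone.IsLimit.mk _
        (fun t => pullback.lift (t.π 0) (hs.lift (WidePullbackCone.mk t.base (fun i => t.π i.succ)
          fun i => t.condition _)) ?_) ?_ ?_ ?_
      · exact (t.condition 0).trans (WidePullbackCone.IsLimit.lift_base hs _ _ _).symm
      · intro t
        exact (pullback.lift_fst_assoc _ _ _ _).trans (t.condition 0)
      · intro t i
        cases i using Fin.cases with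
        | zero => exact pullback.lift_fst _ _ _
        | succ i =>
          refine (pullback.lift_snd_assoc _ _ _ _).trans ?_
          exact WidePullbackCone.IsLimit.lift_π hs _ _ _ i
      · intro t m h1 h2
        apply pullback.hom_ext
        · exact (h2 0).trans (pullback.lift_fst _ _ _).symm
        · refine Eq.trans ?_ (pullback.lift_snd _ _ _).symm
          apply WidePullbackCone.IsLimit.hom_ext hs
          · refine Eq.trans ?_ (WidePullbackCone.IsLimit.lift_base hs _ _ _).symm
            refine Eq.trans ?_ h1
            refine (Category.assoc _ _ _).trans ?_
            exact congr(m ≫ $(pullback.condition.symm))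
          · intro i
            refine Eq.trans ?_ (WidePullbackCone.IsLimit.lift_π hs _ _ _ i).symm
            exact (Category.assoc _ _ _).trans (h2 i.succ)
    · exact isAffineHom_fst_comp (f 0) s.base haff

variable {X : Scheme.{u}} {n : ℕ} {Y : Fin n → Scheme.{u}} (f : ∀ j, Y j ⟶ X)
  [∀ j, IsAffineHom (f j)]

lemma isAffineHom_widePullback_base : IsAffineHom (WidePullback.base f) := by
  obtain ⟨s, ⟨hs⟩, h⟩ := exists_widePullbackCone_isAffineHom' n Y f
  let e := (limit.isLimit (WidePullbackShape.wideCospan X Y f)).conePointUniqueUpToIso hs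
  have he : e.hom ≫ s.base = WidePullback.base f :=
    (limit.isLimit _).conePointUniqueUpToIso_hom_comp hs none
  rw [← he]
  infer_instance

omit [∀ j, IsAffineHom (f j)] in
lemma base_preimage_le (U : X.Opens) (j : Fin n) :
    WidePullback.base f ⁻¹ᵁ U ≤ WidePullback.π f j ⁻¹ᵁ f j ⁻¹ᵁ U := by
  rw [← Hom.comp_preimage, WidePullback.π_arrow]

/-- The universal property of the fibre product, tested on affine schemes `Spec E` mapping into `U`,
is the universal property of a coproduct of rings. -/
lemma isRingCoproduct_widePullback {U : X.Opens} (hU : IsAffineOpen U) :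
    IsRingCoproduct (fun j => ((f j).app U).hom) ((WidePullback.base f).app U).hom
      (fun j => ((WidePullback.π f j).appLE (f j ⁻¹ᵁ U) (WidePullback.base f ⁻¹ᵁ U)
        (base_preimage_le f U j)).hom) := by
  have := isAffineHom_widePullback_base f
  have hW : IsAffineOpen (WidePullback.base f ⁻¹ᵁ U) := hU.preimage _
  refine ⟨fun j => ?_, fun {E} _ e g hg => ?_⟩
  · rw [← CommRingCat.hom_comp, Hom.app_eq_appLE, Hom.appLE_comp_appLE, Hom.app_eq_appLE]
    simp only [WidePullback.π_arrow]
  · have hY : ∀ j, IsAffineOpen (f j ⁻¹ᵁ U) := fun j => hU.preimage (f j)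
    let m : Spec (.of E) ⟶ widePullback X Y f := WidePullback.lift
      (Spec.map (CommRingCat.ofHom e) ≫ hU.fromSpec)
      (fun j => Spec.map (CommRingCat.ofHom (g j)) ≫ (hY j).fromSpec) fun j => by
        rw [Category.assoc, ← IsAffineOpen.SpecMap_appLE_fromSpec (f j) hU (hY j) le_rfl,
          ← Spec.map_comp_assoc, ← Hom.app_eq_appLE]
        congr 2
        ext x
        exact congr($(hg j) x)
    have hm0 : m ≫ WidePullback.base f = Spec.map (CommRingCat.ofHom e) ≫ hU.fromSpec :=
      WidePullback.lift_base _ _ _ _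
    have hmj : ∀ j, m ≫ WidePullback.π f j =
        Spec.map (CommRingCat.ofHom (g j)) ≫ (hY j).fromSpec := fun j =>
      WidePullback.lift_π _ _ _ _ _
    have hm : ⊤ ≤ m ⁻¹ᵁ WidePullback.base f ⁻¹ᵁ U := by
      rw [← Hom.comp_preimage, hm0]
      exact top_le_preimage_SpecMap_fromSpec _ _
    refine ⟨(m.appLE _ ⊤ hm ≫ (ΓSpecIso (.of E)).hom).hom, ⟨?_, fun j => ?_⟩, ?_⟩
    · rw [← CommRingCat.hom_comp, Hom.app_eq_appLE, Hom.appLE_comp_appLE_assoc]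
      simp only [hm0]
      rw [SpecMap_fromSpec_appLE]
      rfl
    · rw [← CommRingCat.hom_comp, Hom.appLE_comp_appLE_assoc]
      simp only [hmj]
      rw [SpecMap_fromSpec_appLE]
      rfl
    · rintro h' ⟨h0, hj⟩
      -- A competing ring map defines a morphism with the same components as `m`, and is recovered
      -- from it on sections.
      have key : Spec.map (CommRingCat.ofHom h') ≫ hW.fromSpec = m := by
        apply WidePullback.hom_ext
        · intro j
          rw [hmj, Category.assoc, ← IsAffineOpen.SpecMap_appLE_fromSpec _ (hY j) hW
            (base_preimage_le f U j), ← Spec.map_comp_assoc]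
          congr 2
          ext x
          exact congr($(hj j) x)
        · rw [hm0, Category.assoc, ← IsAffineOpen.SpecMap_appLE_fromSpec _ hU hW le_rfl,
            ← Spec.map_comp_assoc, ← Hom.app_eq_appLE]
          congr 2
          ext x
          exact congr($h0 x)
      have := SpecMap_fromSpec_appLE hW (CommRingCat.ofHom h')
      simp only [key] at this
      rw [this]
      rfl

end WidePullback

end AlgebraicGeometry.Scheme

/-! ### Morphisms into schemes affine over a base; integrality -/

namespace AlgebraicGeometry.Scheme
open AffineZariskiSite InvariantSubring

section AffineTarget

variable {X Y Z : Scheme.{u}}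

lemma ι_comp_eq_of_appLE (g : Y ⟶ Z) {W : Z.Opens} (hW : IsAffineOpen W) (V : Y.Opens)
    (h : V ≤ g ⁻¹ᵁ W) : V.ι ≫ g = V.toSpecΓ ≫ Spec.map (g.appLE W V h) ≫ hW.fromSpec := by
  rw [Opens.toSpecΓ_SpecMap_appLE_assoc, IsAffineOpen.toSpecΓ_fromSpec, Hom.resLE_comp_ι]

lemma top_le_preimage_toSpecΓ {W : Z.Opens} (hW : IsAffineOpen W) (V : Y.Opens)
    (t : Γ(Z, W) ⟶ Γ(Y, V)) : ⊤ ≤ (V.toSpecΓ ≫ Spec.map t ≫ hW.fromSpec) ⁻¹ᵁ W :=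
  fun _ _ => top_le_preimage_SpecMap_fromSpec hW t trivial

lemma le_preimage_of_ι_comp_eq (g : Y ⟶ Z) {W : Z.Opens} (hW : IsAffineOpen W) (V : Y.Opens)
    (t : Γ(Z, W) ⟶ Γ(Y, V)) (h : V.ι ≫ g = V.toSpecΓ ≫ Spec.map t ≫ hW.fromSpec) :
    V ≤ g ⁻¹ᵁ W := by
  intro x hx
  have := (top_le_preimage_toSpecΓ hW V t) (x := ⟨x, hx⟩) trivial
  rw [← h] at this
  exact this

lemma appLE_eq_of_ι_comp_eq (g : Y ⟶ Z) {W : Z.Opens} (hW : IsAffineOpen W) (V : Y.Opens)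
    (t : Γ(Z, W) ⟶ Γ(Y, V)) (h : V.ι ≫ g = V.toSpecΓ ≫ Spec.map t ≫ hW.fromSpec) :
    g.appLE W V (le_preimage_of_ι_comp_eq g hW V t h) = t := by
  have h1 := ι_comp_eq_of_appLE g hW V (le_preimage_of_ι_comp_eq g hW V t h)
  rw [h] at h1
  have h2 : ∀ t' : Γ(Z, W) ⟶ Γ(Y, V), (V.toSpecΓ ≫ Spec.map t' ≫ hW.fromSpec).appLE W ⊤
      (top_le_preimage_toSpecΓ hW V t') = t' ≫ V.topIso.inv := by
    intro t'
    have h6 := Hom.appLE_comp_appLE V.toSpecΓ (Spec.map t' ≫ hW.fromSpec) W ⊤ ⊤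
      (top_le_preimage_SpecMap_fromSpec hW t') le_top
    rw [← h6]
    have h5 : V.toSpecΓ.appLE ⊤ ⊤ le_top = V.toSpecΓ.appTop := by
      rw [Hom.appTop, Hom.app_eq_appLE]; rfl
    rw [h5, Opens.toSpecΓ_appTop, ← Category.assoc, SpecMap_fromSpec_appLE]
  rw [← cancel_mono V.topIso.inv, ← h2, ← h2]
  simp only [h1]

/-- Two morphisms over `X` into a scheme affine over `X` agree if they agree on sections over a
family of affine opens covering `X`. -/
lemma hom_ext_of_appLE (π : Z ⟶ X) [IsAffineHom π] (f : Y ⟶ X) {g g' : Y ⟶ Z} (hg : g ≫ π = f)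
    (hg' : g' ≫ π = f) {I : Type*} (U : I → X.Opens) (hU : ∀ i, IsAffineOpen (U i))
    (hc : ∀ x, ∃ i, x ∈ U i)
    (h : ∀ i, g.appLE (π ⁻¹ᵁ U i) (f ⁻¹ᵁ U i) (by rw [← hg]; exact le_rfl) =
      g'.appLE (π ⁻¹ᵁ U i) (f ⁻¹ᵁ U i) (by rw [← hg']; exact le_rfl)) : g = g' := by
  have hcov : ⨆ i, f ⁻¹ᵁ U i = ⊤ := by
    rw [eq_top_iff]
    intro y _
    obtain ⟨i, hi⟩ := hc (f y)
    exact TopologicalSpace.Opens.mem_iSup.mpr ⟨i, hi⟩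
  have key : ∀ i, (f ⁻¹ᵁ U i).ι ≫ g = (f ⁻¹ᵁ U i).ι ≫ g' := fun i => by
    rw [ι_comp_eq_of_appLE g ((hU i).preimage π) _ (by rw [← hg]; exact le_rfl),
      ι_comp_eq_of_appLE g' ((hU i).preimage π) _ (by rw [← hg']; exact le_rfl), h]
  exact Scheme.Cover.hom_ext (Y.openCoverOfIsOpenCover _ hcov) _ _ key

/-- The morphism glued from compatible morphisms on the preimages of the affine opens. -/
def glueOverAffines (f : Y ⟶ X)
    (τ : ∀ U : X.AffineZariskiSite, (f ⁻¹ᵁ U.toOpens).toScheme ⟶ Z)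
    (hτ : ∀ {U V : X.AffineZariskiSite} (i : U ⟶ V),
      Y.homOfLE (f.preimage_mono (toOpens_mono (leOfHom i))) ≫ τ V = τ U) : Y ⟶ Z :=
  Scheme.OpenCover.glueMorphismsOfLocallyDirected
    ((directedCover X).pullback₁ f)
    (fun U ↦ (pullbackRestrictIsoRestrict f _).hom ≫ τ U)
    fun {U V : X.AffineZariskiSite} (i : U ⟶ V) ↦ by
  have h : Cover.trans ((directedCover X).pullback₁ f) i ≫
      (pullbackRestrictIsoRestrict f V.toOpens).hom =
      (pullbackRestrictIsoRestrict f U.toOpens).hom ≫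
        Y.homOfLE (f.preimage_mono (toOpens_mono (leOfHom i))) := by
    exact comp_pullbackRestrictIsoRestrict f (toOpens_mono (leOfHom i)) _
      (Cover.trans_map ((directedCover X).pullback₁ f) i)
  refine (Category.assoc _ _ _).symm.trans ?_
  refine (congr($h ≫ τ V)).trans ?_
  refine (Category.assoc _ _ _).trans ?_
  exact congr((pullbackRestrictIsoRestrict f U.toOpens).hom ≫ $(hτ i))

lemma map_glueOverAffines (f : Y ⟶ X)
    (τ : ∀ U : X.AffineZariskiSite, (f ⁻¹ᵁ U.toOpens).toScheme ⟶ Z)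
    (hτ : ∀ {U V : X.AffineZariskiSite} (i : U ⟶ V),
      Y.homOfLE (f.preimage_mono (toOpens_mono (leOfHom i))) ≫ τ V = τ U)
    (U : X.AffineZariskiSite) :
    ((directedCover X).pullback₁ f).f U ≫ glueOverAffines f τ hτ =
      (pullbackRestrictIsoRestrict f U.toOpens).hom ≫ τ U := by
  delta glueOverAffines
  generalize_proofs _ _ _ h
  exact OpenCover.map_glueMorphismsOfLocallyDirected _ _ h U

/-- A morphism over `X` into a scheme affine over `X` is given by compatible maps on sections over
the affine opens of `X`. -/
lemma exists_hom_of_appLE (π : Z ⟶ X) [IsAffineHom π] (f : Y ⟶ X)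
    (t : ∀ U : X.AffineZariskiSite, Γ(Z, π ⁻¹ᵁ U.toOpens) ⟶ Γ(Y, f ⁻¹ᵁ U.toOpens))
    (ht0 : ∀ U, π.app U.toOpens ≫ t U = f.app U.toOpens)
    (ht : ∀ U V : X.AffineZariskiSite, ∀ i : U ≤ V,
      t V ≫ Y.presheaf.map (homOfLE (f.preimage_mono (toOpens_mono i))).op =
        Z.presheaf.map (homOfLE (π.preimage_mono (toOpens_mono i))).op ≫ t U) :
    ∃ g : Y ⟶ Z, g ≫ π = f ∧ ∀ (U : X.AffineZariskiSite) (h),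
      g.appLE (π ⁻¹ᵁ U.toOpens) (f ⁻¹ᵁ U.toOpens) h = t U := by
  have hZ : ∀ U : X.AffineZariskiSite, IsAffineOpen (π ⁻¹ᵁ U.toOpens) :=
    fun U => IsAffineOpen.preimage U.2 π
  let τ (U : X.AffineZariskiSite) : (f ⁻¹ᵁ U.toOpens).toScheme ⟶ Z :=
    (f ⁻¹ᵁ U.toOpens).toSpecΓ ≫ Spec.map (t U) ≫ (hZ U).fromSpec
  have hτ : ∀ {U V : X.AffineZariskiSite} (i : U ⟶ V),
      Y.homOfLE (f.preimage_mono (toOpens_mono (leOfHom i))) ≫ τ V = τ U := by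
    intro U V i
    have h2 := Opens.toSpecΓ_SpecMap_presheaf_map (X := Y) (f ⁻¹ᵁ U.toOpens) (f ⁻¹ᵁ V.toOpens)
      (f.preimage_mono (toOpens_mono (leOfHom i)))
    simp only [τ]
    rw [← reassoc_of% h2, ← Spec.map_comp_assoc, ht U V (leOfHom i), Spec.map_comp_assoc,
      (hZ V).map_fromSpec (hZ U)]
  let g : Y ⟶ Z := glueOverAffines f τ hτ
  have hg : ∀ U : X.AffineZariskiSite, (f ⁻¹ᵁ U.toOpens).ι ≫ g = τ U := by
    intro U
    have h1 : ((directedCover X).pullback₁ f).f U ≫ g =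
        (pullbackRestrictIsoRestrict f U.toOpens).hom ≫ τ U := map_glueOverAffines f τ hτ U
    rw [← cancel_epi (pullbackRestrictIsoRestrict f U.toOpens).hom, ← h1,
      pullbackRestrictIsoRestrict_hom_ι_assoc]
    rfl
  have hg2 : ∀ (U : X.AffineZariskiSite) (h),
      g.appLE (π ⁻¹ᵁ U.toOpens) (f ⁻¹ᵁ U.toOpens) h = t U := fun U _ =>
    appLE_eq_of_ι_comp_eq g (hZ U) _ _ (hg U)
  refine ⟨g, ?_, hg2⟩
  have hcov : ⨆ U : X.AffineZariskiSite, f ⁻¹ᵁ U.toOpens = ⊤ := by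
    rw [eq_top_iff]
    intro y _
    obtain ⟨_, ⟨U, hU, rfl⟩, hxU, -⟩ :=
      X.isBasis_affineOpens.exists_subset_of_mem_open (Set.mem_univ (f y)) isOpen_univ
    exact TopologicalSpace.Opens.mem_iSup.mpr ⟨⟨U, hU⟩, hxU⟩
  have key : ∀ U : X.AffineZariskiSite,
      (f ⁻¹ᵁ U.toOpens).ι ≫ g ≫ π = (f ⁻¹ᵁ U.toOpens).ι ≫ f := fun U => by
    have hU : IsAffineOpen U.toOpens := U.2
    rw [reassoc_of% hg U, ι_comp_eq_of_appLE f hU _ le_rfl, ← Hom.app_eq_appLE, ← ht0]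
    simp only [τ, Category.assoc, Spec.map_comp]
    rw [Hom.app_eq_appLE, IsAffineOpen.SpecMap_appLE_fromSpec π hU (hZ U) le_rfl]
  exact Scheme.Cover.hom_ext (Y.openCoverOfIsOpenCover _ hcov) _ _ key

end AffineTarget

section Integral

variable {X Y : Scheme.{u}}

/-- A scheme affine over an integral scheme is integral, if over a covering family of nonempty affine
opens its sections form a domain containing the sections of the base. -/
lemma isIntegral_of_isAffineHom [IsIntegral X] (f : Y ⟶ X) [IsAffineHom f] {I : Type*} (U : I → X.Opens)
    (hU : ∀ i, IsAffineOpen (U i)) (hc : ∀ x, ∃ i, x ∈ U i)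
    (hdom : ∀ i, IsDomain Γ(Y, f ⁻¹ᵁ U i)) (hinj : ∀ i, Function.Injective (f.app (U i)).hom) :
    IsIntegral Y := by
  have hY : ∀ i, IsAffineOpen (f ⁻¹ᵁ U i) := fun i => (hU i).preimage f
  have hcov : ⨆ i, f ⁻¹ᵁ U i = ⊤ := by
    rw [eq_top_iff]
    intro y _
    obtain ⟨i, hi⟩ := hc (f y)
    exact TopologicalSpace.Opens.mem_iSup.mpr ⟨i, hi⟩
  have hneY : ∀ i, ((f ⁻¹ᵁ U i : Y.Opens) : Set Y).Nonempty := fun i => by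
    rw [Set.nonempty_iff_ne_empty]
    intro h
    have h0 : f ⁻¹ᵁ U i = ⊥ := TopologicalSpace.Opens.ext h
    have := hdom i
    rw [h0] at this
    exact not_subsingleton Γ(Y, ⊥) inferInstance
  have hneX : ∀ i, (U i : Set X).Nonempty := fun i => (hneY i).imp' f fun _ h => h
  have hint : ∀ i, IsIntegral (f ⁻¹ᵁ U i).toScheme := fun i => by
    have := hdom i
    have : Nonempty (f ⁻¹ᵁ U i).toScheme := (hneY i).to_subtype
    have : IsIntegral (Spec Γ(Y, f ⁻¹ᵁ U i)) := inferInstance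
    exact isIntegral_of_isOpenImmersion (hY i).isoSpec.hom
  have hred : IsReduced Y := by
    have h : ∀ i, IsReduced (f ⁻¹ᵁ U i).toScheme := fun i => by
      have := hint i
      infer_instance
    have : ∀ i, IsReduced ((Y.openCoverOfIsOpenCover _ hcov).X i) := h
    exact IsReduced.of_openCover _ (Y.openCoverOfIsOpenCover _ hcov)
  have hirr : ∀ i, IsPreirreducible ((f ⁻¹ᵁ U i : Y.Opens) : Set Y) := fun i => by
    have : PreirreducibleSpace (f ⁻¹ᵁ U i).toScheme := inferInstance
    rw [← Opens.range_ι, ← Set.image_univ]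
    exact PreirreducibleSpace.isPreirreducible_univ.image _ (f ⁻¹ᵁ U i).ι.continuous.continuousOn
  -- Irreducibility of `X` makes `U i` and `U j` meet. A nonzero function `r` with basic open inside
  -- the intersection pulls back to a nonzero function on the reduced scheme `Y`, so its basic open
  -- is nonempty.
  have hmeet : ∀ i j, ((f ⁻¹ᵁ (U i ⊓ U j) : Y.Opens) : Set Y).Nonempty := by
    intro i j
    obtain ⟨x, hx⟩ : ((U i ⊓ U j : X.Opens) : Set X).Nonempty :=
      nonempty_preirreducible_inter (U i).2 (U j).2 (hneX i) (hneX j)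
    obtain ⟨r, hr, hxr⟩ := (hU i).exists_basicOpen_le ⟨x, hx.2⟩ hx.1
    have hr0 : r ≠ 0 := by
      rintro rfl
      simp at hxr
    have h1 : (f.app (U i)).hom r ≠ 0 := by
      rw [map_ne_zero_iff _ (hinj i)]; exact hr0
    have h2 : Y.basicOpen ((f.app (U i)).hom r) ≠ ⊥ := fun h =>
      h1 ((basicOpen_eq_bot_iff _).mp h)
    have h3 : Y.basicOpen ((f.app (U i)).hom r) = f ⁻¹ᵁ X.basicOpen r := (f.preimage_basicOpen r).symm
    obtain ⟨y, hy⟩ := (TopologicalSpace.Opens.ne_bot_iff_nonempty _).mp h2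
    have hy' : y ∈ f ⁻¹ᵁ X.basicOpen r := by rw [← h3]; exact hy
    exact ⟨y, X.basicOpen_le r hy', hr hy'⟩
  have hne : Nonempty Y := by
    obtain ⟨i, -⟩ := hc (Nonempty.some inferInstance)
    exact ⟨(hmeet i i).some⟩
  have : IrreducibleSpace Y :=
    { toNonempty := hne
      isPreirreducible_univ := by
        rintro V₁ V₂ h₁ h₂ ⟨y₁, -, hy₁⟩ ⟨y₂, -, hy₂⟩
        obtain ⟨i, hi⟩ := hc (f y₁)
        obtain ⟨j, hj⟩ := hc (f y₂)
        obtain ⟨y, hy⟩ := hmeet i j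
        -- Irreducibility of piece `j` makes `V₂` reach piece `i`; irreducibility of piece `i` then
        -- makes `V₁` and `V₂` meet.
        obtain ⟨a, ha, ha'⟩ := hirr j V₂ _ h₂ (f ⁻¹ᵁ U i).2 ⟨y₂, hj, hy₂⟩ ⟨y, hy.2, hy.1⟩
        obtain ⟨b, hb, hb'⟩ := hirr i V₁ V₂ h₁ h₂ ⟨y₁, hi, hy₁⟩ ⟨a, ha'.2, ha'.1⟩
        exact ⟨b, trivial, hb'⟩ }
  exact isIntegral_of_irreducibleSpace_of_isReduced Y

end Integral
end AlgebraicGeometry.Scheme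

/-! ### Fibre coordinates on the cotangent bundle -/

namespace AlgebraicGeometry.Scheme
open AffineZariskiSite InvariantSubring

section CotangentCoordinates

variable {k : Type u} [Field k] {X : Scheme.{u}} (p : X ⟶ Spec (.of k))

/-- An affine open of a smooth scheme of relative dimension `d` on which the structure morphism is
standard smooth. -/
def IsStandardOpen (d : ℕ) (U : X.Opens) : Prop :=
  IsAffineOpen U ∧ (structureHom p U).IsStandardSmoothOfRelativeDimension d

lemma exists_isStandardOpen (d : ℕ) [SmoothOfRelativeDimension d p] (x : X) :
    ∃ U : X.Opens, IsStandardOpen p d U ∧ x ∈ U := by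
  obtain ⟨U, hU, V, hV, hx, e, h⟩ :=
    SmoothOfRelativeDimension.exists_isStandardSmoothOfRelativeDimension (n := d) (f := p) x
  -- `Spec k` is a single point, so a nonempty open of it is everything.
  obtain rfl : U = ⊤ := by
    have : Subsingleton (Spec (.of k)) := inferInstanceAs (Subsingleton (PrimeSpectrum k))
    rw [eq_top_iff]
    intro y _
    rw [Subsingleton.elim y (p x)]
    exact e hx
  refine ⟨V, ⟨hV, ?_⟩, hx⟩
  rw [structureHom, CommRingCat.hom_comp]
  have h1 := RingHom.IsStandardSmoothOfRelativeDimension.equiv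
    (ΓSpecIso (.of k)).symm.commRingCatIsoToRingEquiv
  exact h.comp h1

variable {p} in
lemma IsStandardOpen.isIntegrallyClosed [IsIntegral X] {d : ℕ} {U : X.Opens}
    (h : IsStandardOpen p d U) [Nonempty U] : IsIntegrallyClosed Γ(X, U) :=
  h.2.isStandardSmooth.isIntegrallyClosed

variable {p} in
/-- Fibre coordinates on the cotangent bundle over a small affine open. -/
lemma IsStandardOpen.exists_mvPolynomial_equiv [Smooth p] {d : ℕ} {U : X.Opens}
    (h : IsStandardOpen p d U) [Nontrivial Γ(X, U)] :
    ∃ θ : MvPolynomial (Fin d) Γ(X, U) ≃+* Γ(cotangentBundle p, cotangentBundleToBase p ⁻¹ᵁ U),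
      θ.toRingHom.comp MvPolynomial.C = ((cotangentBundleToBase p).app U).hom := by
  let U' : X.AffineZariskiSite := ⟨U, h.1⟩
  let H := coequifibered_cotangentDiagramMap p
  let e : Γ(cotangentBundle p, cotangentBundleToBase p ⁻¹ᵁ U) ≃+*
      CotangentAlgebra.functionsObj (structureHom p U) :=
    (asIso (relativeSpecSections H U')).commRingCatIsoToRingEquiv
  have he : ∀ a, e (((cotangentBundleToBase p).app U).hom a) =
      (CotangentAlgebra.functionsBase (structureHom p U)).hom a := fun a =>
    congr($(app_relativeSpecSections H U').hom a)
  let _ : Algebra k Γ(X, U) := (structureHom p U).toAlgebra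
  have : Algebra.IsStandardSmoothOfRelativeDimension d k Γ(X, U) := h.2
  have : Algebra.IsStandardSmooth k Γ(X, U) :=
    Algebra.IsStandardSmoothOfRelativeDimension.isStandardSmooth d
  have : Module.Free Γ(X, U) Ω[Γ(X, U)⁄k] := inferInstance
  have : Module.Finite Γ(X, U) Ω[Γ(X, U)⁄k] := inferInstance
  have hr : Module.finrank Γ(X, U) Ω[Γ(X, U)⁄k] = d := by
    rw [Module.finrank, Algebra.IsStandardSmoothOfRelativeDimension.rank_kaehlerDifferential d]
    simp
  -- Standard smoothness makes the differentials free of rank `d`; the dual basis turns the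
  -- symmetric algebra of the vector fields into a polynomial ring in `d` variables.
  let b := (Module.finBasisOfFinrankEq Γ(X, U) Ω[Γ(X, U)⁄k] hr).dualBasis
  let g : CotangentAlgebra.Functions k Γ(X, U) ≃ₐ[Γ(X, U)] MvPolynomial (Fin d) Γ(X, U) :=
    SymmetricAlgebra.equivMvPolynomial b
  refine ⟨g.toRingEquiv.symm.trans e.symm, ?_⟩
  ext a
  refine (RingEquiv.symm_apply_eq e).mpr ((g.symm.commutes a).trans (he a).symm)

end CotangentCoordinates
end AlgebraicGeometry.Scheme

/-! ### Coproducts of polynomial rings and iterated coproducts -/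

namespace IsRingCoproduct

variable {A S : Type u} [CommRing A] [CommRing S] {ι J : Type}

/-- A polynomial ring is a coproduct of polynomial rings. -/
lemma mvPolynomial {s : A →+* S} (θ : MvPolynomial ι A ≃+* S)
    (hθ : θ.toRingHom.comp MvPolynomial.C = s) :
    IsRingCoproduct (R := fun _ : J => S) (fun _ => s) (MvPolynomial.C : A →+* MvPolynomial (J × ι) A)
      (fun j => ((MvPolynomial.rename (Prod.mk j)).toRingHom).comp θ.symm.toRingHom) := by
  have hθ' : ∀ a, θ.symm (s a) = MvPolynomial.C a := fun a => by
    rw [RingEquiv.symm_apply_eq, ← hθ]; rfl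
  refine ⟨fun j => ?_, fun {E} _ e g hg => ?_⟩
  · refine RingHom.ext fun a => ?_
    change MvPolynomial.rename (Prod.mk j) (θ.symm (s a)) = _
    rw [hθ', MvPolynomial.rename_C]
  · refine ⟨MvPolynomial.eval₂Hom e fun x => g x.1 (θ (MvPolynomial.X x.2)), ⟨?_, fun j => ?_⟩, ?_⟩
    · ext a; simp
    · have : ((MvPolynomial.eval₂Hom e fun x => g x.1 (θ (MvPolynomial.X x.2))).comp
          (MvPolynomial.rename (Prod.mk j)).toRingHom) = (g j).comp θ.toRingHom := by
        apply MvPolynomial.ringHom_ext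
        · intro a
          have : g j (s a) = e a := congr($(hg j) a)
          rw [← hθ] at this
          simpa using this.symm
        · intro i; simp
      rw [← RingHom.comp_assoc, this, RingHom.comp_assoc]
      ext x; simp
    · rintro h ⟨h0, hj⟩
      apply MvPolynomial.ringHom_ext
      · intro a
        simpa using congr($h0 a)
      · rintro ⟨j, i⟩
        have := congr($(hj j) (θ (MvPolynomial.X i)))
        simpa using this

/-- A coproduct of coproducts is a coproduct. -/
lemma sigma {K : J → Type} {D : Type u} {R : J → Type u} {T : ∀ j, K j → Type u} [CommRing D]
    [∀ j, CommRing (R j)] [∀ j i, CommRing (T j i)] {a : ∀ j, A →+* R j} {d : A →+* D}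
    {i : ∀ j, R j →+* D} {t : ∀ j l, A →+* T j l} {r : ∀ j l, T j l →+* R j}
    (H : IsRingCoproduct a d i) (h : ∀ j, IsRingCoproduct (t j) (a j) (r j)) :
    IsRingCoproduct (R := fun x : Σ j, K j => T x.1 x.2) (fun x => t x.1 x.2) d
      (fun x => (i x.1).comp (r x.1 x.2)) := by
  refine ⟨fun x => ?_, fun {E} _ e g hg => ?_⟩
  · rw [RingHom.comp_assoc, (h x.1).comp, H.comp]
  · choose f hf hf' using fun j => (h j).existsUnique e (fun l => g ⟨j, l⟩) fun l => hg ⟨j, l⟩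
    obtain ⟨m, ⟨hm0, hm⟩, -⟩ := H.existsUnique e f fun j => (hf j).1
    refine ⟨m, ⟨hm0, fun x => ?_⟩, ?_⟩
    · rw [← RingHom.comp_assoc, hm, (hf x.1).2]
    · rintro m' ⟨h0, h1⟩
      apply H.hom_ext
      · rw [h0, hm0]
      · intro j
        apply (h j).hom_ext
        · rw [RingHom.comp_assoc, H.comp, h0, RingHom.comp_assoc, H.comp, hm0]
        · intro l
          have := h1 ⟨j, l⟩
          rw [RingHom.comp_assoc, this, RingHom.comp_assoc, ← RingHom.comp_assoc, hm, (hf j).2]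

end IsRingCoproduct

/-! ### Sections over `X`, permutations of coordinates, block decompositions -/

namespace AlgebraicGeometry.Scheme
open AffineZariskiSite InvariantSubring

section OverApp

variable {X Y Z W : Scheme.{u}} {f : Y ⟶ X} {f' : Z ⟶ X} {f'' : W ⟶ X}

lemma preimage_le_of_over {g : Y ⟶ Z} (h : g ≫ f' = f) (U : X.Opens) :
    f ⁻¹ᵁ U ≤ g ⁻¹ᵁ f' ⁻¹ᵁ U := by
  rw [← h]; exact le_rfl

/-- The pullback of sections over an open of `X` along a morphism over `X`. -/
def overApp {g : Y ⟶ Z} (h : g ≫ f' = f) (U : X.Opens) : Γ(Z, f' ⁻¹ᵁ U) →+* Γ(Y, f ⁻¹ᵁ U) :=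
  (g.appLE _ _ (preimage_le_of_over h U)).hom

lemma overApp_comp_app {g : Y ⟶ Z} (h : g ≫ f' = f) (U : X.Opens) :
    (overApp h U).comp (f'.app U).hom = (f.app U).hom := by
  rw [overApp, ← CommRingCat.hom_comp, Hom.app_eq_appLE, Hom.appLE_comp_appLE, Hom.app_eq_appLE]
  simp only [h]

lemma overApp_comp {g : Y ⟶ Z} (h : g ≫ f' = f) {g' : Z ⟶ W} (h' : g' ≫ f'' = f')
    {m : Y ⟶ W} (hm : m ≫ f'' = f) (e : g ≫ g' = m) (U : X.Opens) :
    (overApp h U).comp (overApp h' U) = overApp hm U := by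
  subst e
  rw [overApp, overApp, ← CommRingCat.hom_comp, Hom.appLE_comp_appLE]
  rfl

lemma overApp_map {g : Y ⟶ Z} (h : g ≫ f' = f) {U V : X.Opens} (i : U ≤ V) (x : Γ(Z, f' ⁻¹ᵁ V)) :
    (Y.presheaf.map (homOfLE (f.preimage_mono i)).op).hom (overApp h V x) =
      overApp h U ((Z.presheaf.map (homOfLE (f'.preimage_mono i)).op).hom x) := by
  have h1 := g.appLE_map (preimage_le_of_over h V) (homOfLE (f.preimage_mono i)).op
  have h2 := g.map_appLE (preimage_le_of_over h U) (homOfLE (f'.preimage_mono i)).op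
  exact congr($(h1.trans h2.symm).hom x)

lemma hom_ext_of_overApp [IsAffineHom f'] {g g' : Y ⟶ Z} (h : g ≫ f' = f) (h' : g' ≫ f' = f)
    (H : ∀ U : X.Opens, IsAffineOpen U → overApp h U = overApp h' U) : g = g' := by
  refine hom_ext_of_appLE f' f h h' (fun U : X.affineOpens => U.1) (fun U => U.2) (fun x => ?_)
    fun U => ?_
  · obtain ⟨_, ⟨U, hU, rfl⟩, hxU, -⟩ :=
      X.isBasis_affineOpens.exists_subset_of_mem_open (Set.mem_univ x) isOpen_univ
    exact ⟨⟨U, hU⟩, hxU⟩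
  · exact CommRingCat.hom_ext (H U.1 U.2)

end OverApp

section Products

variable {X T : Scheme.{u}} (q : T ⟶ X)

lemma fiberPowerProj_toBase {n : ℕ} (i : Fin n) : fiberPowerProj q i ≫ q = fiberPowerToBase q n :=
  WidePullback.π_arrow _ i

lemma fiberPowerPerm_proj {n : ℕ} (σ : Equiv.Perm (Fin n)) (i : Fin n) :
    fiberPowerPerm q n σ ≫ fiberPowerProj q i = fiberPowerProj q (σ i) :=
  WidePullback.lift_π _ _ _ _ _

variable {q} in
lemma fiberPower_hom_ext {n : ℕ} {Y : Scheme.{u}} {g g' : Y ⟶ fiberPower q n}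
    (h0 : g ≫ fiberPowerToBase q n = g' ≫ fiberPowerToBase q n)
    (h : ∀ i, g ≫ fiberPowerProj q i = g' ≫ fiberPowerProj q i) : g = g' :=
  WidePullback.hom_ext _ _ _ h h0

/-- Composition of morphisms here is in diagrammatic order, so after pulling back functions this is
a left action of the symmetric group, as the Reynolds operator requires. -/
lemma fiberPowerPerm_mul {n : ℕ} (σ σ' : Equiv.Perm (Fin n)) :
    fiberPowerPerm q n (σ * σ') = fiberPowerPerm q n σ ≫ fiberPowerPerm q n σ' := by
  apply fiberPower_hom_ext
  · rw [Category.assoc, fiberPowerPerm_toBase, fiberPowerPerm_toBase, fiberPowerPerm_toBase]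
  · intro i
    rw [Category.assoc, fiberPowerPerm_proj, fiberPowerPerm_proj, fiberPowerPerm_proj]
    rfl

variable {s : ℕ} (α : Fin s → ℕ)

/-- The structure morphism of the product of the fibre powers. -/
abbrev fiberPowerProdToBase : fiberPowerProd q α ⟶ X :=
  WidePullback.base (fun j => fiberPowerToBase q (α j))

/-- The projections of the product of the fibre powers. -/
abbrev fiberPowerProdProj (j : Fin s) : fiberPowerProd q α ⟶ fiberPower q (α j) :=
  WidePullback.π (fun j => fiberPowerToBase q (α j)) j

lemma fiberPowerProdProj_toBase (j : Fin s) :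
    fiberPowerProdProj q α j ≫ fiberPowerToBase q (α j) = fiberPowerProdToBase q α :=
  WidePullback.π_arrow _ j

/-- The coordinates of the product of the fibre powers. -/
def partProj (b : Part α) : fiberPowerProd q α ⟶ T :=
  fiberPowerProdProj q α b.1 ≫ fiberPowerProj q b.2

lemma partProj_toBase (b : Part α) : partProj q α b ≫ q = fiberPowerProdToBase q α := by
  rw [partProj, Category.assoc, fiberPowerProj_toBase, fiberPowerProdProj_toBase]

/-- The automorphism of the product of the fibre powers permuting the factors of each. -/
def prodPerm (g : ∀ j, Equiv.Perm (Fin (α j))) : fiberPowerProd q α ⟶ fiberPowerProd q α :=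
  WidePullback.lift (fiberPowerProdToBase q α)
    (fun j => fiberPowerProdProj q α j ≫ fiberPowerPerm q (α j) (g j)) fun j => by
      rw [Category.assoc, fiberPowerPerm_toBase, fiberPowerProdProj_toBase]

lemma prodPerm_toBase (g : ∀ j, Equiv.Perm (Fin (α j))) :
    prodPerm q α g ≫ fiberPowerProdToBase q α = fiberPowerProdToBase q α :=
  WidePullback.lift_base _ _ _ _

lemma prodPerm_proj (g : ∀ j, Equiv.Perm (Fin (α j))) (j : Fin s) :
    prodPerm q α g ≫ fiberPowerProdProj q α j =
      fiberPowerProdProj q α j ≫ fiberPowerPerm q (α j) (g j) :=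
  WidePullback.lift_π _ _ _ _ _

lemma prodPerm_partProj (g : ∀ j, Equiv.Perm (Fin (α j))) (b : Part α) :
    prodPerm q α g ≫ partProj q α b = partProj q α ⟨b.1, g b.1 b.2⟩ := by
  rw [partProj, ← Category.assoc, prodPerm_proj, Category.assoc, fiberPowerPerm_proj, partProj]

variable {α} {n : ℕ}

lemma repeatMap_toBase (c : Fin n → Part α) :
    repeatMap q c ≫ fiberPowerToBase q n = fiberPowerProdToBase q α :=
  WidePullback.lift_base _ _ _ _

lemma repeatMap_proj (c : Fin n → Part α) (i : Fin n) :
    repeatMap q c ≫ fiberPowerProj q i = partProj q α (c i) :=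
  WidePullback.lift_π _ _ _ _ _

lemma repeatMap_fiberPowerPerm (c : Fin n → Part α) (π : Equiv.Perm (Fin n)) :
    repeatMap q c ≫ fiberPowerPerm q n π = repeatMap q (c ∘ π) := by
  apply fiberPower_hom_ext
  · rw [Category.assoc, fiberPowerPerm_toBase, repeatMap_toBase, repeatMap_toBase]
  · intro i
    rw [Category.assoc, fiberPowerPerm_proj, repeatMap_proj, repeatMap_proj]
    rfl

/-- Permuting parts of equal size changes `c` by composition on the left, while permuting places
changes it on the right. Both preserve block decompositions, so the first change can be undone by
the second, which is invisible in the Chow scheme. -/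
lemma prodPerm_repeatMap (g : ∀ j, Equiv.Perm (Fin (α j))) (c : Fin n → Part α) :
    prodPerm q α g ≫ repeatMap q c = repeatMap q (Equiv.sigmaCongrRight g ∘ c) := by
  apply fiberPower_hom_ext
  · rw [Category.assoc, repeatMap_toBase, repeatMap_toBase, prodPerm_toBase]
  · intro i
    rw [Category.assoc, repeatMap_proj, repeatMap_proj, prodPerm_partProj]
    rfl

end Products

section BlockDecomposition

variable {s : ℕ} {α : Fin s → ℕ} {n : ℕ}

/-- The disjoint union of the blocks has `n` elements by `hα`; any bijection with `Fin n` gives a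
decomposition. Since `Fin s` starts at `0`, the index `j` stands for parts of size `j + 1`. -/
lemma exists_isBlockDecomposition (hα : ∑ j : Fin s, ((j : ℕ) + 1) * α j = n) :
    ∃ c : Fin n → Part α, IsBlockDecomposition c := by
  have h : Fintype.card (Σ b : Part α, Fin ((b.1 : ℕ) + 1)) = Fintype.card (Fin n) := by
    rw [Fintype.card_sigma, Fintype.card_fin, ← hα, Fintype.sum_sigma]
    refine Finset.sum_congr rfl fun j _ => ?_
    simp [mul_comm]
  let e := (Fintype.equivOfCardEq h).symm
  refine ⟨fun i => (e i).1, fun b => ?_⟩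
  have e1 : {i // (e i).1 = b} ≃ {x : (Σ b : Part α, Fin ((b.1 : ℕ) + 1)) // x.1 = b} :=
    e.subtypeEquiv fun _ => Iff.rfl
  rw [Nat.card_congr (e1.trans (Equiv.sigmaSubtype b))]
  simp

lemma IsBlockDecomposition.surjective {c : Fin n → Part α} (hc : IsBlockDecomposition c) :
    Function.Surjective c := fun b => by
  have : 0 < Nat.card {i // c i = b} := by rw [hc b]; omega
  obtain ⟨⟨i, hi⟩⟩ := (Nat.card_pos_iff.mp this).1
  exact ⟨i, hi⟩

/-- Choose bijections between corresponding fibres and assemble them. This is why the choice of a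
block decomposition is immaterial modulo permutations of the places. -/
lemma exists_perm_of_card_fiber_eq {β : Type*} {c c' : Fin n → β}
    (h : ∀ b, Nat.card {i // c i = b} = Nat.card {i // c' i = b}) :
    ∃ π : Equiv.Perm (Fin n), c ∘ π = c' := by
  have e (b : β) : {i // c' i = b} ≃ {i // c i = b} := Classical.choice ((Finite.card_eq (α := {i // c' i = b})).mp (h b).symm)
  refine ⟨(Equiv.sigmaFiberEquiv c').symm.trans ((Equiv.sigmaCongrRight e).trans
    (Equiv.sigmaFiberEquiv c)), funext fun i => ?_⟩
  exact (e (c' i) ⟨i, rfl⟩).2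

lemma IsBlockDecomposition.exists_perm {c c' : Fin n → Part α} (hc : IsBlockDecomposition c)
    (hc' : IsBlockDecomposition c') : ∃ π : Equiv.Perm (Fin n), c ∘ π = c' :=
  exists_perm_of_card_fiber_eq fun b => (hc b).trans (hc' b).symm

lemma IsBlockDecomposition.sigmaCongrRight_comp {c : Fin n → Part α} (hc : IsBlockDecomposition c)
    (g : ∀ j, Equiv.Perm (Fin (α j))) :
    IsBlockDecomposition (Equiv.sigmaCongrRight g ∘ c) := fun b => by
  have e : {i // (Equiv.sigmaCongrRight g ∘ c) i = b} ≃
      {i // c i = (Equiv.sigmaCongrRight g).symm b} :=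
    Equiv.subtypeEquivRight fun i => by
      rw [Function.comp_apply, Equiv.eq_symm_apply]
  rw [Nat.card_congr e, hc]
  rfl

end BlockDecomposition
end AlgebraicGeometry.Scheme

lemma RingHom.exists_comp_eq_of_injective {B C D : Type*} [CommRing B] [CommRing C] [CommRing D]
    (φ : C →+* B) (hφ : Function.Injective φ) (ρ : D →+* B) (h : ∀ x, ∃ y, φ y = ρ x) :
    ∃ t : D →+* C, φ.comp t = ρ := by
  choose t ht using h
  exact ⟨{ toFun := t
           map_one' := hφ (by simp [ht])
           map_zero' := hφ (by simp [ht])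
           map_add' := fun x y => hφ (by simp [ht])
           map_mul' := fun x y => hφ (by simp [ht]) }, RingHom.ext ht⟩

/-! ### Sections of products of Chow schemes; the addition morphism -/

namespace AlgebraicGeometry.Scheme
open AffineZariskiSite InvariantSubring

section ChowSections

variable {X T : Scheme.{u}} (q : T ⟶ X) [IsAffineHom q]

instance (n : ℕ) : IsAffineHom (chowToBase q n) :=
  inferInstanceAs (IsAffineHom (quotientToBase _ _ _))

variable {U : X.Opens}

lemma overApp_chowMap_injective (hU : IsAffineOpen U) (n : ℕ) :
    Function.Injective (overApp (chowMap_toBase q n) U) :=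
  toQuotient_appLE_injective (fiberPowerToBase q n) (fiberPowerPerm q n)
    (fiberPowerPerm_toBase q n) ⟨U, hU⟩

lemma mem_range_overApp_chowMap (hU : IsAffineOpen U) (n : ℕ) (x : Γ(fiberPower q n, fiberPowerToBase q n ⁻¹ᵁ U)) :
    x ∈ Set.range (overApp (chowMap_toBase q n) U) ↔
      ∀ σ, overApp (fiberPowerPerm_toBase q n σ) U x = x :=
  mem_range_toQuotient_appLE (fiberPowerToBase q n) (fiberPowerPerm q n)
    (fiberPowerPerm_toBase q n) ⟨U, hU⟩ x

lemma fiberPowerPerm_chowMap {n : ℕ} (σ : Equiv.Perm (Fin n)) :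
    fiberPowerPerm q n σ ≫ chowMap q n = chowMap q n := by
  have h : (fiberPowerPerm q n σ ≫ chowMap q n) ≫ chowToBase q n = fiberPowerToBase q n := by
    rw [Category.assoc, chowMap_toBase, fiberPowerPerm_toBase]
  refine hom_ext_of_overApp h (chowMap_toBase q n) fun U hU => ?_
  rw [← overApp_comp (fiberPowerPerm_toBase q n σ) (chowMap_toBase q n) h rfl U]
  ext x
  exact (mem_range_overApp_chowMap q hU n _).mp ⟨x, rfl⟩ σ

lemma isRingCoproduct_fiberPower (hU : IsAffineOpen U) (n : ℕ) :
    IsRingCoproduct (fun _ : Fin n => (q.app U).hom) ((fiberPowerToBase q n).app U).hom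
      (fun i => overApp (fiberPowerProj_toBase q i) U) :=
  isRingCoproduct_widePullback (fun _ : Fin n => q) hU

variable {s : ℕ} (α : Fin s → ℕ)

lemma isRingCoproduct_fiberPowerProd (hU : IsAffineOpen U) :
    IsRingCoproduct (fun j => ((fiberPowerToBase q (α j)).app U).hom)
      ((fiberPowerProdToBase q α).app U).hom
      (fun j => overApp (fiberPowerProdProj_toBase q α j) U) :=
  isRingCoproduct_widePullback (fun j => fiberPowerToBase q (α j)) hU

lemma isRingCoproduct_partProj (hU : IsAffineOpen U) :
    IsRingCoproduct (fun _ : Part α => (q.app U).hom)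
      ((fiberPowerProdToBase q α).app U).hom
      (fun b => overApp (partProj_toBase q α b) U) := by
  have h := (isRingCoproduct_fiberPowerProd q α hU).sigma
    fun j => isRingCoproduct_fiberPower q hU (α j)
  have e : ∀ b : Part α, (overApp (fiberPowerProdProj_toBase q α b.1) U).comp
      (overApp (fiberPowerProj_toBase q b.2) U) = overApp (partProj_toBase q α b) U := fun b =>
    overApp_comp _ _ _ rfl U
  simpa only [e] using h

/-- The projections of the product of the relative Chow schemes. -/
def chowProdProj (j : Fin s) : chowProd q α ⟶ Chow q (α j) :=
  WidePullback.π (fun j => chowToBase q (α j)) j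

lemma chowProdProj_toBase (j : Fin s) :
    chowProdProj q α j ≫ chowToBase q (α j) = chowProdToBase q α :=
  WidePullback.π_arrow _ j

lemma chowProdMap_toBase : chowProdMap q α ≫ chowProdToBase q α = fiberPowerProdToBase q α :=
  WidePullback.lift_base _ _ _ _

lemma chowProdMap_proj (j : Fin s) :
    chowProdMap q α ≫ chowProdProj q α j = fiberPowerProdProj q α j ≫ chowMap q (α j) :=
  WidePullback.lift_π _ _ _ _ _

instance : IsAffineHom (chowProdToBase q α) :=
  isAffineHom_widePullback_base fun j => chowToBase q (α j)

instance : IsAffineHom (fiberPowerProdToBase q α) :=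
  isAffineHom_widePullback_base fun j => fiberPowerToBase q (α j)

lemma isRingCoproduct_chowProd (hU : IsAffineOpen U) :
    IsRingCoproduct (fun j => ((chowToBase q (α j)).app U).hom)
      ((chowProdToBase q α).app U).hom
      (fun j => overApp (chowProdProj_toBase q α j) U) :=
  isRingCoproduct_widePullback (fun j => chowToBase q (α j)) hU

/-- The sections of the product are the coproduct of the rings of symmetric invariants. Over a
`ℚ`-algebra the orders of the symmetric groups are invertible, so the Reynolds operators apply and
this coproduct is the ring of invariants of the product group. -/
theorem overApp_chowProdMap_injective_and_range (hU : IsAffineOpen U) [Algebra ℚ Γ(X, U)] :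
    Function.Injective (overApp (chowProdMap_toBase q α) U) ∧
      ∀ x, x ∈ Set.range (overApp (chowProdMap_toBase q α) U) ↔
        ∀ g, overApp (prodPerm_toBase q α g) U x = x := by
  refine (isRingCoproduct_fiberPowerProd q α hU).injective_and_range_eq_fixed
    (isRingCoproduct_chowProd q α hU)
    (fun j σ => overApp (fiberPowerPerm_toBase q (α j) σ) U) (fun j g => overApp_comp_app _ _)
    (fun j g h => ?_) (fun j => overApp (chowMap_toBase q (α j)) U)
    (fun j => overApp_comp_app _ _)
    (fun j => overApp_chowMap_injective q hU (α j)) (fun j x => mem_range_overApp_chowMap q hU (α j) x)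
    (fun j => ?_)
    (overApp (chowProdMap_toBase q α) U) (overApp_comp_app _ _) (fun j => ?_)
    (fun g => overApp (prodPerm_toBase q α g) U) (fun g => overApp_comp_app _ _) (fun g j => ?_)
  · exact (overApp_comp _ _ _ (fiberPowerPerm_mul q g h).symm U).symm
  · have h1 : (Fintype.card (Equiv.Perm (Fin (α j))) : ℚ) ≠ 0 :=
      Nat.cast_ne_zero.mpr Fintype.card_ne_zero
    simpa using (IsUnit.mk0 _ h1).map (algebraMap ℚ Γ(X, U))
  · have h : (chowProdMap q α ≫ chowProdProj q α j) ≫ chowToBase q (α j) =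
        fiberPowerProdToBase q α := by
      rw [Category.assoc, chowProdProj_toBase, chowProdMap_toBase]
    rw [overApp_comp _ _ h rfl U,
      overApp_comp (fiberPowerProdProj_toBase q α j) _ h (chowProdMap_proj q α j).symm U]
  · have h : (prodPerm q α g ≫ fiberPowerProdProj q α j) ≫ fiberPowerToBase q (α j) =
        fiberPowerProdToBase q α := by
      rw [Category.assoc, fiberPowerProdProj_toBase, prodPerm_toBase]
    rw [overApp_comp _ _ h rfl U,
      overApp_comp (fiberPowerProdProj_toBase q α j) _ h (prodPerm_proj q α g j).symm U]

end ChowSections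

section Addition

variable {X T : Scheme.{u}} (q : T ⟶ X) [IsAffineHom q] {s : ℕ} {α : Fin s → ℕ} {n : ℕ}

lemma repeatMap_chowMap_eq {c c' : Fin n → Part α} (hc : IsBlockDecomposition c)
    (hc' : IsBlockDecomposition c') : repeatMap q c ≫ chowMap q n = repeatMap q c' ≫ chowMap q n := by
  obtain ⟨π, rfl⟩ := hc.exists_perm hc'
  rw [← repeatMap_fiberPowerPerm, Category.assoc, fiberPowerPerm_chowMap]

lemma prodPerm_repeatMap_chowMap {c : Fin n → Part α} (hc : IsBlockDecomposition c)
    (g : ∀ j, Equiv.Perm (Fin (α j))) :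
    prodPerm q α g ≫ repeatMap q c ≫ chowMap q n = repeatMap q c ≫ chowMap q n := by
  rw [← Category.assoc, prodPerm_repeatMap]
  exact repeatMap_chowMap_eq q (hc.sigmaCongrRight_comp g) hc

lemma repeatMap_chowMap_toBase (c : Fin n → Part α) :
    (repeatMap q c ≫ chowMap q n) ≫ chowToBase q n = fiberPowerProdToBase q α := by
  rw [Category.assoc, chowMap_toBase, repeatMap_toBase]

variable {q}

variable (hX : ∀ U : X.Opens, IsAffineOpen U → Nonempty (Algebra ℚ Γ(X, U)))
include hX

/-- Sections pull back injectively along `chowProdMap`, so it is epimorphic with respect to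
morphisms over `X` into schemes affine over `X`. -/
lemma chowProd_hom_ext_of_comp {Z : Scheme.{u}} {π : Z ⟶ X} [IsAffineHom π]
    {g g' : chowProd q α ⟶ Z} (hg : g ≫ π = chowProdToBase q α)
    (hg' : g' ≫ π = chowProdToBase q α) (h : chowProdMap q α ≫ g = chowProdMap q α ≫ g') :
    g = g' := by
  refine hom_ext_of_overApp hg hg' fun U hU => ?_
  obtain ⟨_⟩ := hX U hU
  have hm : (chowProdMap q α ≫ g) ≫ π = fiberPowerProdToBase q α := by
    rw [Category.assoc, hg, chowProdMap_toBase]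
  have h1 := overApp_comp (chowProdMap_toBase q α) hg hm rfl U
  have h2 := overApp_comp (chowProdMap_toBase q α) hg' hm h.symm U
  ext x
  exact (overApp_chowProdMap_injective_and_range q α hU).1 congr($(h1.trans h2.symm) x)

/-- The composite `repeatMap q c ≫ chowMap q n` is invariant under `prodPerm`, so on each affine
open its pullback of functions factors through the invariants. Injectivity into the functions on the
product of fibre powers makes the local factorizations compatible and `τ` unique. -/
theorem existsUnique_isAdditionMorphism (hα : ∑ j : Fin s, ((j : ℕ) + 1) * α j = n) :
    ∃! τ : chowProd q α ⟶ Chow q n, IsAdditionMorphism q α τ := by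
  obtain ⟨c, hc⟩ := exists_isBlockDecomposition hα
  refine existsUnique_of_exists_of_unique ?_ fun τ τ' h h' =>
    chowProd_hom_ext_of_comp hX h.toBase h'.toBase ((h.comp_eq c hc).trans (h'.comp_eq c hc).symm)
  let ρ (U : X.Opens) := overApp (repeatMap_chowMap_toBase q c) U
  have hinj (U : X.AffineZariskiSite) :
      Function.Injective (overApp (chowProdMap_toBase q α) U.toOpens) := by
    have hU : IsAffineOpen U.toOpens := U.2
    obtain ⟨_⟩ := hX U.toOpens hU
    exact (overApp_chowProdMap_injective_and_range q α hU).1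
  have key (U : X.AffineZariskiSite) : ∃ t : Γ(Chow q n, chowToBase q n ⁻¹ᵁ U.toOpens) →+*
      Γ(chowProd q α, chowProdToBase q α ⁻¹ᵁ U.toOpens),
      (overApp (chowProdMap_toBase q α) U.toOpens).comp t = ρ U.toOpens := by
    refine RingHom.exists_comp_eq_of_injective _ (hinj U) _ fun x => ?_
    have hU : IsAffineOpen U.toOpens := U.2
    obtain ⟨_⟩ := hX U.toOpens hU
    refine ((overApp_chowProdMap_injective_and_range q α hU).2 _).mpr fun g => ?_
    exact congr($(overApp_comp (prodPerm_toBase q α g) (repeatMap_chowMap_toBase q c)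
      (repeatMap_chowMap_toBase q c) (prodPerm_repeatMap_chowMap q hc g) U.toOpens) x)
  choose t ht using key
  have h0 (U : X.AffineZariskiSite) : (chowToBase q n).app U.toOpens ≫ CommRingCat.ofHom (t U) =
      (chowProdToBase q α).app U.toOpens := by
    ext x
    apply hinj U
    have h1 := congr($(ht U) (((chowToBase q n).app U.toOpens).hom x))
    have h2 := congr($(overApp_comp_app (repeatMap_chowMap_toBase q c) U.toOpens) x)
    have h3 := congr($(overApp_comp_app (chowProdMap_toBase q α) U.toOpens) x)
    exact h1.trans (h2.trans h3.symm)
  have h1 (U V : X.AffineZariskiSite) (i : U ≤ V) : CommRingCat.ofHom (t V) ≫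
      (chowProd q α).presheaf.map
        (homOfLE ((chowProdToBase q α).preimage_mono (toOpens_mono i))).op =
      (Chow q n).presheaf.map (homOfLE ((chowToBase q n).preimage_mono (toOpens_mono i))).op ≫
        CommRingCat.ofHom (t U) := by
    ext x
    apply hinj U
    have h1 := congr($(ht V) x)
    have h2 := congr($(ht U) (((Chow q n).presheaf.map
      (homOfLE ((chowToBase q n).preimage_mono (toOpens_mono i))).op).hom x))
    refine Eq.trans ?_ h2.symm
    refine (overApp_map (chowProdMap_toBase q α) (toOpens_mono i) _).symm.trans ?_
    refine Eq.trans ?_ (overApp_map (repeatMap_chowMap_toBase q c) (toOpens_mono i) x)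
    exact congr(((fiberPowerProd q α).presheaf.map
      (homOfLE ((fiberPowerProdToBase q α).preimage_mono (toOpens_mono i))).op).hom $h1)
  obtain ⟨τ, hτ, hτt⟩ := exists_hom_of_appLE (chowToBase q n) (chowProdToBase q α)
    (fun U => CommRingCat.ofHom (t U)) h0 h1
  have h : chowProdMap q α ≫ τ = repeatMap q c ≫ chowMap q n := by
    have hm : (chowProdMap q α ≫ τ) ≫ chowToBase q n = fiberPowerProdToBase q α := by
      rw [Category.assoc, hτ, chowProdMap_toBase]
    refine hom_ext_of_overApp hm (repeatMap_chowMap_toBase q c) fun U hU => ?_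
    rw [← overApp_comp (chowProdMap_toBase q α) hτ hm rfl U]
    have h1 : overApp hτ U = t ⟨U, hU⟩ := congr($(hτt ⟨U, hU⟩ (preimage_le_of_over hτ U)).hom)
    rw [h1]
    exact ht ⟨U, hU⟩
  -- Two block decompositions differ by a permutation of the places, so the equation for `c` gives
  -- it for every `c'`.
  exact ⟨τ, hτ, fun c' hc' => h.trans (repeatMap_chowMap_eq q hc hc')⟩

end Addition
end AlgebraicGeometry.Scheme

/-! ### Coordinate opens: integral closedness, integrality and birationality -/

namespace AlgebraicGeometry.Scheme
open AffineZariskiSite InvariantSubring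

section CoordinateOpen

variable {X T : Scheme.{u}} (q : T ⟶ X) (d : ℕ)

/-- A nonempty affine open over which `q` has `d` linear fibre coordinates, on a normal scheme over `ℚ`. -/
structure IsCoordinateOpen (U : X.Opens) : Prop where
  isAffineOpen : IsAffineOpen U
  nonempty : Nonempty U
  isIntegrallyClosed : IsIntegrallyClosed Γ(X, U)
  exists_equiv : ∃ θ : MvPolynomial (Fin d) Γ(X, U) ≃+* Γ(T, q ⁻¹ᵁ U),
    θ.toRingHom.comp MvPolynomial.C = (q.app U).hom
  algebra : Nonempty (Algebra ℚ Γ(X, U))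

variable {q d} [IsAffineHom q] {U : X.Opens} {s : ℕ} (α : Fin s → ℕ) {n : ℕ}

/-- The product of the fibre powers is a fibre product of copies of `T` indexed by the parts, so its
functions are polynomials in one copy of the fibre coordinates per part; `h1`-type formulas below
use the explicit values of `Θ` on variables. -/
lemma exists_fiberPowerProd_equiv (hU : IsAffineOpen U) {ι : Type}
    (θ : MvPolynomial ι Γ(X, U) ≃+* Γ(T, q ⁻¹ᵁ U))
    (hθ : θ.toRingHom.comp MvPolynomial.C = (q.app U).hom) :
    ∃ Θ : MvPolynomial (Part α × ι) Γ(X, U) ≃+* Γ(fiberPowerProd q α, fiberPowerProdToBase q α ⁻¹ᵁ U),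
      (∀ a, Θ (MvPolynomial.C a) = ((fiberPowerProdToBase q α).app U).hom a) ∧
      ∀ b i, Θ (MvPolynomial.X (b, i)) = overApp (partProj_toBase q α b) U (θ (MvPolynomial.X i)) := by
  obtain ⟨Θ, h0, h1⟩ := (IsRingCoproduct.mvPolynomial (J := Part α) θ hθ).exists_ringEquiv
    (isRingCoproduct_partProj q α hU)
  refine ⟨Θ, fun a => congr($h0 a), fun b i => ?_⟩
  have := congr($(h1 b) (θ (MvPolynomial.X i)))
  simpa using this

namespace IsCoordinateOpen

variable (h : IsCoordinateOpen q d U)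
include h

omit [IsAffineHom q] in
lemma isDomain [IsIntegral X] : IsDomain Γ(X, U) := by
  have := h.nonempty
  infer_instance

lemma isDomain_fiberPowerProd [IsIntegral X] :
    IsDomain Γ(fiberPowerProd q α, fiberPowerProdToBase q α ⁻¹ᵁ U) := by
  obtain ⟨θ, hθ⟩ := h.exists_equiv
  obtain ⟨Θ, -⟩ := exists_fiberPowerProd_equiv α h.isAffineOpen θ hθ
  have := h.isDomain
  exact Θ.symm.toMulEquiv.isDomain _

lemma isIntegrallyClosed_fiberPowerProd [IsIntegral X] :
    IsIntegrallyClosed Γ(fiberPowerProd q α, fiberPowerProdToBase q α ⁻¹ᵁ U) := by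
  obtain ⟨θ, hθ⟩ := h.exists_equiv
  obtain ⟨Θ, -⟩ := exists_fiberPowerProd_equiv α h.isAffineOpen θ hθ
  have := h.isDomain
  have := h.isIntegrallyClosed
  have := MvPolynomial.isIntegrallyClosed_of_finite (A := Γ(X, U)) (Part α × Fin d)
  exact IsIntegrallyClosed.of_equiv Θ

lemma fiberPowerProdToBase_app_injective :
    Function.Injective ((fiberPowerProdToBase q α).app U).hom := by
  obtain ⟨θ, hθ⟩ := h.exists_equiv
  obtain ⟨Θ, h0, -⟩ := exists_fiberPowerProd_equiv α h.isAffineOpen θ hθ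
  intro a a' e
  rw [← h0, ← h0] at e
  exact MvPolynomial.C_injective _ _ (Θ.injective e)

lemma overApp_chowProdMap_injective :
    Function.Injective (overApp (chowProdMap_toBase q α) U) :=
  have ⟨_⟩ := h.algebra
  (overApp_chowProdMap_injective_and_range q α h.isAffineOpen).1

lemma mem_range_overApp_chowProdMap (x) :
    x ∈ Set.range (overApp (chowProdMap_toBase q α) U) ↔
      ∀ g, overApp (prodPerm_toBase q α g) U x = x :=
  have ⟨_⟩ := h.algebra
  (overApp_chowProdMap_injective_and_range q α h.isAffineOpen).2 x

lemma isDomain_chowProd [IsIntegral X] : IsDomain Γ(chowProd q α, chowProdToBase q α ⁻¹ᵁ U) :=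
  have := h.isDomain_fiberPowerProd α
  (h.overApp_chowProdMap_injective α).isDomain _

/-- The sections form a ring of invariants in a polynomial ring over an integrally closed domain. -/
lemma isIntegrallyClosed_chowProd [IsIntegral X] :
    IsIntegrallyClosed Γ(chowProd q α, chowProdToBase q α ⁻¹ᵁ U) := by
  have := h.isDomain_fiberPowerProd α
  have := h.isIntegrallyClosed_fiberPowerProd α
  have := h.isDomain_chowProd α
  refine isIntegrallyClosed_of_range_eq_fixed (overApp (chowProdMap_toBase q α) U)
    (h.overApp_chowProdMap_injective α)
    (Set.range fun g => overApp (prodPerm_toBase q α g) U) fun b => ?_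
  rw [h.mem_range_overApp_chowProdMap α]
  simp

lemma chowProdToBase_app_injective :
    Function.Injective ((chowProdToBase q α).app U).hom := by
  have h1 := h.fiberPowerProdToBase_app_injective α
  rw [← overApp_comp_app (chowProdMap_toBase q α) U] at h1
  exact Function.Injective.of_comp (f := overApp (chowProdMap_toBase q α) U) h1

omit h in
-- A permutation of the places only reorders the factors, so the coefficients are symmetric
-- functions of the values of `f` at the `n` points, and descend to the Chow scheme.
lemma coeff_prod_mem_range (hU : IsAffineOpen U) (f : Γ(T, q ⁻¹ᵁ U)) (m : ℕ) :
    (∏ i : Fin n, (Polynomial.X - Polynomial.C (overApp (fiberPowerProj_toBase q i) U f))).coeff m ∈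
      Set.range (overApp (chowMap_toBase q n) U) := by
  rw [mem_range_overApp_chowMap q hU n]
  intro σ
  rw [← Polynomial.coeff_map, Polynomial.map_prod]
  congr 1
  refine Fintype.prod_equiv σ _ _ fun i => ?_
  rw [Polynomial.map_sub, Polynomial.map_X, Polynomial.map_C]
  congr 2
  exact congr($(overApp_comp (fiberPowerPerm_toBase q n σ) (fiberPowerProj_toBase q i)
    (fiberPowerProj_toBase q (σ i)) (fiberPowerPerm_proj q σ i) U) f)

omit h in
-- Pulling back the symmetric functions of `f` along `repeatMap` replaces the value at place `i` by
-- the value at the part `c i`. Allowing every `f`, not just the coordinates, provides the sums of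
-- two coordinates as well.
lemma coeffsMem_range (hU : IsAffineOpen U) {ι : Type} (c : Fin n → Part α)
    (Θ : MvPolynomial (Part α × ι) Γ(X, U) ≃+*
      Γ(fiberPowerProd q α, fiberPowerProdToBase q α ⁻¹ᵁ U)) (f : Γ(T, q ⁻¹ᵁ U)) :
    CoeffsMem c (Θ.symm.toRingHom.comp (overApp (repeatMap_chowMap_toBase q c) U)).range
      fun b => Θ.symm (overApp (partProj_toBase q α b) U f) := by
  intro m
  let φ := Θ.symm.toRingHom.comp (overApp (repeatMap_toBase q c) U)
  have h1 : (∏ i, (Polynomial.X - Polynomial.C (Θ.symm (overApp (partProj_toBase q α (c i)) U f)))) =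
      (∏ i : Fin n, (Polynomial.X -
        Polynomial.C (overApp (fiberPowerProj_toBase q i) U f))).map φ := by
    rw [Polynomial.map_prod]
    refine Finset.prod_congr rfl fun i _ => ?_
    rw [Polynomial.map_sub, Polynomial.map_X, Polynomial.map_C]
    congr 2
    exact congr(Θ.symm ($(overApp_comp (repeatMap_toBase q c) (fiberPowerProj_toBase q i)
      (partProj_toBase q α (c i)) (repeatMap_proj q c i) U) f)).symm
  rw [h1, Polynomial.coeff_map]
  obtain ⟨y, hy⟩ := coeff_prod_mem_range hU f m
  rw [← hy]
  exact ⟨y, congr(Θ.symm ($(overApp_comp (repeatMap_toBase q c) (chowMap_toBase q n)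
      (repeatMap_chowMap_toBase q c) rfl U) y)).symm⟩

omit h [IsAffineHom q] in
lemma rename_symm_eq {ι : Type}
    (θ : MvPolynomial ι Γ(X, U) ≃+* Γ(T, q ⁻¹ᵁ U))
    (Θ : MvPolynomial (Part α × ι) Γ(X, U) ≃+*
      Γ(fiberPowerProd q α, fiberPowerProdToBase q α ⁻¹ᵁ U))
    (h0 : ∀ a, Θ (MvPolynomial.C a) = ((fiberPowerProdToBase q α).app U).hom a)
    (h1 : ∀ b i, Θ (MvPolynomial.X (b, i)) =
      overApp (partProj_toBase q α b) U (θ (MvPolynomial.X i)))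
    (g : ∀ j, Equiv.Perm (Fin (α j))) (x) :
    MvPolynomial.rename (Prod.map (Equiv.sigmaCongrRight g) id) (Θ.symm x) =
      Θ.symm (overApp (prodPerm_toBase q α g) U x) := by
  obtain ⟨x, rfl⟩ := Θ.surjective x
  rw [RingEquiv.symm_apply_apply, RingEquiv.eq_symm_apply]
  have : Θ.toRingHom.comp
      (MvPolynomial.rename (Prod.map (Equiv.sigmaCongrRight g) (id : ι → ι))).toRingHom =
      (overApp (prodPerm_toBase q α g) U).comp Θ.toRingHom := by
    apply MvPolynomial.ringHom_ext
    · intro a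
      have := congr($(overApp_comp_app (prodPerm_toBase q α g) U) a)
      change Θ (MvPolynomial.rename _ (MvPolynomial.C a)) =
        overApp (prodPerm_toBase q α g) U (Θ (MvPolynomial.C a))
      rw [MvPolynomial.rename_C, h0]
      exact this.symm
    · rintro ⟨b, i⟩
      change Θ (MvPolynomial.rename _ (MvPolynomial.X (b, i))) =
        overApp (prodPerm_toBase q α g) U (Θ (MvPolynomial.X (b, i)))
      rw [MvPolynomial.rename_X, h1, Prod.map_apply, h1]
      exact congr($(overApp_comp (prodPerm_toBase q α g) (partProj_toBase q α b)
        (partProj_toBase q α (Equiv.sigmaCongrRight g b)) (prodPerm_partProj q α g b) U) _).symm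
  exact congr($this x)

omit h in
-- The multiplicity `j + 1` of a part determines `j`, so a permutation preserving multiplicities
-- preserves `j` and splits into permutations of the parts of each size.
lemma exists_eq_sigmaCongrRight {c : Fin n → Part α} (hc : IsBlockDecomposition c)
    (π : Equiv.Perm (Part α)) (hπ : ∀ b, Nat.card {i // c i = π b} = Nat.card {i // c i = b}) :
    ∃ g : ∀ j, Equiv.Perm (Fin (α j)), π = Equiv.sigmaCongrRight g := by
  have h1 : ∀ b, (π b).1 = b.1 := fun b => by
    have := hπ b
    rw [hc, hc] at this
    exact Fin.ext (by omega)
  have h2 : ∀ j i, ∃ i', π ⟨j, i⟩ = ⟨j, i'⟩ := fun j i => by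
    have := h1 ⟨j, i⟩
    rcases hb : π ⟨j, i⟩ with ⟨j', i'⟩
    rw [hb] at this
    obtain rfl : j' = j := this
    exact ⟨i', rfl⟩
  choose f hf using h2
  have hinj : ∀ j, Function.Injective (f j) := fun j i i' e => by
    have : π ⟨j, i⟩ = π ⟨j, i'⟩ := by rw [hf, hf, e]
    simpa using π.injective this
  exact ⟨fun j => Equiv.ofBijective (f j) (Finite.injective_iff_bijective.mp (hinj j)),
    Equiv.ext fun b => hf b.1 b.2⟩

omit h in
lemma overApp_chowProdMap_overApp {τ : chowProd q α ⟶ Chow q n} (hτ : IsAdditionMorphism q α τ)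
    {c : Fin n → Part α} (hc : IsBlockDecomposition c) :
    (overApp (chowProdMap_toBase q α) U).comp (overApp hτ.toBase U) =
      overApp (repeatMap_chowMap_toBase q c) U :=
  overApp_comp _ _ _ (hτ.comp_eq c hc) U

/-- Sections of the product of Chow schemes are integral over sections of the Chow scheme, and are
quotients of such sections. -/
theorem isIntegral_and_exists_mul_eq [IsIntegral X] (hd : 0 < d) (hα : ∑ j : Fin s, ((j : ℕ) + 1) * α j = n)
    {τ : chowProd q α ⟶ Chow q n} (hτ : IsAdditionMorphism q α τ)
    (y : Γ(chowProd q α, chowProdToBase q α ⁻¹ᵁ U)) :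
    (overApp hτ.toBase U).IsIntegralElem y ∧ ∃ a b, overApp hτ.toBase U a ≠ 0 ∧
      overApp hτ.toBase U a * y = overApp hτ.toBase U b := by
  obtain ⟨c, hc⟩ := exists_isBlockDecomposition hα
  obtain ⟨θ, hθ⟩ := h.exists_equiv
  obtain ⟨Θ, h0, h1⟩ := exists_fiberPowerProd_equiv α h.isAffineOpen θ hθ
  obtain ⟨_⟩ := h.algebra
  have := h.isDomain
  have : CharZero Γ(X, U) := algebraRat.charZero _
  have : Nonempty (Fin d) := ⟨⟨0, hd⟩⟩
  -- `E` is the ring of sections of the Chow scheme pulled back to the polynomial ring; `ψ` embeds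
  -- the sections of the product of Chow schemes there, and `ψ` composed with pullback along `τ` has
  -- image `E`.
  let E := (Θ.symm.toRingHom.comp (overApp (repeatMap_chowMap_toBase q c) U)).range
  let ψ := Θ.symm.toRingHom.comp (overApp (chowProdMap_toBase q α) U)
  have hψ : Function.Injective ψ :=
    Θ.symm.injective.comp (h.overApp_chowProdMap_injective α)
  have hE : ∀ x ∈ E, ∃ a, ψ (overApp hτ.toBase U a) = x := by
    rintro _ ⟨a, rfl⟩
    exact ⟨a, congr(Θ.symm ($(overApp_chowProdMap_overApp α hτ hc) a))⟩
  have hA : ∀ a, MvPolynomial.C a ∈ E := fun a => by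
    refine ⟨((chowToBase q n).app U).hom a, ?_⟩
    refine (RingEquiv.symm_apply_eq Θ).mpr ?_
    rw [h0]
    exact congr($(overApp_comp_app (repeatMap_chowMap_toBase q c) U) a)
  have hX : ∀ b i, MvPolynomial.X (b, i) =
      Θ.symm (overApp (partProj_toBase q α b) U (θ (MvPolynomial.X i))) := fun b i => by
    rw [RingEquiv.eq_symm_apply, h1]
  have hE1 : ∀ i : Fin d, CoeffsMem c E fun b => MvPolynomial.X (b, i) := fun i => by
    simp only [hX]
    exact coeffsMem_range α h.isAffineOpen c Θ _
  have hE2 : ∀ i i' : Fin d, CoeffsMem c E fun b => MvPolynomial.X (b, i) + MvPolynomial.X (b, i') :=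
    fun i i' => by
      simp only [hX, ← map_add]
      exact coeffsMem_range α h.isAffineOpen c Θ _
  constructor
  · obtain ⟨p, hp, hp'⟩ := isIntegral_of_coeffsMem hc.surjective hA hE1 (ψ y)
    -- The monic equation over `E` is lifted to a monic polynomial over the sections of the Chow
    -- scheme, and the resulting equation for `y` holds because `ψ` is injective.
    have h2 : p.map (algebraMap E _) ∈ Polynomial.lifts (ψ.comp (overApp hτ.toBase U)) := by
      rw [Polynomial.lifts_iff_coeff_lifts]
      intro m
      rw [Polynomial.coeff_map]
      exact hE _ (p.coeff m).2
    obtain ⟨r, hr, -, hr'⟩ := Polynomial.lifts_and_natDegree_eq_and_monic h2 (hp.map _)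
    refine ⟨r, hr', hψ ?_⟩
    rw [Polynomial.hom_eval₂, ← Polynomial.eval_map, hr, Polynomial.eval_map, map_zero]
    exact hp'
  · obtain ⟨a, ha, b, hb, ha0, hab⟩ := exists_mul_eq_of_coeffsMem hc.surjective hA hE1 hE2 (ψ y)
      fun π hπ => by
        obtain ⟨g, rfl⟩ := exists_eq_sigmaCongrRight α hc π hπ
        refine (rename_symm_eq α θ Θ h0 h1 g _).trans ?_
        exact congr(Θ.symm $((h.mem_range_overApp_chowProdMap α _).mp ⟨y, rfl⟩ g))
    obtain ⟨a, rfl⟩ := hE a ha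
    obtain ⟨b, rfl⟩ := hE b hb
    rw [← map_mul] at hab
    exact ⟨a, b, fun h => ha0 (by rw [h, map_zero]), hψ hab⟩

end IsCoordinateOpen

end CoordinateOpen
end AlgebraicGeometry.Scheme

/-! ### A criterion for normalizations -/

/-- In the fraction field of `L` the element `x` is the fraction `b / a` of elements of `A`; this
fraction is integral over `A`, hence lies in `A`. -/
lemma mem_range_of_isIntegralElem {A L : Type*} [CommRing A] [IsDomain A] [IsIntegrallyClosed A]
    [CommRing L] [IsDomain L] (g : A →+* L) (hg : Function.Injective g) (x : L)
    (hx : g.IsIntegralElem x) {a b : A} (ha : g a ≠ 0) (hab : g a * x = g b) : ∃ y, g y = x := by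
  algebraize [g]
  have : FaithfulSMul A L := (faithfulSMul_iff_algebraMap_injective A L).mpr hg
  let K := FractionRing A
  let M := FractionRing L
  have : FaithfulSMul A M := by
    rw [faithfulSMul_iff_algebraMap_injective, IsScalarTower.algebraMap_eq A L M]
    exact (IsFractionRing.injective L M).comp hg
  let j : K →ₐ[A] M := IsFractionRing.liftAlgHom (g := Algebra.ofId A M)
    (FaithfulSMul.algebraMap_injective A M)
  have ha' : algebraMap L M (g a) ≠ 0 := by
    rwa [Ne, map_eq_zero_iff _ (IsFractionRing.injective L M)]
  have hj : ∀ y, j (algebraMap A K y) = algebraMap L M (g y) := fun y =>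
    (j.commutes y).trans (IsScalarTower.algebraMap_apply A L M y)
  have h1 : j (algebraMap A K b / algebraMap A K a) = algebraMap L M x := by
    rw [map_div₀, hj, hj, ← hab, map_mul, mul_div_assoc, mul_comm, div_mul_cancel₀ _ ha']
  have h2 : IsIntegral A (algebraMap A K b / algebraMap A K a) := by
    rw [← isIntegral_algHom_iff j j.toRingHom.injective, h1]
    exact IsIntegral.map (IsScalarTower.toAlgHom A L M) hx
  obtain ⟨y, hy⟩ := IsIntegrallyClosed.isIntegral_iff.mp h2
  refine ⟨y, IsFractionRing.injective L M ?_⟩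
  rw [← hj, hy, h1]

/-- A ring whose elements are quotients of elements of a subring maps to the fraction field of the
subring. -/
lemma exists_comp_eq_of_exists_mul_eq {R S K : Type*} [CommRing R] [CommRing S] [IsDomain S]
    [Field K] (ν : R →+* S) (hν : Function.Injective ν) (i : R →+* K) (hi : Function.Injective i)
    (h : ∀ y, ∃ a b, a ≠ 0 ∧ ν a * y = ν b) (hK : ∀ x : K, ∃ a b, b ≠ 0 ∧ i b * x = i a) :
    ∃ r : S →+* K, r.comp ν = i := by
  have : IsDomain R := hν.isDomain ν
  algebraize [i]
  have : IsFractionRing R K := by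
    have : FaithfulSMul R K := (faithfulSMul_iff_algebraMap_injective R K).mpr hi
    refine IsFractionRing.of_field R K fun z => ?_
    obtain ⟨a, b, hb, hz⟩ := hK z
    have : i b ≠ 0 := by rwa [Ne, map_eq_zero_iff _ hi]
    exact ⟨a, b, by rw [eq_div_iff (show algebraMap R K b ≠ 0 from this), mul_comm]; exact hz⟩
  let M := FractionRing S
  let j : R →+* M := (algebraMap S M).comp ν
  have hj : Function.Injective j := (IsFractionRing.injective S M).comp hν
  let φ : K →+* M := IsFractionRing.lift hj
  have hφ : ∀ a, φ (i a) = algebraMap S M (ν a) := fun a => IsFractionRing.lift_algebraMap hj a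
  obtain ⟨r, hr⟩ := RingHom.exists_comp_eq_of_injective φ φ.injective (algebraMap S M) fun y => by
    obtain ⟨a, b, ha, hab⟩ := h y
    have ha' : algebraMap S M (ν a) ≠ 0 := by
      rwa [Ne, map_eq_zero_iff _ (IsFractionRing.injective S M), map_eq_zero_iff _ hν]
    refine ⟨i b / i a, ?_⟩
    rw [map_div₀, hφ, hφ, ← hab, map_mul, mul_comm, mul_div_assoc, div_self ha', mul_one]
  refine ⟨r, RingHom.ext fun a => φ.injective ?_⟩
  rw [hφ]
  exact congr($hr (ν a))

namespace AlgebraicGeometry.Scheme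

section Normalization

lemma app_bijective_of_appLE {X Y : Scheme.{u}} (f : X ⟶ Y) (U : Y.Opens) (V : X.Opens)
    (e : V = f ⁻¹ᵁ U) (h : Function.Bijective (f.appLE U V e.le).hom) :
    Function.Bijective (f.app U).hom := by
  subst e
  rwa [Hom.app_eq_appLE]

lemma isIso_of_bijective_app {X Y : Scheme.{u}} (f : X ⟶ Y) [IsAffineHom f] {I : Type*}
    (U : I → Y.Opens) (hU : ∀ i, IsAffineOpen (U i)) (hc : ⨆ i, U i = ⊤)
    (h : ∀ i, Function.Bijective (f.app (U i)).hom) : IsIso f := by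
  change MorphismProperty.isomorphisms _ f
  refine (IsZariskiLocalAtTarget.iff_of_iSup_eq_top (P := .isomorphisms Scheme) U hc).mpr fun i => ?_
  refine (isIso_morphismRestrict_iff_isIso_app f (hU i)).mpr ?_
  exact (ConcreteCategory.isIso_iff_bijective (f.app (U i))).mpr (h i)

lemma isIntegralHom_of_app {X Y : Scheme.{u}} (f : X ⟶ Y) [IsAffineHom f] {I : Type*}
    (U : I → Y.Opens) (hU : ∀ i, IsAffineOpen (U i)) (hc : ⨆ i, U i = ⊤)
    (h : ∀ i, (f.app (U i)).hom.IsIntegral) : IsIntegralHom f := by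
  refine @HasAffineProperty.of_iSup_eq_top _ _ IsIntegralHom.hasAffineProperty _ _ f I
    (fun i => ⟨U i, hU i⟩) hc fun i => ⟨(hU i).preimage f, ?_⟩
  have h1 := h i
  rw [morphismRestrict_app']
  rw [Hom.app_eq_appLE] at h1
  have key : ∀ W W' (_ : W = U i) (_ : W' = f ⁻¹ᵁ U i) (e : W' ≤ f ⁻¹ᵁ W),
      (f.appLE W W' e).hom.IsIntegral := by
    rintro _ _ rfl rfl _
    exact h1
  exact key _ _ (by simp) (by simp) _

variable {Z : Scheme.{u}} [IsIntegral Z]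

lemma genericPoint_mem (V : Z.Opens) [h : Nonempty V] : genericPoint Z ∈ V :=
  ((genericPoint_spec Z).mem_open_set_iff V.isOpen).mpr (by simpa using h)

lemma fromGenericPoint_preimage (V : Z.Opens) [Nonempty V] : Z.fromGenericPoint ⁻¹ᵁ V = ⊤ := by
  rw [eq_top_iff]
  intro x _
  have : Subsingleton (Spec Z.functionField) :=
    inferInstanceAs (Subsingleton (PrimeSpectrum Z.functionField))
  rw [Subsingleton.elim x (IsLocalRing.closedPoint _)]
  have h : Z.fromSpecStalk (genericPoint Z) (IsLocalRing.closedPoint _) = genericPoint Z :=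
    fromSpecStalk_closedPoint
  change Z.fromSpecStalk (genericPoint Z) (IsLocalRing.closedPoint _) ∈ V
  rw [h]
  exact genericPoint_mem V

lemma exists_fromGenericPoint_app_equiv (V : Z.Opens) [Nonempty V] :
    ∃ e : Z.functionField ≃+* Γ(Spec Z.functionField, Z.fromGenericPoint ⁻¹ᵁ V),
      ∀ x, (Z.fromGenericPoint.app V).hom x = e ((Z.germToFunctionField V).hom x) := by
  have h := fromSpecStalk_app (genericPoint_mem V)
  have := fromGenericPoint_preimage V
  have : IsIso ((Spec Z.functionField).presheaf.map
      (homOfLE (le_top : Z.fromGenericPoint ⁻¹ᵁ V ≤ ⊤)).op) := by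
    have : IsIso (homOfLE (le_top : Z.fromGenericPoint ⁻¹ᵁ V ≤ ⊤)) := by
      refine ⟨homOfLE this.ge, Subsingleton.elim _ _, Subsingleton.elim _ _⟩
    infer_instance
  refine ⟨((ΓSpecIso Z.functionField).symm ≪≫ asIso ((Spec Z.functionField).presheaf.map
      (homOfLE (le_top : Z.fromGenericPoint ⁻¹ᵁ V ≤ ⊤)).op)).commRingCatIsoToRingEquiv,
    fun x => congr($h x)⟩

end Normalization
end AlgebraicGeometry.Scheme

namespace AlgebraicGeometry.Scheme

section Normalization

variable {X Y Z : Scheme.{u}}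

/-- Over an affine open, the sections of the relative normalization are an integral closure inside
the sections of `X`. Only the injectivity of this inclusion and the integrality of its elements are
needed. -/
lemma overApp_toNormalization_injective (f : X ⟶ Y) [QuasiCompact f] [QuasiSeparated f]
    {U : Y.Opens} (hU : IsAffineOpen U) :
    Function.Injective (overApp (f.toNormalization_fromNormalization) U) := by
  have h := f.normalizationObjIso_hom_val hU
  let _ := (f.app U).hom.toAlgebra
  have h1 : Function.Injective (f.toNormalization.appLE (f.fromNormalization ⁻¹ᵁ U) (f ⁻¹ᵁ U)
      (preimage_le_of_over (f.toNormalization_fromNormalization) U)).hom := by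
    rw [← h]
    exact Subtype.val_injective.comp
      (ConcreteCategory.bijective_of_isIso (f.normalizationObjIso hU).hom).1
  exact h1

lemma isIntegralElem_overApp_toNormalization (f : X ⟶ Y) [QuasiCompact f] [QuasiSeparated f]
    {U : Y.Opens} (hU : IsAffineOpen U) (x : Γ(f.normalization, f.fromNormalization ⁻¹ᵁ U)) :
    (f.app U).hom.IsIntegralElem (overApp (f.toNormalization_fromNormalization) U x) := by
  have h := f.normalizationObjIso_hom_val hU
  let _ := (f.app U).hom.toAlgebra
  have h1 : overApp (f.toNormalization_fromNormalization) U x =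
      ((f.normalizationObjIso hU).hom x).1 := congr($h.symm x)
  rw [h1]
  exact ((f.normalizationObjIso hU).hom x).2

variable [IsIntegral Z]

/-- Birationality: the sections of `Y` over `V` are fractions of functions on `V`, so they embed in
the function field and the generic point of `Z` lifts to `Y`. The lift feeds the universal property
of the normalization. -/
lemma exists_fromGenericPoint_lift (ν : Y ⟶ Z) [IsAffineHom ν] {V : Z.Opens} (hV : IsAffineOpen V)
    [Nonempty V] [IsDomain Γ(Y, ν ⁻¹ᵁ V)] (hinj : Function.Injective (ν.app V).hom)
    (hfrac : ∀ y, ∃ a b, a ≠ 0 ∧ (ν.app V).hom a * y = (ν.app V).hom b) :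
    ∃ g : Spec Z.functionField ⟶ Y, g ≫ ν = Z.fromGenericPoint := by
  have := functionField_isFractionRing_of_isAffineOpen Z V hV
  have hi : Function.Injective (Z.germToFunctionField V).hom :=
    IsFractionRing.injective Γ(Z, V) Z.functionField
  have hr : ∃ r : Γ(Y, ν ⁻¹ᵁ V) ⟶ Z.functionField, ν.app V ≫ r = Z.germToFunctionField V := by
    obtain ⟨r, hr⟩ := exists_comp_eq_of_exists_mul_eq (ν.app V).hom hinj
      (Z.germToFunctionField V).hom hi hfrac fun x => by
        obtain ⟨a, b, hb, rfl⟩ := IsFractionRing.div_surjective (A := Γ(Z, V)) x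
        have hb0 := nonZeroDivisors.ne_zero hb
        have hb' : algebraMap Γ(Z, V) Z.functionField b ≠ 0 := by
          rwa [Ne, map_eq_zero_iff _ (IsFractionRing.injective Γ(Z, V) Z.functionField)]
        exact ⟨a, b, hb0, mul_div_cancel₀ _ hb'⟩
    exact ⟨CommRingCat.ofHom r, CommRingCat.hom_ext hr⟩
  obtain ⟨r, hr⟩ := hr
  refine ⟨Spec.map r ≫ (hV.preimage ν).fromSpec, ?_⟩
  rw [Category.assoc, ← IsAffineOpen.SpecMap_appLE_fromSpec ν hV (hV.preimage ν) le_rfl,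
    ← Hom.app_eq_appLE, ← Spec.map_comp_assoc, hr]
  exact hV.fromSpecStalk_eq_fromSpecStalk (genericPoint_mem V)

/-- A birational integral morphism from a normal scheme is the normalization. -/
theorem IsNormalization.of_sections (ν : Y ⟶ Z) [IsAffineHom ν] {I : Type*} (V : I → Z.Opens)
    (hV : ∀ i, IsAffineOpen (V i)) (hc : ∀ z, ∃ i, z ∈ V i) (hne : ∀ i, Nonempty (V i))
    (hdom : ∀ i, IsDomain Γ(Y, ν ⁻¹ᵁ V i)) (hnc : ∀ i, IsIntegrallyClosed Γ(Y, ν ⁻¹ᵁ V i))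
    (hinj : ∀ i, Function.Injective (ν.app (V i)).hom)
    (hint : ∀ i, (ν.app (V i)).hom.IsIntegral)
    (hfrac : ∀ i y, ∃ a b, a ≠ 0 ∧ (ν.app (V i)).hom a * y = (ν.app (V i)).hom b) :
    IsNormalization ν := by
  have hcov : ⨆ i, V i = ⊤ := by
    rw [eq_top_iff]
    intro z _
    obtain ⟨i, hi⟩ := hc z
    exact TopologicalSpace.Opens.mem_iSup.mpr ⟨i, hi⟩
  have : IsIntegralHom ν := isIntegralHom_of_app ν V hV hcov hint
  obtain ⟨i₀, -⟩ := hc (genericPoint Z)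
  have := hne i₀
  have := hdom i₀
  obtain ⟨g, hg⟩ := exists_fromGenericPoint_lift ν (hV i₀) (hinj i₀) (hfrac i₀)
  let f := Z.fromGenericPoint
  -- Since `ν` is integral, the factorization of the generic point through it extends to the
  -- normalization.
  let h : f.normalization ⟶ Y := f.normalizationDesc g ν hg.symm
  have hh : h ≫ ν = f.fromNormalization := f.normalizationDesc_comp g ν hg.symm
  have hh' : f.toNormalization ≫ h = g := f.toNormalization_normalizationDesc g ν hg.symm
  have haff : IsAffineHom h := inferInstance
  have hiso : IsIso h := by
    refine isIso_of_bijective_app h (fun i => ν ⁻¹ᵁ V i) (fun i => (hV i).preimage ν) ?_ fun i => ?_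
    · rw [eq_top_iff]
      intro y _
      obtain ⟨i, hi⟩ := hc (ν y)
      exact TopologicalSpace.Opens.mem_iSup.mpr ⟨i, hi⟩
    have := hne i
    have := hdom i
    have := hnc i
    refine app_bijective_of_appLE h (ν ⁻¹ᵁ V i) (f.fromNormalization ⁻¹ᵁ V i) (by rw [← hh]; rfl) ?_
    change Function.Bijective (overApp hh (V i))
    obtain ⟨e, he⟩ := exists_fromGenericPoint_app_equiv (V i)
    have := functionField_isFractionRing_of_isAffineOpen Z (V i) (hV i)
    have hL : IsDomain Γ(Spec Z.functionField, f ⁻¹ᵁ V i) := e.symm.toMulEquiv.isDomain _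
    have hfi : Function.Injective (f.app (V i)).hom := fun a b hab =>
      IsFractionRing.injective Γ(Z, V i) Z.functionField
        (e.injective ((he a).symm.trans (hab.trans (he b))))
    have hfs : ∀ x, ∃ a b, a ≠ 0 ∧ (f.app (V i)).hom a * x = (f.app (V i)).hom b := fun x => by
      obtain ⟨b, a, ha, hab⟩ := IsFractionRing.div_surjective (A := Γ(Z, V i)) (e.symm x)
      have ha' : algebraMap Γ(Z, V i) Z.functionField a ≠ 0 := by
        rw [Ne, map_eq_zero_iff _ (IsFractionRing.injective Γ(Z, V i) Z.functionField)]
        exact nonZeroDivisors.ne_zero ha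
      refine ⟨a, b, nonZeroDivisors.ne_zero ha, ?_⟩
      rw [he, he, ← e.apply_symm_apply x, ← map_mul, ← hab]
      exact congr_arg e (mul_div_cancel₀ _ ha')
    have hgν := overApp_comp_app hg (V i)
    have hgν' : ∀ a, overApp hg (V i) ((ν.app (V i)).hom a) = (f.app (V i)).hom a :=
      fun a => congr($hgν a)
    -- If `y` dies in the function field and `a * y = b` with `a ≠ 0`, then `b` dies too, so `b =
    -- 0`, and `y = 0` in the domain of sections of `Y`.
    have hgi : Function.Injective (overApp hg (V i)) := by
      rw [injective_iff_map_eq_zero]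
      intro y hy
      obtain ⟨a, b, ha, hab⟩ := hfrac i y
      have h1 := congr(overApp hg (V i) $hab)
      rw [map_mul, hy, mul_zero, hgν'] at h1
      have hb : b = 0 := hfi (by rw [← h1, map_zero])
      rw [hb, map_zero, mul_eq_zero] at hab
      exact hab.resolve_left fun h0 => ha (hinj i (by rw [h0, map_zero]))
    have hcomp := overApp_comp f.toNormalization_fromNormalization hh hg hh' (V i)
    have hti := overApp_toNormalization_injective f (hV i)
    constructor
    · rw [← hcomp] at hgi
      exact Function.Injective.of_comp (f := overApp f.toNormalization_fromNormalization (V i)) hgi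
    · intro x
      -- A section of the normalization is integral over `Z`, so over `Y`, and is a fraction of
      -- functions on `Z`; the sections of `Y` being integrally closed, it comes from `Y`.
      let x' := overApp f.toNormalization_fromNormalization (V i) x
      have hx : (overApp hg (V i)).IsIntegralElem x' := by
        obtain ⟨p, hp, hp'⟩ := isIntegralElem_overApp_toNormalization f (hV i) x
        refine ⟨p.map (ν.app (V i)).hom, hp.map _, ?_⟩
        rw [Polynomial.eval₂_map, hgν]
        exact hp'
      obtain ⟨a, b, ha, hab⟩ := hfs x'
      have ha' : (f.app (V i)).hom a ≠ 0 := fun h0 => ha (hfi (by rw [h0, map_zero]))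
      obtain ⟨y, hy⟩ := mem_range_of_isIntegralElem (overApp hg (V i)) hgi x' hx
        (a := (ν.app (V i)).hom a) (b := (ν.app (V i)).hom b) (by rwa [hgν'])
        (by rw [hgν', hgν']; exact hab)
      refine ⟨y, hti ?_⟩
      exact congr($hcomp y).trans hy
  refine ⟨inferInstance, (asIso h).symm, ?_⟩
  rw [← hh]
  simp

end Normalization
end AlgebraicGeometry.Scheme

/-! ### Scheme-theoretic images and the closure of the stratum -/

namespace AlgebraicGeometry.Scheme
open AffineZariskiSite InvariantSubring

section Generalities

variable {X Y Z : Scheme.{u}}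

lemma isAffineHom_of_comp (f : Y ⟶ Z) (g : Z ⟶ X) [IsSeparated g] (h : IsAffineHom (f ≫ g)) :
    IsAffineHom f :=
  MorphismProperty.of_postcomp (W := @IsAffineHom) (W' := @IsSeparated) _ g ‹_› h

lemma nonempty_of_nontrivial_sections (U : X.Opens) [h : Nontrivial Γ(X, U)] : Nonempty U := by
  by_contra hne
  have h0 : U = ⊥ := by
    rw [eq_bot_iff]
    exact fun z hz => (hne ⟨⟨z, hz⟩⟩).elim
  rw [h0] at h
  exact not_subsingleton Γ(X, ⊥) inferInstance

lemma overApp_injective_iff {f : Y ⟶ X} {f' : Z ⟶ X} {g : Y ⟶ Z} (h : g ≫ f' = f) (U : X.Opens) :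
    Function.Injective (overApp h U) ↔ Function.Injective (g.app (f' ⁻¹ᵁ U)).hom := by
  subst h
  rw [Hom.app_eq_appLE]
  rfl

/-- A criterion for normalizations between schemes affine over a base. -/
theorem IsNormalization.of_over [IsIntegral Z] {f : Y ⟶ X} {f' : Z ⟶ X} [IsAffineHom f]
    [IsAffineHom f'] {ν : Y ⟶ Z} (h : ν ≫ f' = f) {I : Type*} (U : I → X.Opens)
    (hU : ∀ i, IsAffineOpen (U i)) (hc : ∀ x, ∃ i, x ∈ U i)
    (hdom : ∀ i, IsDomain Γ(Y, f ⁻¹ᵁ U i)) (hnc : ∀ i, IsIntegrallyClosed Γ(Y, f ⁻¹ᵁ U i))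
    (hinj : ∀ i, Function.Injective (ν.app (f' ⁻¹ᵁ U i)).hom)
    (hint : ∀ i, (overApp h (U i)).IsIntegral)
    (hfrac : ∀ i y, ∃ a b, a ≠ 0 ∧ overApp h (U i) a * y = overApp h (U i) b) :
    IsNormalization ν := by
  subst h
  have : IsAffineHom ν := isAffineHom_of_comp ν f' ‹_›
  have e : ∀ i, overApp (f := ν ≫ f') (f' := f') rfl (U i) = (ν.app (f' ⁻¹ᵁ U i)).hom := fun i => by
    rw [Hom.app_eq_appLE]; rfl
  refine IsNormalization.of_sections ν (fun i => f' ⁻¹ᵁ U i) (fun i => (hU i).preimage f')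
    (fun z => hc (f' z)) (fun i => ?_) hdom hnc hinj (fun i => ?_) fun i => ?_
  · have := hdom i
    obtain ⟨⟨y, hy⟩⟩ := nonempty_of_nontrivial_sections ((ν ≫ f') ⁻¹ᵁ U i)
    exact ⟨⟨ν y, hy⟩⟩
  · rw [← e]; exact hint i
  · rw [← e]; exact hfrac i

/-- The kernel ideal of a morphism from a reduced scheme is radical and its support is the closure
of the range. Hence the reduced closure is the scheme-theoretic image. -/
lemma vanishingIdeal_closure_range (f : Y ⟶ Z) [QuasiCompact f] [IsReduced Y] (S : Set Z)
    (hS : closure S = closure (Set.range f)) :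
    IdealSheafData.vanishingIdeal ⟨closure S, isClosed_closure⟩ = f.ker := by
  have h1 : (⟨closure S, isClosed_closure⟩ : TopologicalSpace.Closeds Z) = f.ker.support :=
    SetLike.coe_injective (by
      rw [Hom.support_ker]
      exact hS)
  rw [h1, IdealSheafData.vanishingIdeal_support]
  ext U : 2
  change (f.ker.ideal U).radical = _
  rw [Hom.ker_apply, Ideal.IsRadical.radical]
  rintro x ⟨m, hm⟩
  rw [RingHom.mem_ker, map_pow] at hm
  exact IsReduced.eq_zero _ ⟨m, hm⟩

/-- A morphism inducing an injection on sections over an affine open is dominant. -/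
lemma isDominant_of_app_injective (f : Y ⟶ Z) [IsIntegral Z] [IsReduced Y] (W : Z.Opens)
    (hW : IsAffineOpen W) [Nonempty W] (hinj : Function.Injective (f.app W).hom) :
    IsDominant f := by
  refine ⟨dense_iff_inter_open.mpr fun V hV hVne => ?_⟩
  let V' : Z.Opens := ⟨V, hV⟩
  have hWne : (W : Set Z).Nonempty := Set.nonempty_coe_sort.mp ‹_›
  obtain ⟨z, hzW, hzV⟩ : ((W : Set Z) ∩ V).Nonempty :=
    nonempty_preirreducible_inter W.2 hV hWne hVne
  obtain ⟨r, hr, hzr⟩ := hW.exists_basicOpen_le (V := V') ⟨z, hzV⟩ hzW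
  have hr0 : r ≠ 0 := by
    rintro rfl
    simp at hzr
  have h1 : (f.app W).hom r ≠ 0 := by
    rw [map_ne_zero_iff _ hinj]; exact hr0
  have h2 : Y.basicOpen ((f.app W).hom r) ≠ ⊥ := fun h => h1 ((basicOpen_eq_bot_iff _).mp h)
  obtain ⟨y, hy⟩ := (TopologicalSpace.Opens.ne_bot_iff_nonempty _).mp h2
  have hy' : y ∈ f ⁻¹ᵁ Z.basicOpen r := by rw [f.preimage_basicOpen r]; exact hy
  exact ⟨f y, hr hy', y, rfl⟩

/-- A field extension is faithfully flat. This allows coincidence of coordinates to be tested after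
enlarging the residue field. -/
lemma epi_SpecMap_of_field {K L : Type u} [Field K] [Field L] (f : K →+* L) :
    Epi (Spec.map (CommRingCat.ofHom f)) := by
  have h : f.FaithfullyFlat := by
    algebraize [f]
    exact inferInstanceAs (Module.FaithfullyFlat K L)
  obtain ⟨_, _⟩ := (flat_and_surjective_SpecMap_iff (CommRingCat.ofHom f)).mpr h
  exact Flat.epi_of_flat_of_surjective _

end Generalities

section Stratum

variable {X T : Scheme.{u}} {q : T ⟶ X} [IsAffineHom q] {s : ℕ} {α : Fin s → ℕ} {n : ℕ}

/-- Choose with `σ` one place in each block and read off the coordinates there. This gives a point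
of the product of fibre powers over the residue field of `y`, and repeating its coordinates gives
back `y`, because the coordinates of `y` agree within blocks. -/
lemma chowStratum_subset_range {τ : chowProd q α ⟶ Chow q n} (hτ : IsAdditionMorphism q α τ) :
    chowStratum q α n ⊆ Set.range τ := by
  rintro _ ⟨y, ⟨c, hc, hy⟩, rfl⟩
  obtain ⟨σ, hσ⟩ := hc.surjective.hasRightInverse
  let v := (fiberPower q n).fromSpecResidueField y
  let w (j : Fin s) : Spec ((fiberPower q n).residueField y) ⟶ fiberPower q (α j) :=
    WidePullback.lift (v ≫ fiberPowerToBase q n) (fun i => v ≫ fiberPowerProj q (σ ⟨j, i⟩))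
      fun i => by rw [Category.assoc, fiberPowerProj_toBase]
  have hw0 : ∀ j, w j ≫ fiberPowerToBase q (α j) = v ≫ fiberPowerToBase q n := fun j =>
    WidePullback.lift_base _ _ _ _
  have hw : ∀ j i, w j ≫ fiberPowerProj q i = v ≫ fiberPowerProj q (σ ⟨j, i⟩) := fun j i =>
    WidePullback.lift_π _ _ _ _ _
  let z : Spec ((fiberPower q n).residueField y) ⟶ fiberPowerProd q α :=
    WidePullback.lift (v ≫ fiberPowerToBase q n) w hw0
  have hz0 : z ≫ fiberPowerProdToBase q α = v ≫ fiberPowerToBase q n :=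
    WidePullback.lift_base _ _ _ _
  have hz : ∀ j, z ≫ fiberPowerProdProj q α j = w j := fun j => WidePullback.lift_π _ _ _ _ _
  have h : z ≫ repeatMap q c = v := by
    apply fiberPower_hom_ext
    · rw [Category.assoc, repeatMap_toBase, hz0]
    · intro i
      rw [Category.assoc, repeatMap_proj, partProj, ← Category.assoc, hz, hw]
      exact (hy _ _).mpr (hσ (c i))
  have h' : z ≫ chowProdMap q α ≫ τ = v ≫ chowMap q n := by
    rw [hτ.comp_eq c hc, ← Category.assoc, h]
  let x : Spec ((fiberPower q n).residueField y) := IsLocalRing.closedPoint _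
  refine ⟨(z ≫ chowProdMap q α) x, ?_⟩
  rw [← Hom.comp_apply, Category.assoc, h', Hom.comp_apply]
  congr 1
  exact fromSpecResidueField_apply _ _

/-- If the coordinates of a reduced product of fibre powers are distinct, then its generic point maps
to the stratum. -/
lemma repeatMap_mem_stratum [IsIntegral (fiberPowerProd q α)]
    (hdist : ∀ b b', partProj q α b = partProj q α b' → b = b') {c : Fin n → Part α}
    (hc : IsBlockDecomposition c) :
    (repeatMap q c ≫ chowMap q n) (genericPoint (fiberPowerProd q α)) ∈ chowStratum q α n := by
  let η := genericPoint (fiberPowerProd q α)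
  rw [Hom.comp_apply]
  refine ⟨_, ⟨c, hc, fun i i' => ?_⟩, rfl⟩
  have h1 := Hom.SpecMap_residueFieldMap_fromSpecResidueField (repeatMap q c) η
  have he : Epi (Spec.map ((repeatMap q c).residueFieldMap η)) :=
    epi_SpecMap_of_field ((repeatMap q c).residueFieldMap η).hom
  unfold SameCoordinate
  rw [← cancel_epi (Spec.map ((repeatMap q c).residueFieldMap η)), reassoc_of% h1,
    reassoc_of% h1, repeatMap_proj, repeatMap_proj]
  refine ⟨fun h => hdist _ _ ?_, fun h => by rw [h]⟩
  -- Two coordinates agreeing at the generic point of an integral scheme agree everywhere, as `q` is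
  -- separated.
  refine ext_of_fromSpecResidueField_eq _ _ q {η} ?_ ?_ ?_
  · exact dense_iff_closure_eq.mpr (genericPoint_spec _)
  · rintro x rfl
    exact h
  · rw [partProj_toBase, partProj_toBase]

/-- For the nontrivial inclusion, `chowProdMap` is dominant, so it suffices to treat images of
points of the product of fibre powers. These are specializations of the image of the generic point,
which is in the stratum. -/
lemma closure_chowStratum {τ : chowProd q α ⟶ Chow q n} (hτ : IsAdditionMorphism q α τ)
    [IsIntegral (fiberPowerProd q α)] [IsDominant (chowProdMap q α)]
    (hdist : ∀ b b', partProj q α b = partProj q α b' → b = b') {c : Fin n → Part α}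
    (hc : IsBlockDecomposition c) :
    closure (chowStratum q α n) = closure (Set.range τ) := by
  refine subset_antisymm (closure_mono (chowStratum_subset_range hτ)) ?_
  refine closure_minimal ?_ isClosed_closure
  have h1 : Set.range τ ⊆ closure (τ '' Set.range (chowProdMap q α)) := by
    rw [← Set.image_univ, ← (chowProdMap q α).denseRange.closure_range]
    exact image_closure_subset_closure_image τ.continuous
  refine h1.trans (closure_minimal ?_ isClosed_closure)
  rintro _ ⟨_, ⟨z, rfl⟩, rfl⟩
  rw [← Hom.comp_apply, hτ.comp_eq c hc]
  have h2 : genericPoint (fiberPowerProd q α) ⤳ z := (genericPoint_spec _).specializes trivial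
  have h3 := h2.map (repeatMap q c ≫ chowMap q n).continuous
  exact closure_mono (Set.singleton_subset_iff.mpr (repeatMap_mem_stratum hdist hc))
    h3.mem_closure

end Stratum
end AlgebraicGeometry.Scheme

/-! ### The addition morphism as a normalization -/

namespace AlgebraicGeometry.Scheme

section Main

variable {X T : Scheme.{u}} {q : T ⟶ X} [IsAffineHom q] {d : ℕ} {s : ℕ} {α : Fin s → ℕ} {n : ℕ}

/-- Different parts pull back the first fibre coordinate to different variables; this is where a
positive fibre dimension enters the study of the stratum. -/
lemma IsCoordinateOpen.partProj_injective {U : X.Opens} (h : IsCoordinateOpen q d U) [IsIntegral X]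
    (hd : 0 < d) (b b' : Part α) (e : partProj q α b = partProj q α b') : b = b' := by
  obtain ⟨θ, hθ⟩ := h.exists_equiv
  obtain ⟨Θ, -, h1⟩ := exists_fiberPowerProd_equiv α h.isAffineOpen θ hθ
  have := h.isDomain
  have h2 : ∀ b' (hb : partProj q α b' ≫ q = fiberPowerProdToBase q α)
      (_ : partProj q α b = partProj q α b'),
      overApp (partProj_toBase q α b) U = overApp hb U := by
    intro b' hb e
    simp only [overApp, e]
  have h3 : Θ (MvPolynomial.X (b, ⟨0, hd⟩)) = Θ (MvPolynomial.X (b', ⟨0, hd⟩)) := by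
    rw [h1, h1, h2 b' (partProj_toBase q α b') e]
  exact congr_arg Prod.fst (MvPolynomial.X_injective (Θ.injective h3))

variable (hX : ∀ x : X, ∃ U : X.Opens, IsCoordinateOpen q d U ∧ x ∈ U) [IsIntegral X]
include hX

variable (α) in
lemma isIntegral_fiberPowerProd : IsIntegral (fiberPowerProd q α) :=
  isIntegral_of_isAffineHom (fiberPowerProdToBase q α)
    (fun U : {U : X.Opens // IsCoordinateOpen q d U} => U.1) (fun U => U.2.isAffineOpen)
    (fun x => let ⟨U, hU, hx⟩ := hX x; ⟨⟨U, hU⟩, hx⟩) (fun U => U.2.isDomain_fiberPowerProd α)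
    fun U => U.2.fiberPowerProdToBase_app_injective α

variable (α) in
lemma isIntegral_chowProd : IsIntegral (chowProd q α) :=
  isIntegral_of_isAffineHom (chowProdToBase q α)
    (fun U : {U : X.Opens // IsCoordinateOpen q d U} => U.1) (fun U => U.2.isAffineOpen)
    (fun x => let ⟨U, hU, hx⟩ := hX x; ⟨⟨U, hU⟩, hx⟩) (fun U => U.2.isDomain_chowProd α)
    fun U => U.2.chowProdToBase_app_injective α

lemma isDominant_chowProdMap : IsDominant (chowProdMap q α) := by
  have := isIntegral_fiberPowerProd α hX
  have := isIntegral_chowProd α hX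
  obtain ⟨U, hU, -⟩ := hX (genericPoint X)
  have := hU.isDomain_chowProd α
  have := nonempty_of_nontrivial_sections (chowProdToBase q α ⁻¹ᵁ U)
  exact isDominant_of_app_injective (chowProdMap q α) (chowProdToBase q α ⁻¹ᵁ U)
    (hU.isAffineOpen.preimage _)
    ((overApp_injective_iff (chowProdMap_toBase q α) U).mp (hU.overApp_chowProdMap_injective α))

/-- A morphism of addition is the normalization of its image. -/
theorem isNormalization_toImage (hd : 0 < d) (hα : ∑ j : Fin s, ((j : ℕ) + 1) * α j = n)
    {τ : chowProd q α ⟶ Chow q n} (hτ : IsAdditionMorphism q α τ) : IsNormalization τ.toImage := by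
  have := isIntegral_chowProd α hX
  have hτa : IsAffineHom τ := isAffineHom_of_comp τ (chowToBase q n) (by
    rw [hτ.toBase]; infer_instance)
  let f' : τ.image ⟶ X := τ.imageι ≫ chowToBase q n
  have hf' : IsAffineHom f' := inferInstance
  have hν : τ.toImage ≫ f' = chowProdToBase q α := by
    rw [← hτ.toBase, ← Category.assoc, Hom.toImage_imageι]
  have hinj : ∀ U : {U : X.Opens // IsCoordinateOpen q d U},
      Function.Injective (τ.toImage.app (f' ⁻¹ᵁ U.1)).hom := fun U =>
    τ.toImage_app_injective ⟨chowToBase q n ⁻¹ᵁ U.1, U.2.isAffineOpen.preimage _⟩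
  have hcov : ∀ x, ∃ U : {U : X.Opens // IsCoordinateOpen q d U}, x ∈ U.1 := fun x =>
    let ⟨U, hU, hx⟩ := hX x; ⟨⟨U, hU⟩, hx⟩
  have hinj' : ∀ U : {U : X.Opens // IsCoordinateOpen q d U},
      Function.Injective (overApp hν U.1) := fun U =>
    (overApp_injective_iff hν U.1).mpr (hinj U)
  have : IsIntegral τ.image := by
    refine isIntegral_of_isAffineHom f' (fun U : {U : X.Opens // IsCoordinateOpen q d U} => U.1)
      (fun U => U.2.isAffineOpen) hcov (fun U => ?_) fun U => ?_
    · have := U.2.isDomain_chowProd α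
      exact (hinj' U).isDomain _
    · have h1 := U.2.chowProdToBase_app_injective α
      rw [← overApp_comp_app hν U.1] at h1
      exact Function.Injective.of_comp (f := overApp hν U.1) h1
  -- Pullback along `τ` passes through the sections of the image, so integral equations and
  -- fractions over the Chow scheme yield ones over the image.
  have hc (U : X.Opens) : (overApp hν U).comp (overApp (g := τ.imageι) (f := f') rfl U) =
      overApp hτ.toBase U := overApp_comp _ _ _ τ.toImage_imageι U
  refine IsNormalization.of_over hν (fun U : {U : X.Opens // IsCoordinateOpen q d U} => U.1)
    (fun U => U.2.isAffineOpen) hcov (fun U => U.2.isDomain_chowProd α)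
    (fun U => U.2.isIntegrallyClosed_chowProd α) hinj (fun U y => ?_) fun U y => ?_
  · obtain ⟨p, hp, hp'⟩ := (U.2.isIntegral_and_exists_mul_eq α hd hα hτ y).1
    refine ⟨p.map (overApp (g := τ.imageι) (f := f') rfl U.1), hp.map _, ?_⟩
    rw [Polynomial.eval₂_map, hc]
    exact hp'
  · obtain ⟨a, b, ha, hab⟩ := (U.2.isIntegral_and_exists_mul_eq α hd hα hτ y).2
    rw [← hc] at ha hab
    exact ⟨_, _, fun h => ha ((congr_arg (overApp hν U.1) h).trans (map_zero _)), hab⟩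

theorem exists_isNormalization_reducedClosure (hd : 0 < d)
    (hα : ∑ j : Fin s, ((j : ℕ) + 1) * α j = n) {τ : chowProd q α ⟶ Chow q n}
    (hτ : IsAdditionMorphism q α τ) :
    ∃ ν : chowProd q α ⟶ reducedClosure (Chow q n) (chowStratum q α n),
      ν ≫ reducedClosureι (Chow q n) (chowStratum q α n) = τ ∧ IsNormalization ν := by
  have := isIntegral_fiberPowerProd α hX
  have := isIntegral_chowProd α hX
  have := isDominant_chowProdMap (α := α) hX
  have hτa : IsAffineHom τ := isAffineHom_of_comp τ (chowToBase q n) (by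
    rw [hτ.toBase]; infer_instance)
  obtain ⟨c, hc⟩ := exists_isBlockDecomposition hα
  obtain ⟨U, hU, -⟩ := hX (genericPoint X)
  have h := vanishingIdeal_closure_range τ _
    (closure_chowStratum hτ (fun b b' => hU.partProj_injective hd b b') hc)
  unfold reducedClosure reducedClosureι
  rw [h]
  exact ⟨τ.toImage, τ.toImage_imageι, isNormalization_toImage hX hd hα hτ⟩

end Main

section Cotangent

variable {k : Type u} [Field k] {X : Scheme.{u}} (p : X ⟶ Spec (.of k))

include p in
lemma nonempty_algebra_rat [CharZero k] (U : X.Opens) : Nonempty (Algebra ℚ Γ(X, U)) :=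
  ⟨((structureHom p U).comp (algebraMap ℚ k)).toAlgebra⟩

/-- A standard smooth neighbourhood provides both the fibre coordinates and, being étale over affine
space, the integral closedness of the base ring. -/
lemma exists_isCoordinateOpen [CharZero k] [IsIntegral X] [Smooth p] (d : ℕ)
    [SmoothOfRelativeDimension d p] (x : X) :
    ∃ U : X.Opens, IsCoordinateOpen (cotangentBundleToBase p) d U ∧ x ∈ U := by
  obtain ⟨U, hU, hx⟩ := exists_isStandardOpen p d x
  have : Nonempty U := ⟨⟨x, hx⟩⟩
  exact ⟨U, ⟨hU.1, this, hU.isIntegrallyClosed, hU.exists_mvPolynomial_equiv,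
    nonempty_algebra_rat p U⟩, hx⟩

end Cotangent
end AlgebraicGeometry.Scheme

theorem mainTheorem3 {k : Type u} [Field k] [IsAlgClosed k] [CharZero k]
    (X : Scheme.{u}) (p : X ⟶ Spec (.of k)) [IsIntegral X] [Smooth p]
    [SmoothOfRelativeDimension 2 p] (hp : IsProjective p)
    {n s : ℕ} (α : Fin s → ℕ) (hα : ∑ j : Fin s, ((j : ℕ) + 1) * α j = n) :
    (∃! τ : chowProd (cotangentBundleToBase p) α ⟶ Chow (cotangentBundleToBase p) n,
      IsAdditionMorphism (cotangentBundleToBase p) α τ) ∧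
    ∀ τ : chowProd (cotangentBundleToBase p) α ⟶ Chow (cotangentBundleToBase p) n,
      IsAdditionMorphism (cotangentBundleToBase p) α τ →
      ∃ ν : chowProd (cotangentBundleToBase p) α ⟶
          reducedClosure (Chow (cotangentBundleToBase p) n)
            (chowStratum (cotangentBundleToBase p) α n),
        ν ≫ reducedClosureι (Chow (cotangentBundleToBase p) n)
            (chowStratum (cotangentBundleToBase p) α n) = τ ∧ IsNormalization ν :=
  ⟨existsUnique_isAdditionMorphism (fun U _ => nonempty_algebra_rat p U) hα,
    fun _ hτ => exists_isNormalization_reducedClosure (exists_isCoordinateOpen p 2) two_pos hα hτ⟩
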